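/- Let $\mathcal C$ be a braided monoidal category with braiding $\Phi$, and let $H$ be a Hopf algebra in $\mathcal C$ with multiplication $\nabla$, unit $\eta$, comultiplication $\Delta$, counit $\varepsilon$ and invertible antipode $S$. Suppose that $H$ is finite, i.e. has a dual $H^*$ with evaluation $ev:H^*\otimes H\to I$ and coevaluation (dual basis) $d:I\to H\otimes H^*$, and suppose that $\Phi_{H,M}$ is symmetric, i.e. $\Phi_{H,M}=\Phi_{M,H}^{-1}$, for every object $M$ of $\mathcal C$. *Yetter–Drinfel'd modules.* A left-right Yetter–Drinfel'd module over $H$ is an object $M$ with a left $H$-module structure $\alpha_M:H\otimes M\to M$ and a right $H$-comodule structure $\rho_M:M\to M\otimes H$ such that $$(M\otimes\nabla)(\rho_M\otimes H)\,\Phi_{M,H}^{-1}\,(H\otimes\alpha_M)(\Delta\otimes M)=(\alpha_M\otimes\nabla)(H\otimes\Phi_{H,M}\otimes H)(\Delta\otimes\rho_M)$$ as morphisms $H\otimes M\to M\otimes H$ (associativity constraints suppressed). Morphisms are the morphisms of $\mathcal C$ that are $H$-linear and $H$-colinear. Denote the category by ${}_H\mathcal{YD}(\mathcal C)^{H^{op}}$;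 the tensor product of $M$ and $N$ is $M\otimes N$ with the diagonal action $(\alpha_M\otimes\alpha_N)(H\otimes\Phi_{H,M}\otimes N)(\Delta\otimes M\otimes N)$ and the codiagonal $H^{op}$-coaction $(M\otimes N\otimes\nabla\Phi_{H,H})(M\otimes\Phi_{H,N}\otimes H)(\rho_M\otimes\rho_N)$, the unit is $I$ with action $\varepsilon$ and coaction $\eta$. *Drinfel'd double.* Let $B=(H^{op})^*$ be the object $H^*$ with multiplication dual to $\Delta$, unit dual to $\varepsilon$, comultiplication dual to $\nabla\Phi_{H,H}$ and counit dual to $\eta$. In elements (to be read as morphisms of $\mathcal C$, with braidings for all permutations of factors): $(fg)(h)=f(h_1)g(h_2)$ and $f_1(h)f_2(k)=f(kh)$. Let $H$ act on $B$ from the left and $B$ on $H$ from the right by $$(h\rightharpoonup f)(k)=f\big(S^{-1}(h_2)\,k\,h_1\big),\qquad h\leftharpoonup f=h_2\,f\big(S^{-1}(h_3)h_1\big).$$ The Drinfel'd double $D(H)=(H^{op})^*\bowtie H$ is $H^*\otimes H$ with multiplication $$(f\bowtie h)(f'\bowtie h')=f\,(h_1\rightharpoonup f'_1)\bowtie(h_2\leftharpoonup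 f'_2)\,h',$$ unit $\eta_B\otimes\eta_H$, the tensor product comultiplication $(B\otimes\Phi_{B,H}\otimes H)(\Delta_B\otimes\Delta_H)$ and counit $\varepsilon_B\otimes\varepsilon_H$. Its canonical $R$-matrix is $R=\eta_B\otimes d\otimes\eta_H: I\to D(H)\otimes D(H)$. **Statement.** 1. $D(H)$ is a bialgebra in $\mathcal C$; hence the category ${}_{D(H)}\mathcal C$ of left $D(H)$-modules is monoidal with the diagonal action. 2. ${}_H\mathcal{YD}(\mathcal C)^{H^{op}}$ is closed under the tensor product above and contains the unit, and is a braided monoidal category with braiding $(N\otimes\alpha_M)(\rho_N\otimes M)\Phi_{M,N}:M\otimes N\to N\otimes M$. 3. ${}_{D(H)}\mathcal C$ is a braided monoidal category with the braiding $M\otimes N\to N\otimes M$ given by acting with the two legs of $R$ on $M$ and $N$ and then applying $\Phi_{M,N}$. 4. Sending a $D(H)$-module $M$ to the object $M$ with the $H$-action obtained by restriction along $\eta_B\otimes H:H\to D(H)$ and the coaction $$M\xrightarrow{\,d\otimes M\,}H\otimes H^*\otimes M\longrightarrow H\otimes M\xrightarrow{\,\Phi_{H,M}\,}M\otimes H$$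 (the middle arrow being the action of $H^*$ on $M$ through $H^*\otimes\eta_H:H^*\to D(H)$), and a morphism to itself, is a functor ${}_{D(H)}\mathcal C\to{}_H\mathcal{YD}(\mathcal C)^{H^{op}}$ which is an isomorphism of categories and is braided strict monoidal. In particular the two categories are isomorphic as braided monoidal categories. -/

import Mathlib

open CategoryTheory MonoidalCategory
open scoped MonObj ComonObj HopfObj

universe v u

namespace BraidedDouble

noncomputable section

section Diagonal

/-! ### Diagonal actions and codiagonal coactions -/

variable {C : Type u} [Category.{v} C] [MonoidalCategory C]

theorem assoc_exchange {A B A' B' P Q : C} (f : A ⟶ A') (g : B ⟶ B') (X : B' ⊗ P ⟶ Q) :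
    (f ⊗ₘ g) ▷ P ≫ (α_ A' B' P).hom ≫ A' ◁ X = (α_ A B P).hom ≫ A ◁ (g ▷ P ≫ X) ≫ f ▷ Q := by
  rw [← tensorHom_id, associator_naturality_assoc, ← tensorHom_def', ← id_tensorHom,
    tensorHom_comp_tensorHom, Category.comp_id, tensorHom_id]

variable [BraidedCategory C]

/-- The diagonal action `A ⊗ (M ⊗ N) ⟶ M ⊗ N` on the tensor product of two objects on which the
comonoid `A` acts by `a` and `b`: comultiply, move the second factor past `M`, act. -/
def diagAct {A : C} [ComonObj A] {M N : C} (a : A ⊗ M ⟶ M) (b : A ⊗ N ⟶ N) :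
    A ⊗ (M ⊗ N) ⟶ M ⊗ N :=
  Δ[A] ▷ (M ⊗ N) ≫ tensorμ A A M N ≫ (a ⊗ₘ b)

/-- The trivial action `A ⊗ 𝟙 ⟶ 𝟙`. -/
def unitAct (A : C) [ComonObj A] : A ⊗ 𝟙_ C ⟶ 𝟙_ C := (ρ_ A).hom ≫ ε[A]

theorem diagAct_natural {A : C} [ComonObj A] {M N M' N' : C} {a : A ⊗ M ⟶ M} {b : A ⊗ N ⟶ N}
    {a' : A ⊗ M' ⟶ M'} {b' : A ⊗ N' ⟶ N'} {f : M ⟶ M'} {g : N ⟶ N'}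
    (hf : a ≫ f = A ◁ f ≫ a') (hg : b ≫ g = A ◁ g ≫ b') :
    diagAct a b ≫ (f ⊗ₘ g) = A ◁ (f ⊗ₘ g) ≫ diagAct a' b' := by
  simp only [diagAct, Category.assoc, tensorHom_comp_tensorHom, hf, hg]
  rw [whisker_exchange_assoc, tensorμ_natural_right_assoc, tensorHom_comp_tensorHom]

theorem diagAct_assoc {A : C} [ComonObj A] {M N L : C} (a : A ⊗ M ⟶ M) (b : A ⊗ N ⟶ N)
    (c : A ⊗ L ⟶ L) :
    diagAct (diagAct a b) c ≫ (α_ M N L).hom = A ◁ (α_ M N L).hom ≫ diagAct a (diagAct b c) := by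
  have h1 : (diagAct a b ⊗ₘ c) = (Δ[A] ▷ (M ⊗ N) ⊗ₘ 𝟙 (A ⊗ L)) ≫
      tensorμ A A M N ▷ (A ⊗ L) ≫ ((a ⊗ₘ b) ⊗ₘ c) := by
    rw [← tensorHom_id (tensorμ A A M N), tensorHom_comp_tensorHom, tensorHom_comp_tensorHom]
    simp [diagAct]
  have h2 : (a ⊗ₘ diagAct b c) = (𝟙 (A ⊗ M) ⊗ₘ Δ[A] ▷ (N ⊗ L)) ≫
      (A ⊗ M) ◁ tensorμ A A N L ≫ (a ⊗ₘ b ⊗ₘ c) := by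
    rw [← id_tensorHom _ (tensorμ A A N L), tensorHom_comp_tensorHom, tensorHom_comp_tensorHom]
    simp [diagAct]
  have e := associator_monoidal A A A M N L
  have n1 := tensorμ_natural_left Δ[A] (𝟙 A) (M ⊗ N) L
  have n2 := tensorμ_natural_left (𝟙 A) Δ[A] M (N ⊗ L)
  have hΔ := ComonObj.comul_assoc A
  rw [id_whiskerRight] at n1 n2
  rw [diagAct, h1, diagAct, h2]
  simp only [Category.assoc, associator_naturality]
  rw [← reassoc_of% n1, ← reassoc_of% n2, reassoc_of% e, whisker_exchange_assoc,
    tensorHom_def (α_ A A A).hom]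
  simp only [tensorHom_id, id_tensorHom, Category.assoc, ← whisker_exchange_assoc]
  simp only [← comp_whiskerRight_assoc, hΔ]

theorem diagAct_leftUnitor {A : C} [ComonObj A] {M : C} (a : A ⊗ M ⟶ M) :
    diagAct (unitAct A) a ≫ (λ_ M).hom = A ◁ (λ_ M).hom ≫ a := by
  have h1 : (unitAct A ⊗ₘ a) = (ε[A] ▷ 𝟙_ C ⊗ₘ 𝟙 A ▷ M) ≫ (𝟙_ C ⊗ 𝟙_ C) ◁ a ≫
      (λ_ (𝟙_ C)).hom ▷ M := by
    rw [← tensorHom_def', tensorHom_comp_tensorHom]; simp [unitAct, unitors_equal]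
  have n1 := tensorμ_natural_left ε[A] (𝟙 A) (𝟙_ C) M
  have e := leftUnitor_monoidal A M
  rw [diagAct, h1]
  simp only [Category.assoc]
  rw [← reassoc_of% n1, tensorHom_id, ← comp_whiskerRight_assoc, ComonObj.counit_comul]
  have : (𝟙_ C ⊗ 𝟙_ C) ◁ a ≫ (λ_ (𝟙_ C)).hom ▷ M ≫ (λ_ M).hom =
      (λ_ (𝟙_ C)).hom ▷ (A ⊗ M) ≫ (λ_ (A ⊗ M)).hom ≫ a := by
    rw [whisker_exchange_assoc, leftUnitor_naturality]
  rw [this, ← reassoc_of% e, MonoidalCategory.tensorHom_def]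
  simp

theorem diagAct_rightUnitor {A : C} [ComonObj A] {M : C} (a : A ⊗ M ⟶ M) :
    diagAct a (unitAct A) ≫ (ρ_ M).hom = A ◁ (ρ_ M).hom ≫ a := by
  have h1 : (a ⊗ₘ unitAct A) = (𝟙 A ▷ M ⊗ₘ ε[A] ▷ 𝟙_ C) ≫ a ▷ (𝟙_ C ⊗ 𝟙_ C) ≫
      M ◁ (λ_ (𝟙_ C)).hom := by
    rw [← MonoidalCategory.tensorHom_def, tensorHom_comp_tensorHom]; simp [unitAct, unitors_equal]
  have n1 := tensorμ_natural_left (𝟙 A) ε[A] M (𝟙_ C)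
  have e := rightUnitor_monoidal A M
  rw [diagAct, h1]
  simp only [Category.assoc]
  rw [← reassoc_of% n1, id_tensorHom, ← comp_whiskerRight_assoc, ComonObj.comul_counit]
  have : a ▷ (𝟙_ C ⊗ 𝟙_ C) ≫ M ◁ (λ_ (𝟙_ C)).hom ≫ (ρ_ M).hom =
      (A ⊗ M) ◁ (λ_ (𝟙_ C)).hom ≫ (ρ_ (A ⊗ M)).hom ≫ a := by
    rw [← whisker_exchange_assoc, rightUnitor_naturality]
  rw [this, ← reassoc_of% e, MonoidalCategory.tensorHom_def]
  simp

/-- The multiplication `∇ ∘ Φ` of the opposite algebra `A^op`. -/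
def opMul (A : C) [MonObj A] : A ⊗ A ⟶ A := (β_ A A).hom ≫ μ[A]

theorem opMul_assoc (A : C) [MonObj A] :
    opMul A ▷ A ≫ opMul A = (α_ A A A).hom ≫ A ◁ opMul A ≫ opMul A := by
  have y := BraidedCategory.yang_baxter A A A
  simp only [opMul, comp_whiskerRight, MonoidalCategory.whiskerLeft_comp, Category.assoc,
    BraidedCategory.braiding_naturality_left_assoc, BraidedCategory.braiding_naturality_right_assoc,
    BraidedCategory.braiding_tensor_left_hom, BraidedCategory.braiding_tensor_right_hom,
    MonObj.mul_assoc]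
  rw [MonObj.mul_assoc_flip, ← reassoc_of% y]
  simp

theorem opMul_one (A : C) [MonObj A] : A ◁ η[A] ≫ opMul A = (ρ_ A).hom := by
  simp [opMul]

theorem one_opMul (A : C) [MonObj A] : η[A] ▷ A ≫ opMul A = (λ_ A).hom := by
  simp [opMul]

/-- The codiagonal `A^op`-coaction on the tensor product of two objects on which `A` coacts by
`a` and `b`: coact, move the first factor `A` past `N`, multiply in `A^op`. -/
def diagCoact {A : C} [MonObj A] {M N : C} (a : M ⟶ M ⊗ A) (b : N ⟶ N ⊗ A) :
    M ⊗ N ⟶ (M ⊗ N) ⊗ A :=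
  (a ⊗ₘ b) ≫ tensorμ M A N A ≫ (M ⊗ N) ◁ opMul A

/-- The trivial coaction `𝟙 ⟶ 𝟙 ⊗ A`. -/
def unitCoact (A : C) [MonObj A] : 𝟙_ C ⟶ 𝟙_ C ⊗ A := η[A] ≫ (λ_ A).inv

theorem diagCoact_natural {A : C} [MonObj A] {M N M' N' : C} {a : M ⟶ M ⊗ A} {b : N ⟶ N ⊗ A}
    {a' : M' ⟶ M' ⊗ A} {b' : N' ⟶ N' ⊗ A} {f : M ⟶ M'} {g : N ⟶ N'}
    (hf : a ≫ f ▷ A = f ≫ a') (hg : b ≫ g ▷ A = g ≫ b') :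
    diagCoact a b ≫ (f ⊗ₘ g) ▷ A = (f ⊗ₘ g) ≫ diagCoact a' b' := by
  have n := tensorμ_natural f (𝟙 A) g (𝟙 A)
  simp only [tensorHom_id] at n
  simp only [diagCoact, Category.assoc, whisker_exchange, tensorHom_comp_tensorHom_assoc, ← hf, ← hg]
  simp only [← tensorHom_comp_tensorHom_assoc]
  rw [reassoc_of% n]
  simp

theorem diagCoact_assoc {A : C} [MonObj A] {M N L : C} (a : M ⟶ M ⊗ A) (b : N ⟶ N ⊗ A)
    (c : L ⟶ L ⊗ A) :
    diagCoact (diagCoact a b) c ≫ (α_ M N L).hom ▷ A =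
      (α_ M N L).hom ≫ diagCoact a (diagCoact b c) := by
  have h1 : (diagCoact a b ⊗ₘ c) = ((a ⊗ₘ b) ⊗ₘ c) ≫ tensorμ M A N A ▷ (L ⊗ A) ≫
      ((M ⊗ N) ◁ opMul A ⊗ₘ 𝟙 (L ⊗ A)) := by
    rw [← tensorHom_id (tensorμ M A N A), tensorHom_comp_tensorHom, tensorHom_comp_tensorHom]
    simp [diagCoact]
  have h2 : (a ⊗ₘ diagCoact b c) = (a ⊗ₘ b ⊗ₘ c) ≫ (M ⊗ A) ◁ tensorμ N A L A ≫
      (𝟙 (M ⊗ A) ⊗ₘ (N ⊗ L) ◁ opMul A) := by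
    rw [← id_tensorHom _ (tensorμ N A L A), tensorHom_comp_tensorHom, tensorHom_comp_tensorHom]
    simp [diagCoact]
  have e := tensor_associativity M A N A L A
  have n1 := tensorμ_natural (𝟙 (M ⊗ N)) (opMul A) (𝟙 L) (𝟙 A)
  have n2 := tensorμ_natural (𝟙 M) (𝟙 A) (𝟙 (N ⊗ L)) (opMul A)
  simp only [id_whiskerRight, id_tensorHom, tensorHom_id] at n1 n2
  rw [diagCoact, h1, diagCoact, h2]
  simp only [Category.assoc, id_tensorHom, tensorHom_id]
  rw [reassoc_of% n1, reassoc_of% n2, ← MonoidalCategory.whiskerLeft_comp_assoc, opMul_assoc,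
    ← associator_naturality_assoc, ← reassoc_of% e, MonoidalCategory.tensorHom_def (α_ M N L).hom]
  simp only [MonoidalCategory.whiskerLeft_comp, Category.assoc, whisker_exchange,
    whisker_exchange_assoc]

theorem diagCoact_leftUnitor {A : C} [MonObj A] {M : C} (a : M ⟶ M ⊗ A) :
    diagCoact (unitCoact A) a ≫ (λ_ M).hom ▷ A = (λ_ M).hom ≫ a := by
  have h1 : (unitCoact A ⊗ₘ a) = 𝟙_ C ◁ a ≫ (λ_ (𝟙_ C)).inv ▷ (M ⊗ A) ≫
      ((𝟙 (𝟙_ C) ⊗ₘ η[A]) ⊗ₘ (𝟙 M ⊗ₘ 𝟙 A)) := by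
    rw [id_tensorHom_id, tensorHom_id, ← comp_whiskerRight, ← tensorHom_def']
    simp [unitCoact]
  have n1 := tensorμ_natural (𝟙 (𝟙_ C)) η[A] (𝟙 M) (𝟙 A)
  rw [diagCoact, h1]
  simp only [Category.assoc]
  rw [reassoc_of% n1, id_tensorHom_id, id_tensorHom, tensorHom_id,
    ← MonoidalCategory.whiskerLeft_comp_assoc, one_opMul, ← tensorHom_def',
    ← tensor_left_unitality, leftUnitor_naturality]

theorem diagCoact_rightUnitor {A : C} [MonObj A] {M : C} (a : M ⟶ M ⊗ A) :
    diagCoact a (unitCoact A) ≫ (ρ_ M).hom ▷ A = (ρ_ M).hom ≫ a := by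
  have h1 : (a ⊗ₘ unitCoact A) = a ▷ 𝟙_ C ≫ (M ⊗ A) ◁ (λ_ (𝟙_ C)).inv ≫
      ((𝟙 M ⊗ₘ 𝟙 A) ⊗ₘ (𝟙 (𝟙_ C) ⊗ₘ η[A])) := by
    rw [id_tensorHom_id, id_tensorHom, ← MonoidalCategory.whiskerLeft_comp,
      ← MonoidalCategory.tensorHom_def]
    simp [unitCoact]
  have n1 := tensorμ_natural (𝟙 M) (𝟙 A) (𝟙 (𝟙_ C)) η[A]
  rw [diagCoact, h1]
  simp only [Category.assoc]
  rw [reassoc_of% n1, id_tensorHom_id, id_tensorHom, id_tensorHom,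
    ← MonoidalCategory.whiskerLeft_comp_assoc, opMul_one, ← tensorHom_def',
    ← tensor_right_unitality, rightUnitor_naturality]

variable {A : C} [BimonObj A]

theorem diagAct_one {M N : C} {a : A ⊗ M ⟶ M} {b : A ⊗ N ⟶ N}
    (ha : η[A] ▷ M ≫ a = (λ_ M).hom) (hb : η[A] ▷ N ≫ b = (λ_ N).hom) :
    η[A] ▷ (M ⊗ N) ≫ diagAct a b = (λ_ (M ⊗ N)).hom := by
  rw [diagAct, ← comp_whiskerRight_assoc, BimonObj.one_comul, MonObj.tensorObj.one_def,
    comp_whiskerRight_assoc, tensorμ_natural_left_assoc, tensorHom_comp_tensorHom, ha, hb,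
    ← tensor_left_unitality]

theorem diagAct_mul {M N : C} {a : A ⊗ M ⟶ M} {b : A ⊗ N ⟶ N}
    (ha : μ[A] ▷ M ≫ a = (α_ A A M).hom ≫ A ◁ a ≫ a)
    (hb : μ[A] ▷ N ≫ b = (α_ A A N).hom ≫ A ◁ b ≫ b) :
    μ[A] ▷ (M ⊗ N) ≫ diagAct a b =
      (α_ A A (M ⊗ N)).hom ≫ A ◁ diagAct a b ≫ diagAct a b := by
  rw [diagAct, ← comp_whiskerRight_assoc, BimonObj.mul_comul]
  simp only [comp_whiskerRight, Category.assoc]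
  rw [tensorμ_natural_left_assoc, tensorHom_comp_tensorHom, ha, hb, ← tensorHom_comp_tensorHom,
    ← tensorHom_comp_tensorHom]
  have e := tensor_associativity A A A A M N
  rw [reassoc_of% e, ← tensorμ_natural_right_assoc, ← whiskerLeft_comp_assoc,
    reassoc_of% (assoc_exchange Δ[A] Δ[A] (tensorμ A A M N ≫ (a ⊗ₘ b)))]


end Diagonal

section Modules

/-! ### Left modules over a bimonoid form a monoidal category -/

variable {C : Type u} [Category.{v} C] [MonoidalCategory C]

theorem mod_comm {A : C} [MonObj A] {M N : Mod C A} (f : M ⟶ N) :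
    γ[A, M.X] ≫ f.hom = A ◁ f.hom ≫ γ[A, N.X] :=
  IsModHom.smul_hom

theorem restrict_natural {A T : C} [MonObj A] {M N : Mod C A} (f : M ⟶ N) (g : T ⟶ A) :
    (g ▷ M.X ≫ γ[A, M.X]) ≫ f.hom = T ◁ f.hom ≫ g ▷ N.X ≫ γ[A, N.X] := by
  rw [Category.assoc, mod_comm, whisker_exchange_assoc]

variable [BraidedCategory C] {A : C} [BimonObj A]

/-- The tensor product of two `A`-modules, with the diagonal action. -/
def modTensor (M N : Mod C A) : Mod C A where
  X := M.X ⊗ N.X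
  mod :=
    { smul := diagAct γ[A, M.X] γ[A, N.X]
      one_smul := diagAct_one (ModObj.one_smul_self A M.X) (ModObj.one_smul_self A N.X)
      mul_smul := diagAct_mul (ModObj.mul_smul_self A M.X) (ModObj.mul_smul_self A N.X) }

variable (A) in
/-- The unit object with the trivial action. -/
def modUnit : Mod C A where
  X := 𝟙_ C
  mod :=
    { smul := unitAct A
      one_smul := by
        change η[A] ▷ 𝟙_ C ≫ (ρ_ A).hom ≫ ε[A] = (λ_ (𝟙_ C)).hom
        rw [rightUnitor_naturality_assoc, BimonObj.one_counit, Category.comp_id, unitors_equal]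
      mul_smul := by
        change μ[A] ▷ 𝟙_ C ≫ (ρ_ A).hom ≫ ε[A] =
          (α_ A A (𝟙_ C)).hom ≫ A ◁ ((ρ_ A).hom ≫ ε[A]) ≫ (ρ_ A).hom ≫ ε[A]
        rw [rightUnitor_naturality_assoc, BimonObj.mul_counit, MonoidalCategory.whiskerLeft_comp,
          Category.assoc, Comon.tensorObj_counit]
        simp [MonoidalCategory.tensorHom_def', unitors_equal] }

/-- A linear isomorphism of underlying objects is an isomorphism of modules. -/
def modIso {M N : Mod C A} (e : M.X ≅ N.X) (h : γ[A, M.X] ≫ e.hom = A ◁ e.hom ≫ γ[A, N.X]) :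
    M ≅ N where
  hom := Mod.Hom.mk' e.hom h
  inv := Mod.Hom.mk' e.inv (by
    change γ[A, N.X] ≫ e.inv = A ◁ e.inv ≫ γ[A, M.X]
    rw [Iso.comp_inv_eq, Category.assoc, h]; simp)
  hom_inv_id := by ext; exact e.hom_inv_id
  inv_hom_id := by ext; exact e.inv_hom_id

instance : MonoidalCategoryStruct (Mod C A) where
  tensorObj M N := modTensor M N
  tensorUnit := modUnit A
  tensorHom {M N M' N'} f g := Mod.Hom.mk' (M := modTensor M M') (N := modTensor N N')
    (f.hom ⊗ₘ g.hom) (diagAct_natural (mod_comm f) (mod_comm g))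
  whiskerLeft M {N N'} g := Mod.Hom.mk' (M := modTensor M N) (N := modTensor M N')
    (M.X ◁ g.hom) (by
      rw [← id_tensorHom]; exact diagAct_natural (mod_comm (𝟙 M)) (mod_comm g))
  whiskerRight {M M'} f N := Mod.Hom.mk' (M := modTensor M N) (N := modTensor M' N)
    (f.hom ▷ N.X) (by
      rw [← tensorHom_id]; exact diagAct_natural (mod_comm f) (mod_comm (𝟙 N)))
  associator M N L := modIso (M := modTensor (modTensor M N) L) (N := modTensor M (modTensor N L))
    (α_ M.X N.X L.X) (diagAct_assoc _ _ _)
  leftUnitor M := modIso (M := modTensor (modUnit A) M) (λ_ M.X) (diagAct_leftUnitor _)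
  rightUnitor M := modIso (M := modTensor M (modUnit A)) (ρ_ M.X) (diagAct_rightUnitor _)

instance : (Mod.forget (D := C) A).Faithful where
  map_injective h := Mod.hom_ext _ _ h

instance : MonoidalCategory (Mod C A) :=
  Monoidal.induced (Mod.forget A)
    { μIso _ _ := Iso.refl _
      εIso := Iso.refl _
      whiskerLeft_eq X {_ _} f := by
        change X.X ◁ f.hom = 𝟙 _ ≫ X.X ◁ f.hom ≫ 𝟙 _
        simp
      whiskerRight_eq {_ _} f X := by
        change f.hom ▷ X.X = 𝟙 _ ≫ f.hom ▷ X.X ≫ 𝟙 _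
        simp
      tensorHom_eq {_ _ _ _} f g := by
        change f.hom ⊗ₘ g.hom = 𝟙 _ ≫ (f.hom ⊗ₘ g.hom) ≫ 𝟙 _
        simp
      associator_eq X Y Z := by
        change (α_ X.X Y.X Z.X).hom = (𝟙 _ ≫ (𝟙 _ ⊗ₘ 𝟙 _)) ≫ (α_ X.X Y.X Z.X).hom ≫ (𝟙 _ ⊗ₘ 𝟙 _) ≫ 𝟙 _
        simp
      leftUnitor_eq X := by
        change (λ_ X.X).hom = (𝟙 _ ≫ (𝟙 _ ⊗ₘ 𝟙 _)) ≫ (λ_ X.X).hom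
        simp
      rightUnitor_eq X := by
        change (ρ_ X.X).hom = (𝟙 _ ≫ (𝟙 _ ⊗ₘ 𝟙 _)) ≫ (ρ_ X.X).hom
        simp }

/-- For a morphism `R : 𝟙 ⟶ A ⊗ A`, the morphism `M ⊗ N ⟶ N ⊗ M` that inserts `R`, lets its two
legs act on `M` and `N`, and applies the braiding of `C`. -/
def braidingOfR (R : 𝟙_ C ⟶ A ⊗ A) (M N : Mod C A) : M.X ⊗ N.X ⟶ N.X ⊗ M.X :=
  (λ_ (M.X ⊗ N.X)).inv ≫ R ▷ (M.X ⊗ N.X) ≫ tensorμ A A M.X N.X ≫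
    (γ[A, M.X] ⊗ₘ γ[A, N.X]) ≫ (β_ M.X N.X).hom

end Modules

section YetterDrinfeld

/-! ### Left-right Yetter-Drinfel'd modules -/

variable {C : Type u} [Category.{v} C] [MonoidalCategory C]

/-- An object with a morphism `H ⊗ X ⟶ X` and a morphism `X ⟶ X ⊗ H`, subject to no conditions.
The module, comodule and compatibility axioms are imposed in `isYD`. -/
structure ActCoact (H : C) where
  /-- The underlying object. -/
  X : C
  /-- The action morphism. -/
  act : H ⊗ X ⟶ X
  /-- The coaction morphism. -/
  coact : X ⟶ X ⊗ H

namespace ActCoact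

/-- Morphisms that are both `H`-linear and `H`-colinear. -/
@[ext]
structure Hom {H : C} (M N : ActCoact H) where
  /-- The underlying morphism. -/
  hom : M.X ⟶ N.X
  linear : M.act ≫ hom = H ◁ hom ≫ N.act
  colinear : M.coact ≫ hom ▷ H = hom ≫ N.coact

variable {H : C}

instance : Category (ActCoact H) where
  Hom M N := Hom M N
  id M := ⟨𝟙 M.X, by simp, by simp⟩
  comp f g := ⟨f.hom ≫ g.hom, by rw [reassoc_of% f.linear, g.linear]; simp,
    by rw [comp_whiskerRight, reassoc_of% f.colinear, g.colinear, Category.assoc]⟩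

@[ext]
theorem hom_ext {M N : ActCoact H} {f g : M ⟶ N} (h : f.hom = g.hom) : f = g := Hom.ext h

@[simp] theorem id_hom (M : ActCoact H) : Hom.hom (𝟙 M) = 𝟙 M.X := rfl

@[simp] theorem comp_hom {M N L : ActCoact H} (f : M ⟶ N) (g : N ⟶ L) :
    (f ≫ g).hom = f.hom ≫ g.hom := rfl

variable (H) in
/-- The forgetful functor to `C`. -/
@[simps]
def forget : ActCoact H ⥤ C where
  obj M := M.X
  map f := f.hom

instance : (forget H).Faithful where
  map_injective h := hom_ext h

/-- An isomorphism of underlying objects that is linear and colinear. -/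
def mkIso {M N : ActCoact H} (e : M.X ≅ N.X) (h : M.act ≫ e.hom = H ◁ e.hom ≫ N.act)
    (h' : M.coact ≫ e.hom ▷ H = e.hom ≫ N.coact) : M ≅ N where
  hom := ⟨e.hom, h, h'⟩
  inv := ⟨e.inv, by rw [Iso.comp_inv_eq, Category.assoc, h]; simp,
    by rw [Iso.eq_inv_comp, ← reassoc_of% h']; simp⟩
  hom_inv_id := by ext; exact e.hom_inv_id
  inv_hom_id := by ext; exact e.inv_hom_id

variable [BraidedCategory C] [BimonObj H]

/-- Tensor products carry the diagonal `H`-action and the codiagonal `H^op`-coaction. -/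
instance : MonoidalCategoryStruct (ActCoact H) where
  tensorObj M N := ⟨M.X ⊗ N.X, diagAct M.act N.act, diagCoact M.coact N.coact⟩
  tensorUnit := ⟨𝟙_ C, unitAct H, unitCoact H⟩
  tensorHom f g := ⟨f.hom ⊗ₘ g.hom, diagAct_natural f.linear g.linear,
    diagCoact_natural f.colinear g.colinear⟩
  whiskerLeft M _ _ g := ⟨M.X ◁ g.hom,
    by have h := diagAct_natural (Hom.linear (𝟙 M)) g.linear; rwa [id_hom, id_tensorHom] at h,
    by have h := diagCoact_natural (Hom.colinear (𝟙 M)) g.colinear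
       rwa [id_hom, id_tensorHom] at h⟩
  whiskerRight f N := ⟨f.hom ▷ N.X,
    by have h := diagAct_natural f.linear (Hom.linear (𝟙 N)); rwa [id_hom, tensorHom_id] at h,
    by have h := diagCoact_natural f.colinear (Hom.colinear (𝟙 N))
       rwa [id_hom, tensorHom_id] at h⟩
  associator M N L := mkIso (α_ M.X N.X L.X) (diagAct_assoc _ _ _) (diagCoact_assoc _ _ _)
  leftUnitor M := mkIso (λ_ M.X) (diagAct_leftUnitor _) (diagCoact_leftUnitor _)
  rightUnitor M := mkIso (ρ_ M.X) (diagAct_rightUnitor _) (diagCoact_rightUnitor _)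

instance : MonoidalCategory (ActCoact H) :=
  Monoidal.induced (forget H)
    { μIso _ _ := Iso.refl _
      εIso := Iso.refl _
      whiskerLeft_eq X {_ _} f := by
        change X.X ◁ f.hom = 𝟙 _ ≫ X.X ◁ f.hom ≫ 𝟙 _
        simp
      whiskerRight_eq {_ _} f X := by
        change f.hom ▷ X.X = 𝟙 _ ≫ f.hom ▷ X.X ≫ 𝟙 _
        simp
      tensorHom_eq {_ _ _ _} f g := by
        change f.hom ⊗ₘ g.hom = 𝟙 _ ≫ (f.hom ⊗ₘ g.hom) ≫ 𝟙 _
        simp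
      associator_eq X Y Z := by
        change (α_ X.X Y.X Z.X).hom = (𝟙 _ ≫ (𝟙 _ ⊗ₘ 𝟙 _)) ≫ (α_ X.X Y.X Z.X).hom ≫ (𝟙 _ ⊗ₘ 𝟙 _) ≫ 𝟙 _
        simp
      leftUnitor_eq X := by
        change (λ_ X.X).hom = (𝟙 _ ≫ (𝟙 _ ⊗ₘ 𝟙 _)) ≫ (λ_ X.X).hom
        simp
      rightUnitor_eq X := by
        change (ρ_ X.X).hom = (𝟙 _ ≫ (𝟙 _ ⊗ₘ 𝟙 _)) ≫ (ρ_ X.X).hom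
        simp }

end ActCoact

variable [BraidedCategory C]

/-- `M` is a left-right Yetter-Drinfel'd module over `H`: a left `H`-module and a right
`H`-comodule satisfying the compatibility condition. In the condition, read from left to right,
`H ⊗ M` is mapped to `M ⊗ H`. -/
structure IsYetterDrinfeld {H : C} [BimonObj H] (M : ActCoact H) : Prop where
  one_act : η[H] ▷ M.X ≫ M.act = (λ_ M.X).hom
  mul_act : μ[H] ▷ M.X ≫ M.act = (α_ H H M.X).hom ≫ H ◁ M.act ≫ M.act
  coact_counit : M.coact ≫ M.X ◁ ε[H] = (ρ_ M.X).inv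
  coact_comul : M.coact ≫ M.X ◁ Δ[H] = M.coact ≫ M.coact ▷ H ≫ (α_ M.X H H).hom
  compat :
    Δ[H] ▷ M.X ≫ (α_ H H M.X).hom ≫ H ◁ M.act ≫ (β_ M.X H).inv ≫ M.coact ▷ H ≫
        (α_ M.X H H).hom ≫ M.X ◁ μ[H] =
      (Δ[H] ⊗ₘ M.coact) ≫ tensorμ H H M.X H ≫ (M.act ⊗ₘ μ[H])

/-- The property of being a left-right Yetter-Drinfel'd module. -/
def isYD (H : C) [BimonObj H] : ObjectProperty (ActCoact H) := fun M => IsYetterDrinfeld M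

/-- The category of left-right Yetter-Drinfel'd modules over `H` with `H`-linear and `H`-colinear
morphisms. Its tensor product, as soon as `isYD H` is closed under tensor products, is the one of
`ActCoact H`: diagonal `H`-action, codiagonal `H^op`-coaction. -/
abbrev YD (H : C) [BimonObj H] := (isYD H).FullSubcategory

/-- The morphism `M ⊗ N ⟶ N ⊗ M` given by the braiding of `C`, the coaction of `N` and the
action on `M`. -/
def ydBraiding {H : C} (M N : ActCoact H) : M.X ⊗ N.X ⟶ N.X ⊗ M.X :=
  (β_ M.X N.X).hom ≫ N.coact ▷ M.X ≫ (α_ N.X H M.X).hom ≫ N.X ◁ M.act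

end YetterDrinfeld

section Double

/-! ### The dual of a finite Hopf algebra and the Drinfel'd double -/

variable {C : Type u} [Category.{v} C] [MonoidalCategory C]

/-- The universal property of the dual `H* = Hᘁ`: a morphism `f : T ⊗ H ⟶ 𝟙` corresponds to
the unique `g : T ⟶ H*` with `ev ∘ (g ⊗ H) = f`. -/
def curry {H : C} [HasRightDual H] {T : C} (f : T ⊗ H ⟶ 𝟙_ C) : T ⟶ Hᘁ :=
  tensorRightHomEquiv T H Hᘁ (𝟙_ C) f ≫ (λ_ Hᘁ).hom

theorem curry_ev {H : C} [HasRightDual H] {T : C} (f : T ⊗ H ⟶ 𝟙_ C) :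
    curry f ▷ H ≫ ε_ H Hᘁ = f := by
  have h := (tensorRightHomEquiv T H Hᘁ (𝟙_ C)).symm_apply_apply f
  rw [curry, comp_whiskerRight_assoc]
  refine Eq.trans ?_ h
  change _ = _ ▷ H ≫ (α_ _ _ _).hom ≫ 𝟙_ C ◁ ε_ H Hᘁ ≫ (ρ_ _).hom
  congr 1
  rw [← unitors_equal, leftUnitor_naturality]
  simp

variable [BraidedCategory C]

/-- The evaluation `H ⊗ H* ⟶ 𝟙`. -/
def evBar (H : C) [HasRightDual H] : H ⊗ Hᘁ ⟶ 𝟙_ C := (β_ H Hᘁ).hom ≫ ε_ H Hᘁ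

/-- The universal property of `H*` with respect to `evBar`: the unique `g : T ⟶ H*` with
`evBar ∘ (H ⊗ g) = f`. -/
def curryBar {H : C} [HasRightDual H] {T : C} (f : H ⊗ T ⟶ 𝟙_ C) : T ⟶ Hᘁ :=
  curry ((β_ H T).inv ≫ f)

theorem curryBar_evBar {H : C} [HasRightDual H] {T : C} (f : H ⊗ T ⟶ 𝟙_ C) :
    H ◁ curryBar f ≫ evBar H = f := by
  rw [evBar, BraidedCategory.braiding_naturality_right_assoc, curryBar, curry_ev]
  simp

/-- The multiplication of `H*` dual to a comultiplication `d` of `H`: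
`(f g)(h) = f(h₁) g(h₂)`. -/
def dualMul {H : C} [HasRightDual H] (d : H ⟶ H ⊗ H) : Hᘁ ⊗ Hᘁ ⟶ Hᘁ :=
  curry ((Hᘁ ⊗ Hᘁ) ◁ d ≫ tensorμ Hᘁ Hᘁ H H ≫ (ε_ H Hᘁ ⊗ₘ ε_ H Hᘁ) ≫ (λ_ (𝟙_ C)).hom)

/-- The unit of `H*` dual to a counit of `H`. -/
def dualOne {H : C} [HasRightDual H] (e : H ⟶ 𝟙_ C) : 𝟙_ C ⟶ Hᘁ := curry ((λ_ H).hom ≫ e)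

/-- The comultiplication of `H*` dual to a multiplication `m` of `H`, characterized in
`dualComul_ev`: `f₁(h) f₂(k) = f(m(h ⊗ k))`. -/
def dualComul {H : C} [HasRightDual H] (m : H ⊗ H ⟶ H) : Hᘁ ⟶ Hᘁ ⊗ Hᘁ :=
  tensorRightHomEquiv Hᘁ H Hᘁ Hᘁ (curry ((α_ Hᘁ H H).hom ≫ Hᘁ ◁ m ≫ ε_ H Hᘁ)) ≫ (β_ Hᘁ Hᘁ).hom

theorem dualComul_ev {H : C} [HasRightDual H] (m : H ⊗ H ⟶ H) :
    dualComul m ▷ (H ⊗ H) ≫ tensorμ Hᘁ Hᘁ H H ≫ (ε_ H Hᘁ ⊗ₘ ε_ H Hᘁ) ≫ (λ_ (𝟙_ C)).hom =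
      Hᘁ ◁ m ≫ ε_ H Hᘁ := by
  set c := curry ((α_ Hᘁ H H).hom ≫ Hᘁ ◁ m ≫ ε_ H Hᘁ) with hc
  have h1 : c ▷ H ≫ ε_ H Hᘁ = (α_ Hᘁ H H).hom ≫ Hᘁ ◁ m ≫ ε_ H Hᘁ := curry_ev _
  have h2 : _ ▷ H ≫ (α_ Hᘁ Hᘁ H).hom ≫ Hᘁ ◁ ε_ H Hᘁ ≫ (ρ_ Hᘁ).hom = c :=
    (tensorRightHomEquiv Hᘁ H Hᘁ Hᘁ).symm_apply_apply c
  rw [dualComul, ← hc]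
  generalize tensorRightHomEquiv Hᘁ H Hᘁ Hᘁ c = g at h2 ⊢
  have key : ∀ B : C, ∀ e : B ⊗ H ⟶ 𝟙_ C,
      (β_ B B).hom ▷ (H ⊗ H) ≫ tensorμ B B H H ≫ (e ⊗ₘ e) ≫ (λ_ (𝟙_ C)).hom =
        (α_ (B ⊗ B) H H).inv ≫ ((α_ B B H).hom ≫ B ◁ e ≫ (ρ_ B).hom) ▷ H ≫ e := by
    intro B e
    have hn : (β_ B (B ⊗ H)).hom ≫ e ▷ B = B ◁ e ≫ (ρ_ B).hom ≫ (λ_ B).inv := by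
      rw [← BraidedCategory.braiding_naturality_right]; simp
    have h3 : (α_ B B H).inv ≫ (β_ B B).hom ▷ H ≫ (α_ B B H).hom ≫ B ◁ (β_ B H).hom ≫
        (α_ B H B).inv ≫ e ▷ B = B ◁ e ≫ (ρ_ B).hom ≫ (λ_ B).inv := by
      rw [← hn, BraidedCategory.braiding_tensor_right_hom]; simp
    have h4 : (α_ B B H).hom ≫ B ◁ e ≫ (ρ_ B).hom = (β_ B B).hom ▷ H ≫ (α_ B B H).hom ≫
        B ◁ (β_ B H).hom ≫ (α_ B H B).inv ≫ e ▷ B ≫ (λ_ B).hom := by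
      rw [Iso.inv_comp_eq] at h3
      simpa using h3.symm =≫ (λ_ B).hom
    rw [h4]
    simp only [tensorμ, MonoidalCategory.tensorHom_def]
    monoidal
  rw [comp_whiskerRight_assoc, key, associator_inv_naturality_left_assoc,
    ← comp_whiskerRight_assoc, h2, h1]
  simp

/-- The counit of `H*` dual to a unit of `H`. -/
def dualCounit {H : C} [HasRightDual H] (e : 𝟙_ C ⟶ H) : Hᘁ ⟶ 𝟙_ C :=
  (ρ_ Hᘁ).inv ≫ Hᘁ ◁ e ≫ ε_ H Hᘁ

variable (H : C) [HopfObj H] [HasRightDual H]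

/-- The underlying object `(H^op)* ⊗ H` of the Drinfel'd double. -/
def double : C := Hᘁ ⊗ H

/-- The comultiplication of `B = (H^op)*`. -/
def comulB : Hᘁ ⟶ Hᘁ ⊗ Hᘁ := dualComul (opMul H)

/-- The left action of `H` on `B = (H^op)*`: `(h ⇀ f)(k) = f(S⁻¹(h₂) k h₁)`. -/
def leftAction [IsIso 𝒮[H]] : H ⊗ Hᘁ ⟶ Hᘁ :=
  curryBar (T := H ⊗ Hᘁ)
    (H ◁ Δ[H] ▷ Hᘁ ⊗≫ (μ[H] ⊗ₘ inv 𝒮[H]) ▷ Hᘁ ≫ (β_ H H).hom ▷ Hᘁ ≫ μ[H] ▷ Hᘁ ≫ evBar H)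

/-- The right action of `B = (H^op)*` on `H`: `h ↼ f = h₂ f(S⁻¹(h₃) h₁)`. -/
def rightAction [IsIso 𝒮[H]] : H ⊗ Hᘁ ⟶ H :=
  (Δ[H] ≫ Δ[H] ▷ H) ▷ Hᘁ ≫ ((β_ H H).inv ⊗ₘ inv 𝒮[H]) ▷ Hᘁ ⊗≫ H ◁ (β_ H H).hom ▷ Hᘁ ≫
    H ◁ μ[H] ▷ Hᘁ ≫ H ◁ evBar H ≫ (ρ_ H).hom

/-- The morphism `H ⊗ B ⟶ B ⊗ H`, `h ⊗ f ↦ (h₁ ⇀ f₁) ⊗ (h₂ ↼ f₂)`, for `B = (H^op)*`. -/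
def exchange [IsIso 𝒮[H]] : H ⊗ Hᘁ ⟶ Hᘁ ⊗ H :=
  (Δ[H] ⊗ₘ comulB H) ≫ tensorμ H H Hᘁ Hᘁ ≫ (leftAction H ⊗ₘ rightAction H)

/-- The bicrossproduct multiplication of the Drinfel'd double. -/
def doubleMul [IsIso 𝒮[H]] : double H ⊗ double H ⟶ double H :=
  (α_ Hᘁ H (Hᘁ ⊗ H)).hom ≫ Hᘁ ◁ (α_ H Hᘁ H).inv ≫ Hᘁ ◁ exchange H ▷ H ⊗≫
    (dualMul Δ[H] ⊗ₘ μ[H])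

/-- The unit of the Drinfel'd double. -/
def doubleOne : 𝟙_ C ⟶ double H := (λ_ (𝟙_ C)).inv ≫ (dualOne ε[H] ⊗ₘ η[H])

/-- The codiagonal comultiplication of the Drinfel'd double. -/
def doubleComul : double H ⟶ double H ⊗ double H :=
  (comulB H ⊗ₘ Δ[H]) ≫ tensorμ Hᘁ Hᘁ H H

/-- The counit of the Drinfel'd double. -/
def doubleCounit : double H ⟶ 𝟙_ C := (dualCounit η[H] ⊗ₘ ε[H]) ≫ (λ_ (𝟙_ C)).hom

/-- The canonical R-matrix of the Drinfel'd double: the dual basis `𝟙 ⟶ H ⊗ H*` placed in the two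
inner factors of `(H* ⊗ H) ⊗ (H* ⊗ H)`, with units in the outer factors. -/
def doubleR : 𝟙_ C ⟶ double H ⊗ double H :=
  η_ H Hᘁ ≫ ((λ_ H).inv ⊗ₘ (ρ_ Hᘁ).inv) ≫ (dualOne ε[H] ▷ H ⊗ₘ Hᘁ ◁ η[H])

variable [MonObj (double H)]

/-- The action of `H` on a module over the Drinfel'd double, through `η ⊗ H`. -/
def actOfDouble (M : Mod C (double H)) : H ⊗ M.X ⟶ M.X :=
  ((λ_ H).inv ≫ dualOne ε[H] ▷ H) ▷ M.X ≫ γ[double H, M.X]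

/-- The action of `H*` on a module over the Drinfel'd double, through `H* ⊗ η`. -/
def dualActOfDouble (M : Mod C (double H)) : Hᘁ ⊗ M.X ⟶ M.X :=
  ((ρ_ Hᘁ).inv ≫ Hᘁ ◁ η[H]) ▷ M.X ≫ γ[double H, M.X]

/-- The `H`-coaction on a module over the Drinfel'd double obtained from the action of `H*` by
inserting the dual basis. -/
def coactOfDouble (M : Mod C (double H)) : M.X ⟶ M.X ⊗ H :=
  (λ_ M.X).inv ≫ η_ H Hᘁ ▷ M.X ≫ (α_ H Hᘁ M.X).hom ≫ H ◁ dualActOfDouble H M ≫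
    (β_ H M.X).hom

theorem coactOfDouble_natural {M N : Mod C (double H)} (f : M ⟶ N) :
    coactOfDouble H M ≫ f.hom ▷ H = f.hom ≫ coactOfDouble H N := by
  have h : dualActOfDouble H M ≫ f.hom = Hᘁ ◁ f.hom ≫ dualActOfDouble H N :=
    restrict_natural f _
  simp only [coactOfDouble, Category.assoc]
  rw [← BraidedCategory.braiding_naturality_right, ← MonoidalCategory.whiskerLeft_comp_assoc, h,
    MonoidalCategory.whiskerLeft_comp_assoc, ← associator_naturality_right_assoc,
    ← whisker_exchange_assoc, ← leftUnitor_inv_naturality_assoc]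

/-- The functor sending a module over the Drinfel'd double to the same object with the
corresponding `H`-action and `H`-coaction, and a morphism to itself. -/
def doubleToActCoact : Mod C (double H) ⥤ ActCoact H where
  obj M := ⟨M.X, actOfDouble H M, coactOfDouble H M⟩
  map {M N} f := ⟨f.hom, restrict_natural f _, coactOfDouble_natural H f⟩

end Double

end

end BraidedDouble

/-!
The double `D(H) = B ⋈ H`, `B = (H^op)*`, is an algebra whose multiplication is governed by one
morphism, the exchange `E : H ⊗ B ⟶ B ⊗ H`, and almost everything reduces to properties of `E`.

**The double.** The evaluation `τ : H ⊗ B ⟶ 𝟙` is a skew pairing, with convolution inverse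
`τ ∘ (S⁻¹ ⊗ B)` (`dualPairing`), and unwinding the two actions shows that
`E(h ⊗ f) = τ(h₁, f₁) f₂ ⊗ h₂ τ⁻¹(h₃, f₃)` (`exchange_eq`). In other words, `E` is the braiding
preceded by the conjugation of the comonoid `H ⊗ B` by the convolution invertible functional `τ`
(`twist`). Conjugations compose by convolution and commute with morphisms of comonoids. So `E` is a
morphism of comonoids, and the multiplicativity of `τ` in each variable says that `E` is a
distributive law (`SkewPairing.isDistributive`). A distributive law makes `B ⊗ H` a monoid
(`smashMonObj`), and a bimonoid if it is a morphism of comonoids (`smashBimonObj`).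

**Modules.** A `D(H)`-module is an object with an `H`-action and a `B`-action that satisfy the
exchange relation given by `E` (`smashAct_mul`, `smashAct_incl`, `exchange_incl`). Contraction with
the dual basis turns `B`-actions into morphisms `M ⟶ M ⊗ H` (`contract`, `uncontract`); under this
dictionary the axioms of an action are those of a coaction (`coact_counit_iff`, `coact_comul_iff`),
and the Yetter-Drinfel'd condition is the exchange relation with `τ⁻¹` moved to the other side
(`compat_iff`, `isYetterDrinfeld_iff`). This gives the isomorphism of categories. The diagonal
action of `B`, whose comultiplication is dual to that of `H^op`, corresponds to the codiagonal
`H^op`-coaction (`contract_diagInsert`), so the isomorphism is strictly monoidal and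
Yetter-Drinfel'd modules are closed under tensor products (`isMonoidal_isYD`).

**Braidings.** That the Yetter-Drinfel'd braiding is linear and colinear follows from the
Yetter-Drinfel'd condition, and its hexagons from the multiplicativity of the action and of the
coaction; it is invertible because `n ⊗ m ↦ n₀ ⊗ S(n₁) m` inverts `n ⊗ m ↦ n₀ ⊗ n₁ m`
(`ydBraiding_isIso`). The braiding of `D(H)`-modules is transported along the isomorphism, and it
is the one given by the `R`-matrix because a coaction is the insertion of the dual basis
(`braidingOfR_doubleR`).

Transparency of `H`, that is symmetry of its braiding with every object, passes to the dual
(`IsTransparent.rightDual`), so strands labelled `H` and `H*` may be moved freely through others.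
-/

namespace BraidedDouble

noncomputable section

/-! ### Transparent objects -/

section
variable {C : Type u} [Category.{v} C] [MonoidalCategory C] [BraidedCategory C]

/-- An object is transparent if its braiding with every object is symmetric. -/
def IsTransparent (X : C) : Prop := ∀ M : C, (β_ X M).hom = (β_ M X).inv

theorem IsTransparent.comm {X : C} (hX : IsTransparent X) (M : C) :
    (β_ M X).hom = (β_ X M).inv := by
  rw [← cancel_mono (β_ X M).hom, Iso.inv_hom_id, hX M, Iso.hom_inv_id]

theorem IsTransparent.hom_hom {X : C} (hX : IsTransparent X) (M : C) :
    (β_ X M).hom ≫ (β_ M X).hom = 𝟙 _ := by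
  rw [hX M, Iso.inv_hom_id]

theorem IsTransparent.hom_hom' {X : C} (hX : IsTransparent X) (M : C) :
    (β_ M X).hom ≫ (β_ X M).hom = 𝟙 _ := by
  rw [hX M, Iso.hom_inv_id]

/-- If `X` and `W` are mutually symmetric, the braiding of `X ⊗ Y` with `Z ⊗ W` is, up to the
shuffles `tensorμ`, made of the braidings of `X` with `Z` and of `Y` with `W`. -/
theorem braiding_tensorμ {X Y Z W : C} (h : (β_ X W).hom ≫ (β_ W X).hom = 𝟙 _) :
    (β_ (X ⊗ Y) (Z ⊗ W)).hom ≫ tensorμ Z W X Y =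
      tensorμ X Y Z W ≫ ((β_ X Z).hom ⊗ₘ (β_ Y W).hom) := by
  simp only [tensorμ, BraidedCategory.braiding_tensor_left_hom,
    BraidedCategory.braiding_tensor_right_hom]
  calc
    _ = 𝟙 _ ⊗≫ X ◁ (β_ Y Z).hom ▷ W ⊗≫ ((β_ X Z).hom ▷ (Y ⊗ W) ≫
          (Z ⊗ X) ◁ (β_ Y W).hom) ⊗≫
          Z ◁ ((β_ X W).hom ≫ (β_ W X).hom) ▷ Y ⊗≫ 𝟙 _ := by monoidal
    _ = _ := by rw [h, MonoidalCategory.tensorHom_def]; monoidal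

/-- The counterpart of `braiding_tensorμ` with the shuffle in front. -/
theorem tensorμ_braiding {A B D E : C} (h : (β_ B D).hom ≫ (β_ D B).hom = 𝟙 _) :
    tensorμ A B D E ≫ (β_ (A ⊗ D) (B ⊗ E)).hom =
      ((β_ A B).hom ⊗ₘ (β_ D E).hom) ≫ tensorμ B A E D := by
  simp only [tensorμ, BraidedCategory.braiding_tensor_left_hom,
    BraidedCategory.braiding_tensor_right_hom]
  calc
    _ = 𝟙 _ ⊗≫ A ◁ ((β_ B D).hom ≫ (β_ D B).hom) ▷ E ⊗≫ ((β_ A B).hom ▷ (D ⊗ E) ≫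
          (B ⊗ A) ◁ (β_ D E).hom) ⊗≫ B ◁ (β_ A E).hom ▷ D ⊗≫ 𝟙 _ := by monoidal
    _ = _ := by rw [h, MonoidalCategory.tensorHom_def]; monoidal

/-- The dual of a transparent object is transparent. -/
theorem IsTransparent.rightDual {H : C} [HasRightDual H] (hH : IsTransparent H) :
    IsTransparent (Hᘁ) := by
  intro M
  -- `q`, which moves `H` past `M` and evaluates, is the transpose of the braiding of `Hᘁ` with `M`
  -- and of its mirror image: by transparency it does not matter how `H` passes `M`.
  set q : (Hᘁ ⊗ M) ⊗ H ⟶ M := (α_ _ _ _).hom ≫ Hᘁ ◁ (β_ M H).hom ≫ (α_ _ _ _).inv ≫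
    ε_ H Hᘁ ▷ M ≫ (λ_ M).hom with hq
  have e1 : M ◁ ε_ H Hᘁ ≫ (ρ_ M).hom = (β_ M (Hᘁ ⊗ H)).hom ≫ ε_ H Hᘁ ▷ M ≫ (λ_ M).hom := by
    rw [← BraidedCategory.braiding_naturality_right_assoc]; simp
  have e2 : M ◁ ε_ H Hᘁ ≫ (ρ_ M).hom = (β_ (Hᘁ ⊗ H) M).inv ≫ ε_ H Hᘁ ▷ M ≫ (λ_ M).hom := by
    rw [Iso.eq_inv_comp, ← BraidedCategory.braiding_naturality_left_assoc]; simp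
  have f1 : (tensorRightHomEquiv (Hᘁ ⊗ M) H Hᘁ M).symm (β_ M Hᘁ).inv = q := by
    change (β_ M Hᘁ).inv ▷ H ≫ (α_ _ _ _).hom ≫ M ◁ ε_ H Hᘁ ≫ (ρ_ M).hom = q
    rw [e1, BraidedCategory.braiding_tensor_right_hom, hq]
    simp
  have f2 : (tensorRightHomEquiv (Hᘁ ⊗ M) H Hᘁ M).symm (β_ Hᘁ M).hom = q := by
    change (β_ Hᘁ M).hom ▷ H ≫ (α_ _ _ _).hom ≫ M ◁ ε_ H Hᘁ ≫ (ρ_ M).hom = q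
    rw [e2, BraidedCategory.braiding_tensor_left_inv, hq, ← hH.comm]
    simp
  exact (tensorRightHomEquiv (Hᘁ ⊗ M) H Hᘁ M).symm.injective (f2.trans f1.symm)

end

/-! ### Mates and non-degenerate pairings -/

section
variable {C : Type u} [Category.{v} C] [MonoidalCategory C]

/-- `p : X' ⟶ Y'` and `u : Y ⟶ X` are mates with respect to pairings of `X'` with `X` and of `Y'`
with `Y`: `⟨p x, y⟩ = ⟨x, u y⟩`. -/
def IsMate {X X' Y Y' : C} (e : X' ⊗ X ⟶ 𝟙_ C) (e' : Y' ⊗ Y ⟶ 𝟙_ C) (p : X' ⟶ Y') (u : Y ⟶ X) :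
    Prop := p ▷ Y ≫ e' = X' ◁ u ≫ e

/-- A pairing `X' ⊗ X ⟶ 𝟙` is nondegenerate if a morphism into `Z ⊗ X'` is determined by its
contraction with `X`. -/
def Nondegenerate {X X' : C} (e : X' ⊗ X ⟶ 𝟙_ C) : Prop :=
  ∀ ⦃T Z : C⦄ ⦃p q : T ⟶ Z ⊗ X'⦄,
    p ▷ X ≫ (α_ Z X' X).hom ≫ Z ◁ e = q ▷ X ≫ (α_ Z X' X).hom ≫ Z ◁ e → p = q

theorem Nondegenerate.eq {X X' : C} {e : X' ⊗ X ⟶ 𝟙_ C} (he : Nondegenerate e) {T : C}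
    {p q : T ⟶ X'} (h : p ▷ X ≫ e = q ▷ X ≫ e) : p = q := by
  rw [← cancel_mono (λ_ X').inv]
  apply he
  have : (λ_ X').inv ▷ X ≫ (α_ (𝟙_ C) X' X).hom ≫ 𝟙_ C ◁ e = e ≫ (λ_ _).inv := by
    simp
  rw [comp_whiskerRight_assoc, comp_whiskerRight_assoc, this, reassoc_of% h]

/-- Mates of equal morphisms are equal. This reduces identities between structure morphisms of the
dual to identities between structure morphisms of `H`. -/
theorem IsMate.unique {X X' Y Y' : C} {e : X' ⊗ X ⟶ 𝟙_ C} {e' : Y' ⊗ Y ⟶ 𝟙_ C} {p q : X' ⟶ Y'}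
    {u w : Y ⟶ X} (he : Nondegenerate e') (h : IsMate e e' p u) (h' : IsMate e e' q w)
    (huw : u = w) : p = q := by
  subst huw
  exact he.eq (h.trans h'.symm)

theorem isMate_id {X X' : C} (e : X' ⊗ X ⟶ 𝟙_ C) : IsMate e e (𝟙 X') (𝟙 X) := by simp [IsMate]

theorem IsMate.comp {X X' Y Y' Z Z' : C} {e : X' ⊗ X ⟶ 𝟙_ C} {e' : Y' ⊗ Y ⟶ 𝟙_ C}
    {e'' : Z' ⊗ Z ⟶ 𝟙_ C} {p : X' ⟶ Y'} {u : Y ⟶ X} {q : Y' ⟶ Z'} {w : Z ⟶ Y}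
    (h : IsMate e e' p u) (h' : IsMate e' e'' q w) : IsMate e e'' (p ≫ q) (w ≫ u) := by
  unfold IsMate at *
  rw [comp_whiskerRight, Category.assoc, h', ← whisker_exchange_assoc, h,
    MonoidalCategory.whiskerLeft_comp, Category.assoc]

theorem IsMate.iso_inv {X X' Y Y' : C} {e : X' ⊗ X ⟶ 𝟙_ C} {e' : Y' ⊗ Y ⟶ 𝟙_ C} {p : X' ≅ Y'}
    {u : Y ≅ X} (h : IsMate e e' p.hom u.hom) : IsMate e' e p.inv u.inv := by
  unfold IsMate at *
  rw [← cancel_epi (p.hom ▷ X), hom_inv_whiskerRight_assoc, ← whisker_exchange_assoc, h,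
    whiskerLeft_inv_hom_assoc]

/-- The pairing of `𝟙` with itself. -/
def unitPairing (C : Type u) [Category.{v} C] [MonoidalCategory C] : 𝟙_ C ⊗ 𝟙_ C ⟶ 𝟙_ C :=
  (λ_ (𝟙_ C)).hom

theorem unitPairing_nondegenerate : Nondegenerate (unitPairing C) := by
  intro T Z p q h
  have : ∀ r : T ⟶ Z ⊗ 𝟙_ C, (ρ_ T).inv ≫ r ▷ 𝟙_ C ≫ (α_ _ _ _).hom ≫ Z ◁ unitPairing C = r := by
    intro r; simp [unitPairing]
  rw [← this p, ← this q, h]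

theorem rightDual_nondegenerate (H : C) [HasRightDual H] : Nondegenerate (ε_ H Hᘁ) := by
  intro T Z p q h
  apply (tensorRightHomEquiv T H Hᘁ Z).symm.injective
  change p ▷ H ≫ (α_ _ _ _).hom ≫ Z ◁ ε_ H Hᘁ ≫ (ρ_ Z).hom =
    q ▷ H ≫ (α_ _ _ _).hom ≫ Z ◁ ε_ H Hᘁ ≫ (ρ_ Z).hom
  rw [reassoc_of% h]

variable [BraidedCategory C]

/-- The pairing of `X' ⊗ Y'` with `X ⊗ Y` given by `⟨x ⊗ y, a ⊗ b⟩ = ⟨x, a⟩⟨y, b⟩`. -/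
def tensorPairing {X X' Y Y' : C} (e : X' ⊗ X ⟶ 𝟙_ C) (e' : Y' ⊗ Y ⟶ 𝟙_ C) :
    (X' ⊗ Y') ⊗ (X ⊗ Y) ⟶ 𝟙_ C :=
  tensorμ X' Y' X Y ≫ (e ⊗ₘ e') ≫ (λ_ (𝟙_ C)).hom

/-- Up to the braiding of `X` and `Y`, the tensor product pairing is the nested one. -/
theorem tensorPairing_eq_nested {X X' Y Y' : C} (e : X' ⊗ X ⟶ 𝟙_ C) (e' : Y' ⊗ Y ⟶ 𝟙_ C) :
    tensorPairing e e' = (X' ⊗ Y') ◁ (β_ Y X).inv ≫ (α_ X' Y' (Y ⊗ X)).hom ≫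
      X' ◁ ((α_ Y' Y X).inv ≫ e' ▷ X ≫ (λ_ X).hom) ≫ e := by
  have h : e' ▷ X ≫ (λ_ X).hom = (β_ (Y' ⊗ Y) X).hom ≫ X ◁ e' ≫ (ρ_ X).hom := by
    rw [← BraidedCategory.braiding_naturality_left_assoc]; simp
  rw [h, tensorPairing, tensorμ, BraidedCategory.braiding_tensor_left_hom]
  symm
  calc
    _ = 𝟙 _ ⊗≫ (X' ⊗ Y') ◁ ((β_ Y X).inv ≫ (β_ Y X).hom) ⊗≫ X' ◁ (β_ Y' X).hom ▷ Y ⊗≫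
          ((X' ⊗ X) ◁ e' ≫ e ▷ 𝟙_ C) ⊗≫ 𝟙 _ := by monoidal
    _ = _ := by rw [Iso.inv_hom_id, MonoidalCategory.tensorHom_def']; monoidal

theorem Nondegenerate.tensorPairing {X X' Y Y' : C} {e : X' ⊗ X ⟶ 𝟙_ C} {e' : Y' ⊗ Y ⟶ 𝟙_ C}
    (he : Nondegenerate e) (he' : Nondegenerate e') : Nondegenerate (tensorPairing e e') := by
  intro T Z p q h
  rw [← cancel_mono (α_ Z X' Y').inv]
  apply he'
  rw [← cancel_mono (ρ_ (Z ⊗ X')).hom]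
  apply he
  have key : ∀ r : T ⟶ Z ⊗ X' ⊗ Y',
      ((((r ≫ (α_ Z X' Y').inv) ▷ Y ≫ (α_ (Z ⊗ X') Y' Y).hom ≫ (Z ⊗ X') ◁ e') ≫ (ρ_ _).hom) ▷ X) ≫
        (α_ Z X' X).hom ≫ Z ◁ e = (α_ T Y X).hom ≫ T ◁ (β_ Y X).hom ≫ r ▷ (X ⊗ Y) ≫
          (α_ _ _ _).hom ≫ Z ◁ BraidedDouble.tensorPairing e e' := by
    intro r
    rw [tensorPairing_eq_nested]
    symm
    calc
      _ = 𝟙 _ ⊗≫ T ◁ (β_ Y X).hom ⊗≫ (r ▷ (X ⊗ Y) ≫ (Z ⊗ X' ⊗ Y') ◁ (β_ Y X).inv) ⊗≫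
            Z ◁ X' ◁ e' ▷ X ⊗≫ Z ◁ e ⊗≫ 𝟙 _ := by monoidal
      _ = 𝟙 _ ⊗≫ T ◁ ((β_ Y X).hom ≫ (β_ Y X).inv) ⊗≫ r ▷ (Y ⊗ X) ⊗≫
            Z ◁ X' ◁ e' ▷ X ⊗≫ Z ◁ e ⊗≫ 𝟙 _ := by rw [← whisker_exchange]; monoidal
      _ = _ := by rw [Iso.hom_inv_id]; monoidal
  rw [key, key, h]

theorem IsMate.tensor {X X' Y Y' U U' V V' : C} {e : X' ⊗ X ⟶ 𝟙_ C} {e' : Y' ⊗ Y ⟶ 𝟙_ C}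
    {c : U' ⊗ U ⟶ 𝟙_ C} {c' : V' ⊗ V ⟶ 𝟙_ C} {p : X' ⟶ Y'} {u : Y ⟶ X} {q : U' ⟶ V'} {w : V ⟶ U}
    (h : IsMate e e' p u) (h' : IsMate c c' q w) :
    IsMate (tensorPairing e c) (tensorPairing e' c') (p ⊗ₘ q) (u ⊗ₘ w) := by
  unfold IsMate tensorPairing at *
  rw [tensorμ_natural_left_assoc, tensorμ_natural_right_assoc, tensorHom_comp_tensorHom_assoc,
    tensorHom_comp_tensorHom_assoc, h, h']

theorem IsMate.whiskerRight {X X' Y Y' U U' : C} {e : X' ⊗ X ⟶ 𝟙_ C} {e' : Y' ⊗ Y ⟶ 𝟙_ C}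
    {p : X' ⟶ Y'} {u : Y ⟶ X} (h : IsMate e e' p u) (c : U' ⊗ U ⟶ 𝟙_ C) :
    IsMate (tensorPairing e c) (tensorPairing e' c) (p ▷ U') (u ▷ U) := by
  simpa using h.tensor (isMate_id c)

theorem IsMate.whiskerLeft {X X' Y Y' U U' : C} {e : X' ⊗ X ⟶ 𝟙_ C} {e' : Y' ⊗ Y ⟶ 𝟙_ C}
    {p : X' ⟶ Y'} {u : Y ⟶ X} (c : U' ⊗ U ⟶ 𝟙_ C) (h : IsMate e e' p u) :
    IsMate (tensorPairing c e) (tensorPairing c e') (U' ◁ p) (U ◁ u) := by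
  simpa using (isMate_id c).tensor h

theorem isMate_associator {X X' Y Y' Z Z' : C} (e : X' ⊗ X ⟶ 𝟙_ C) (e' : Y' ⊗ Y ⟶ 𝟙_ C)
    (e'' : Z' ⊗ Z ⟶ 𝟙_ C) :
    IsMate (tensorPairing (tensorPairing e e') e'') (tensorPairing e (tensorPairing e' e''))
      (α_ X' Y' Z').hom (α_ X Y Z).inv := by
  have h := associator_monoidal X' Y' Z' X Y Z
  unfold IsMate tensorPairing
  rw [← cancel_epi (((X' ⊗ Y') ⊗ Z') ◁ (α_ X Y Z).hom)]
  rw [whiskerLeft_hom_inv_assoc, ← MonoidalCategory.tensorHom_def'_assoc]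
  rw [← whiskerLeft_comp_tensorHom]
  simp only [Category.assoc]
  rw [← reassoc_of% h]
  simp only [MonoidalCategory.tensorHom_def]
  monoidal

theorem isMate_associator_inv {X X' Y Y' Z Z' : C} (e : X' ⊗ X ⟶ 𝟙_ C) (e' : Y' ⊗ Y ⟶ 𝟙_ C)
    (e'' : Z' ⊗ Z ⟶ 𝟙_ C) :
    IsMate (tensorPairing e (tensorPairing e' e'')) (tensorPairing (tensorPairing e e') e'')
      (α_ X' Y' Z').inv (α_ X Y Z).hom := by
  have h := isMate_associator e e' e''
  unfold IsMate at *
  rw [← cancel_epi ((α_ X' Y' Z').hom ▷ _), hom_inv_whiskerRight_assoc, ← whisker_exchange_assoc, h,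
    whiskerLeft_hom_inv_assoc]

theorem isMate_leftUnitor {X X' : C} (e : X' ⊗ X ⟶ 𝟙_ C) :
    IsMate (tensorPairing (unitPairing C) e) e (λ_ X').hom (λ_ X).inv := by
  have h := leftUnitor_monoidal X' X
  unfold IsMate tensorPairing unitPairing
  rw [← cancel_epi ((𝟙_ C ⊗ X') ◁ (λ_ X).hom), whiskerLeft_hom_inv_assoc,
    ← MonoidalCategory.tensorHom_def'_assoc, h, MonoidalCategory.tensorHom_def]
  simp

theorem isMate_rightUnitor {X X' : C} (e : X' ⊗ X ⟶ 𝟙_ C) :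
    IsMate (tensorPairing e (unitPairing C)) e (ρ_ X').hom (ρ_ X).inv := by
  have h := rightUnitor_monoidal X' X
  unfold IsMate tensorPairing unitPairing
  rw [← cancel_epi ((X' ⊗ 𝟙_ C) ◁ (ρ_ X).hom), whiskerLeft_hom_inv_assoc,
    ← MonoidalCategory.tensorHom_def'_assoc, h, MonoidalCategory.tensorHom_def']
  simp [unitors_equal]

theorem isMate_braiding {X X' Y Y' : C} (e : X' ⊗ X ⟶ 𝟙_ C) (e' : Y' ⊗ Y ⟶ 𝟙_ C)
    (hX : IsTransparent X) (hY : IsTransparent Y) :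
    IsMate (tensorPairing e e') (tensorPairing e' e) (β_ X' Y').hom (β_ Y X).hom := by
  have h := tensorμ_braiding (A := X') (B := Y') (D := X) (E := Y) (hX.hom_hom' _)
  have h2 : (e ⊗ₘ e') ≫ (λ_ (𝟙_ C)).hom = (β_ (X' ⊗ X) (Y' ⊗ Y)).hom ≫
      (e' ⊗ₘ e) ≫ (λ_ (𝟙_ C)).hom := by
    rw [← BraidedCategory.braiding_naturality_assoc]; simp [← unitors_equal]
  unfold IsMate tensorPairing
  rw [h2, reassoc_of% h, MonoidalCategory.tensorHom_def' (β_ X' Y').hom, Category.assoc,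
    ← MonoidalCategory.whiskerLeft_comp_assoc, hY.hom_hom]
  simp

end

/-! ### The dual bimonoid -/

section
variable {C : Type u} [Category.{v} C] [MonoidalCategory C] [BraidedCategory C]

theorem isMate_tensorμ {W W' X X' Y Y' Z Z' : C} (a : W' ⊗ W ⟶ 𝟙_ C) (b : X' ⊗ X ⟶ 𝟙_ C)
    (c : Y' ⊗ Y ⟶ 𝟙_ C) (d : Z' ⊗ Z ⟶ 𝟙_ C) (hX : IsTransparent X) (hY : IsTransparent Y) :
    IsMate (tensorPairing (tensorPairing a b) (tensorPairing c d))
      (tensorPairing (tensorPairing a c) (tensorPairing b d))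
      (tensorμ W' X' Y' Z') (tensorμ W Y X Z) := by
  have := (isMate_associator a b (tensorPairing c d)).comp
    (((isMate_associator_inv b c d).whiskerLeft a).comp
      ((((isMate_braiding b c hX hY).whiskerRight d).whiskerLeft a).comp
        (((isMate_associator c b d).whiskerLeft a).comp
          (isMate_associator_inv a c (tensorPairing b d)))))
  simpa only [tensorμ, Category.assoc] using this

variable (H : C) [HasRightDual H]

/-- By definition, the multiplication of the dual is the mate of the comultiplication. -/
theorem isMate_dualMul (d : H ⟶ H ⊗ H) :
    IsMate (tensorPairing (ε_ H Hᘁ) (ε_ H Hᘁ)) (ε_ H Hᘁ) (dualMul d) d := curry_ev _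

omit [BraidedCategory C] in
theorem isMate_dualOne (e : H ⟶ 𝟙_ C) :
    IsMate (unitPairing C) (ε_ H Hᘁ) (dualOne e) e := by
  unfold IsMate unitPairing
  rw [dualOne, curry_ev, leftUnitor_naturality]

theorem isMate_dualComul (m : H ⊗ H ⟶ H) :
    IsMate (ε_ H Hᘁ) (tensorPairing (ε_ H Hᘁ) (ε_ H Hᘁ)) (dualComul m) m := dualComul_ev m

omit [BraidedCategory C] in
theorem isMate_dualCounit (e : 𝟙_ C ⟶ H) :
    IsMate (ε_ H Hᘁ) (unitPairing C) (dualCounit e) e := by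
  unfold IsMate unitPairing
  rw [dualCounit]
  simp [unitors_equal]

theorem tensorPairing_dual_nondegenerate :
    Nondegenerate (tensorPairing (ε_ H Hᘁ) (ε_ H Hᘁ)) :=
  (rightDual_nondegenerate H).tensorPairing (rightDual_nondegenerate H)

/-- The dual of a comonoid is a monoid. -/
abbrev dualMonObj [ComonObj H] : MonObj Hᘁ where
  one := dualOne ε[H]
  mul := dualMul Δ[H]
  one_mul :=
    (((isMate_dualOne H ε[H]).whiskerRight (ε_ H Hᘁ)).comp (isMate_dualMul H Δ[H])).unique
      (rightDual_nondegenerate H) (isMate_leftUnitor _) (ComonObj.counit_comul H)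
  mul_one :=
    ((((isMate_dualOne H ε[H])).whiskerLeft (ε_ H Hᘁ)).comp (isMate_dualMul H Δ[H])).unique
      (rightDual_nondegenerate H) (isMate_rightUnitor _) (ComonObj.comul_counit H)
  mul_assoc :=
    ((((isMate_dualMul H Δ[H])).whiskerRight (ε_ H Hᘁ)).comp (isMate_dualMul H Δ[H])).unique
      (rightDual_nondegenerate H) ((isMate_associator _ _ _).comp
        (((isMate_dualMul H Δ[H]).whiskerLeft (ε_ H Hᘁ)).comp (isMate_dualMul H Δ[H]))) (by simp)

/-- The comonoid dual to the opposite of a monoid. The pairing of tensor squares is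
`⟨f ⊗ g, h ⊗ k⟩ = ⟨f, h⟩⟨g, k⟩`, so the mate of `dualComul (opMul H)` is `opMul H` itself. -/
abbrev dualComonObj [MonObj H] : ComonObj Hᘁ where
  counit := dualCounit η[H]
  comul := dualComul (opMul H)
  counit_comul :=
    ((isMate_dualComul H (opMul H)).comp ((isMate_dualCounit H η[H]).whiskerRight (ε_ H Hᘁ))).unique
      ((unitPairing_nondegenerate).tensorPairing (rightDual_nondegenerate H))
      (IsMate.iso_inv (p := λ_ _) (u := (λ_ _).symm) (isMate_leftUnitor _)) (one_opMul H)
  comul_counit :=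
    ((isMate_dualComul H (opMul H)).comp ((isMate_dualCounit H η[H]).whiskerLeft (ε_ H Hᘁ))).unique
      ((rightDual_nondegenerate H).tensorPairing unitPairing_nondegenerate)
      (IsMate.iso_inv (p := ρ_ _) (u := (ρ_ _).symm) (isMate_rightUnitor _)) (opMul_one H)
  comul_assoc :=
    ((isMate_dualComul H (opMul H)).comp
      ((isMate_dualComul H (opMul H)).whiskerLeft (ε_ H Hᘁ))).unique
      ((rightDual_nondegenerate H).tensorPairing (tensorPairing_dual_nondegenerate H))
      ((isMate_dualComul H (opMul H)).comp
        (((isMate_dualComul H (opMul H)).whiskerRight (ε_ H Hᘁ)).comp (isMate_associator _ _ _)))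
      (by simp [opMul_assoc])

/-- The opposite multiplication of a transparent bimonoid is a morphism of comonoids. -/
theorem opMul_comul (H : C) [BimonObj H] (hH : IsTransparent H) :
    opMul H ≫ Δ[H] = (Δ[H] ⊗ₘ Δ[H]) ≫ tensorμ H H H H ≫ (opMul H ⊗ₘ opMul H) := by
  rw [opMul, Category.assoc, BimonObj.mul_comul, ← BraidedCategory.braiding_naturality_assoc,
    reassoc_of% (braiding_tensorμ (X := H) (Y := H) (Z := H) (W := H) (hH.hom_hom H)),
    tensorHom_comp_tensorHom]

/-- The bimonoid `(H^op)*` dual to the opposite of a transparent bimonoid `H`. -/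
abbrev dualBimonObj [BimonObj H] (hH : IsTransparent H) : BimonObj Hᘁ where
  toMonObj := dualMonObj H
  toComonObj := dualComonObj H
  mul_comul :=
    ((isMate_dualMul H Δ[H]).comp (isMate_dualComul H (opMul H))).unique
      (tensorPairing_dual_nondegenerate H)
      (((isMate_dualComul H (opMul H)).tensor (isMate_dualComul H (opMul H))).comp
        ((isMate_tensorμ _ _ _ _ hH hH).comp
          ((isMate_dualMul H Δ[H]).tensor (isMate_dualMul H Δ[H]))))
      (by rw [opMul_comul H hH, Category.assoc])
  one_comul :=
    ((isMate_dualOne H ε[H]).comp (isMate_dualComul H (opMul H))).unique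
      (tensorPairing_dual_nondegenerate H)
      ((IsMate.iso_inv (p := λ_ _) (u := (λ_ _).symm) (isMate_leftUnitor _)).comp
        ((isMate_dualOne H ε[H]).tensor (isMate_dualOne H ε[H])))
      (by
        rw [opMul, Category.assoc, BimonObj.mul_counit, Comon.tensorObj_counit,
          ← BraidedCategory.braiding_naturality_assoc]
        simp [← unitors_equal])
  mul_counit :=
    ((isMate_dualMul H Δ[H]).comp (isMate_dualCounit H η[H])).unique
      unitPairing_nondegenerate
      (((isMate_dualCounit H η[H]).tensor (isMate_dualCounit H η[H])).comp (isMate_leftUnitor _))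
      (by simp [MonObj.tensorObj.one_def])
  one_counit :=
    ((isMate_dualOne H ε[H]).comp (isMate_dualCounit H η[H])).unique
      unitPairing_nondegenerate (isMate_id _) (by simp)

end

/-! ### Convolution of pairings -/

section
variable {C : Type u} [Category.{v} C] [MonoidalCategory C]

section Conv
variable {P : C} [ComonObj P]

/-- The convolution product of two functionals on a comonoid. -/
def conv (u w : P ⟶ 𝟙_ C) : P ⟶ 𝟙_ C := Δ[P] ≫ (u ⊗ₘ w) ≫ (λ_ _).hom

/-- The left action `x ↦ u(x₁) x₂` of a functional `u` on a comonoid. -/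
def convL (u : P ⟶ 𝟙_ C) : P ⟶ P := Δ[P] ≫ u ▷ P ≫ (λ_ _).hom

/-- The right action `x ↦ x₁ u(x₂)` of a functional `u` on a comonoid. -/
def convR (u : P ⟶ 𝟙_ C) : P ⟶ P := Δ[P] ≫ P ◁ u ≫ (ρ_ _).hom

theorem convL_comp (u w : P ⟶ 𝟙_ C) : convL u ≫ w = conv u w := by
  simp [convL, conv, MonoidalCategory.tensorHom_def]

theorem convR_comp (u w : P ⟶ 𝟙_ C) : convR w ≫ u = conv u w := by
  simp [convR, conv, MonoidalCategory.tensorHom_def', unitors_equal]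

theorem convL_counit : convL ε[P] = 𝟙 P := by simp [convL]

theorem convR_counit : convR ε[P] = 𝟙 P := by simp [convR]

theorem convL_comul (u : P ⟶ 𝟙_ C) : convL u ≫ Δ[P] = Δ[P] ≫ convL u ▷ P := by
  have : u ▷ P ≫ (λ_ P).hom ≫ Δ[P] = P ◁ Δ[P] ≫ u ▷ (P ⊗ P) ≫ (λ_ (P ⊗ P)).hom := by
    rw [whisker_exchange_assoc, leftUnitor_naturality]
  simp [convL, this]

theorem convR_comul (u : P ⟶ 𝟙_ C) : convR u ≫ Δ[P] = Δ[P] ≫ P ◁ convR u := by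
  have : P ◁ u ≫ (ρ_ P).hom ≫ Δ[P] = Δ[P] ▷ P ≫ (P ⊗ P) ◁ u ≫ (ρ_ (P ⊗ P)).hom := by
    rw [← whisker_exchange_assoc, rightUnitor_naturality]
  simp [convR, this]

/-- The two actions of a functional agree in the middle of a comultiplication. -/
theorem comul_convR_whiskerRight (u : P ⟶ 𝟙_ C) : Δ[P] ≫ convR u ▷ P = Δ[P] ≫ P ◁ convL u := by
  simp [convR, convL]

theorem convL_convL (u w : P ⟶ 𝟙_ C) : convL u ≫ convL w = convL (conv u w) := by
  conv_lhs => rw [convL.eq_1 w, reassoc_of% convL_comul u, ← comp_whiskerRight_assoc, convL_comp]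
  rw [convL]

/-- The right action reverses convolution products. -/
theorem convR_convR (u w : P ⟶ 𝟙_ C) : convR u ≫ convR w = convR (conv w u) := by
  conv_lhs => rw [convR.eq_1 w, reassoc_of% convR_comul u,
    ← MonoidalCategory.whiskerLeft_comp_assoc, convR_comp]
  rw [convR]

/-- The left and right actions of functionals commute. -/
theorem convL_convR (u w : P ⟶ 𝟙_ C) : convL u ≫ convR w = convR w ≫ convL u := by
  conv_lhs => rw [convR, reassoc_of% convL_comul u, ← whisker_exchange_assoc]
  rw [convR, Category.assoc, Category.assoc, rightUnitor_naturality]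

theorem conv_assoc (a b c : P ⟶ 𝟙_ C) : conv (conv a b) c = conv a (conv b c) := by
  rw [← convL_comp, ← convL_convL, Category.assoc, convL_comp, convL_comp]

theorem counit_conv (a : P ⟶ 𝟙_ C) : conv ε[P] a = a := by
  rw [← convL_comp, convL_counit, Category.id_comp]

theorem conv_counit (a : P ⟶ 𝟙_ C) : conv a ε[P] = a := by
  rw [← convR_comp, convR_counit, Category.id_comp]

/-- Convolution inverses are unique. -/
theorem conv_inv_unique {a b c : P ⟶ 𝟙_ C} (h : conv b a = ε[P]) (h' : conv a c = ε[P]) :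
    b = c := by
  rw [← conv_counit b, ← h', ← conv_assoc, h, counit_conv]

variable {Q : C} [ComonObj Q]

theorem comp_conv (g : P ⟶ Q) [IsComonHom g] (u w : Q ⟶ 𝟙_ C) :
    g ≫ conv u w = conv (g ≫ u) (g ≫ w) := by
  simp [conv, IsComonHom.hom_comul_assoc]

theorem comp_convL (g : P ⟶ Q) [IsComonHom g] (u : Q ⟶ 𝟙_ C) :
    g ≫ convL u = convL (g ≫ u) ≫ g := by
  simp only [convL, IsComonHom.hom_comul_assoc, MonoidalCategory.tensorHom_def', Category.assoc,
    comp_whiskerRight, ← leftUnitor_naturality, ← whisker_exchange_assoc]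

theorem comp_convR (g : P ⟶ Q) [IsComonHom g] (u : Q ⟶ 𝟙_ C) :
    g ≫ convR u = convR (g ≫ u) ≫ g := by
  simp only [convR, IsComonHom.hom_comul_assoc, MonoidalCategory.tensorHom_def, Category.assoc,
    MonoidalCategory.whiskerLeft_comp, ← rightUnitor_naturality, whisker_exchange_assoc]

/-- The twist `x ↦ u(x₁) x₂ w(x₃)` of a comonoid by two functionals. For `w` the convolution inverse
of `u` this is the conjugation by `u`. -/
def twist (u w : P ⟶ 𝟙_ C) : P ⟶ P := convL u ≫ convR w

/-- Twists are natural for morphisms of comonoids. -/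
theorem comp_twist (g : P ⟶ Q) [IsComonHom g] (u w : Q ⟶ 𝟙_ C) :
    g ≫ twist u w = twist (g ≫ u) (g ≫ w) ≫ g := by
  rw [twist, ← Category.assoc, comp_convL, Category.assoc, comp_convR, twist, Category.assoc]

theorem twist_twist (u w u' w' : P ⟶ 𝟙_ C) :
    twist u w ≫ twist u' w' = twist (conv u u') (conv w' w) := by
  simp only [twist, Category.assoc]
  rw [← reassoc_of% convL_convR, ← convR_convR, ← convL_convL, Category.assoc]

theorem twist_counit : twist ε[P] ε[P] = 𝟙 P := by
  rw [twist, convL_counit, convR_counit, Category.comp_id]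

/-- Conjugation by an invertible functional is a morphism of comonoids. -/
theorem isComonHom_twist {u w : P ⟶ 𝟙_ C} (h : conv u w = ε[P]) (h' : conv w u = ε[P]) :
    IsComonHom (twist u w) where
  hom_counit := by
    rw [twist, Category.assoc, convR_comp, counit_conv, convL_comp, h]
  hom_comul := by
    -- `x₁ ⊗ x₂` may be expanded to `x₁ w(x₂) ⊗ u(x₃) x₄`, since `w` is inverse to `u`.
    have h1 : Δ[P] ≫ convR w ▷ P ≫ P ◁ convL u = Δ[P] := by
      rw [reassoc_of% comul_convR_whiskerRight, ← MonoidalCategory.whiskerLeft_comp,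
        convL_convL, h', convL_counit, MonoidalCategory.whiskerLeft_id, Category.comp_id]
    conv_lhs => rw [twist, Category.assoc, convR_comul, reassoc_of% convL_comul, ← h1]
    simp only [MonoidalCategory.tensorHom_def, twist, comp_whiskerRight,
      MonoidalCategory.whiskerLeft_comp, Category.assoc]
    rw [whisker_exchange_assoc, ← comp_whiskerRight_assoc, ← convL_convR,
      comp_whiskerRight_assoc]
end Conv

variable [BraidedCategory C]

section ComonHom

instance isComonHom_tensorHom {P Q P' Q' : C} [ComonObj P] [ComonObj Q] [ComonObj P'] [ComonObj Q']
    (f : P ⟶ P') (g : Q ⟶ Q') [IsComonHom f] [IsComonHom g] : IsComonHom (f ⊗ₘ g) :=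
  (Comon.Hom.mk' (M := ⟨P⟩) (N := ⟨P'⟩) f ⊗ₘ Comon.Hom.mk' (M := ⟨Q⟩) (N := ⟨Q'⟩) g :
    (⟨P⟩ : Comon C) ⊗ (⟨Q⟩ : Comon C) ⟶ ⟨P'⟩ ⊗ ⟨Q'⟩).isComonHom_hom

instance isComonHom_whiskerRight {P P' : C} [ComonObj P] [ComonObj P'] (f : P ⟶ P') [IsComonHom f]
    (Q : C) [ComonObj Q] : IsComonHom (f ▷ Q) := by
  rw [← tensorHom_id]; infer_instance

instance isComonHom_whiskerLeft {P P' : C} [ComonObj P] [ComonObj P'] (Q : C) [ComonObj Q]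
    (f : P ⟶ P') [IsComonHom f] : IsComonHom (Q ◁ f) := by
  rw [← id_tensorHom]; infer_instance

instance isComonHom_associator_hom (P Q R : C) [ComonObj P] [ComonObj Q] [ComonObj R] :
    IsComonHom (α_ P Q R).hom :=
  by
    have h := (α_ (⟨P⟩ : Comon C) ⟨Q⟩ ⟨R⟩).hom.isComonHom_hom
    have e : (α_ (⟨P⟩ : Comon C) ⟨Q⟩ ⟨R⟩).hom.hom = (α_ P Q R).hom := by
      refine (Functor.Monoidal.map_associator (Comon.forget C) ⟨P⟩ ⟨Q⟩ ⟨R⟩).trans ?_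
      change 𝟙 _ ≫ 𝟙 _ ▷ _ ≫ (α_ P Q R).hom ≫ _ ◁ 𝟙 _ ≫ 𝟙 _ = _
      simp
    rw [e] at h; exact h

instance isComonHom_associator_inv (P Q R : C) [ComonObj P] [ComonObj Q] [ComonObj R] :
    IsComonHom (α_ P Q R).inv := inferInstance

theorem isComonHom_braiding {P Q : C} [ComonObj P] [ComonObj Q] (hP : IsTransparent P) :
    IsComonHom (β_ P Q).hom where
  hom_counit := by
    rw [Comon.tensorObj_counit, ← BraidedCategory.braiding_naturality_assoc]
    simp [← unitors_equal, Comon.tensorObj_counit]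
  hom_comul := by
    rw [Comon.tensorObj_comul, ← BraidedCategory.braiding_naturality_assoc,
      braiding_tensorμ (hP.hom_hom _), Comon.tensorObj_comul, Category.assoc]

instance isComonHom_mul (A : C) [BimonObj A] : IsComonHom μ[A] where
  hom_counit := BimonObj.mul_counit A
  hom_comul := by rw [BimonObj.mul_comul, Comon.tensorObj_comul, Category.assoc]

theorem isComonHom_one_tensor (A P : C) [BimonObj A] [ComonObj P] :
    IsComonHom ((λ_ P).inv ≫ η[A] ▷ P) where
  hom_counit := by
    rw [Comon.tensorObj_counit, Category.assoc, MonoidalCategory.tensorHom_def, Category.assoc,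
      ← comp_whiskerRight_assoc, BimonObj.one_counit]
    simp
  hom_comul := by
    have h := tensor_left_unitality P P
    have e : (λ_ (𝟙_ C)).inv ▷ (P ⊗ P) ≫ tensorμ (𝟙_ C) (𝟙_ C) P P =
        (λ_ (P ⊗ P)).hom ≫ ((λ_ P).inv ⊗ₘ (λ_ P).inv) := by
      rw [h]; simp
    rw [Comon.tensorObj_comul, Category.assoc, MonoidalCategory.tensorHom_def, Category.assoc,
      ← comp_whiskerRight_assoc, BimonObj.one_comul, MonObj.tensorObj.one_def,
      comp_whiskerRight_assoc, ← whisker_exchange_assoc, ← whisker_exchange_assoc,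
      tensorμ_natural_left, reassoc_of% e, leftUnitor_naturality_assoc,
      Iso.inv_hom_id_assoc, tensorHom_comp_tensorHom]

theorem isComonHom_tensor_one (A P : C) [BimonObj A] [ComonObj P] :
    IsComonHom ((ρ_ P).inv ≫ P ◁ η[A]) where
  hom_counit := by
    rw [Comon.tensorObj_counit, Category.assoc, MonoidalCategory.tensorHom_def', Category.assoc,
      ← MonoidalCategory.whiskerLeft_comp_assoc, BimonObj.one_counit]
    simp [unitors_equal]
  hom_comul := by
    have h := tensor_right_unitality P P
    have e : (P ⊗ P) ◁ (λ_ (𝟙_ C)).inv ≫ tensorμ P P (𝟙_ C) (𝟙_ C) =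
        (ρ_ (P ⊗ P)).hom ≫ ((ρ_ P).inv ⊗ₘ (ρ_ P).inv) := by
      rw [h]; simp
    rw [Comon.tensorObj_comul, Category.assoc, MonoidalCategory.tensorHom_def', Category.assoc,
      ← MonoidalCategory.whiskerLeft_comp_assoc, BimonObj.one_comul, MonObj.tensorObj.one_def,
      MonoidalCategory.whiskerLeft_comp_assoc, whisker_exchange_assoc, whisker_exchange_assoc,
      tensorμ_natural_right, reassoc_of% e, rightUnitor_naturality_assoc,
      Iso.inv_hom_id_assoc, tensorHom_comp_tensorHom]

end ComonHom
end

/-! ### Skew pairings -/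

section
variable {C : Type u} [Category.{v} C] [MonoidalCategory C] [BraidedCategory C]

section
variable {P Q : C} [ComonObj P] [ComonObj Q]

theorem convL_tensor (u : P ⟶ 𝟙_ C) (w : Q ⟶ 𝟙_ C) :
    convL ((u ⊗ₘ w) ≫ (λ_ (𝟙_ C)).hom) = convL u ⊗ₘ convL w := by
  have n := tensorμ_natural u (𝟙 P) w (𝟙 Q)
  have e := leftUnitor_monoidal P Q
  rw [id_tensorHom_id, tensorHom_id, tensorHom_id, tensorHom_id] at n
  rw [convL, Comon.tensorObj_comul, comp_whiskerRight, Category.assoc, Category.assoc,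
    ← reassoc_of% n, ← e, tensorHom_comp_tensorHom, tensorHom_comp_tensorHom]
  simp only [convL]

theorem convR_tensor (u : P ⟶ 𝟙_ C) (w : Q ⟶ 𝟙_ C) :
    convR ((u ⊗ₘ w) ≫ (λ_ (𝟙_ C)).hom) = convR u ⊗ₘ convR w := by
  have n := tensorμ_natural (𝟙 P) u (𝟙 Q) w
  have e := rightUnitor_monoidal P Q
  rw [id_tensorHom_id, id_tensorHom, id_tensorHom, id_tensorHom] at n
  rw [convR, Comon.tensorObj_comul, MonoidalCategory.whiskerLeft_comp, Category.assoc,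
    Category.assoc, ← reassoc_of% n, ← e, tensorHom_comp_tensorHom, tensorHom_comp_tensorHom]
  simp only [convR]

theorem conv_tensor (u u' : P ⟶ 𝟙_ C) (w w' : Q ⟶ 𝟙_ C) :
    conv ((u ⊗ₘ w) ≫ (λ_ (𝟙_ C)).hom) ((u' ⊗ₘ w') ≫ (λ_ (𝟙_ C)).hom) =
      (conv u u' ⊗ₘ conv w w') ≫ (λ_ (𝟙_ C)).hom := by
  rw [← convL_comp, convL_tensor, tensorHom_comp_tensorHom_assoc, convL_comp, convL_comp]

theorem twist_whiskerRight (u w : P ⟶ 𝟙_ C) :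
    twist u w ▷ Q = twist ((u ⊗ₘ ε[Q]) ≫ (λ_ (𝟙_ C)).hom) ((w ⊗ₘ ε[Q]) ≫ (λ_ (𝟙_ C)).hom) := by
  rw [twist, twist, convL_tensor, convR_tensor, tensorHom_comp_tensorHom, convL_counit,
    convR_counit, Category.comp_id, tensorHom_id]

theorem whiskerLeft_twist (u w : P ⟶ 𝟙_ C) :
    Q ◁ twist u w = twist ((ε[Q] ⊗ₘ u) ≫ (λ_ (𝟙_ C)).hom) ((ε[Q] ⊗ₘ w) ≫ (λ_ (𝟙_ C)).hom) := by
  rw [twist, twist, convL_tensor, convR_tensor, tensorHom_comp_tensorHom, convL_counit,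
    convR_counit, Category.comp_id, id_tensorHom]

/-- The two projections of a tensor product of comonoids jointly recover it. -/
theorem comul_proj : Δ[P ⊗ Q] ≫ ((P ◁ ε[Q] ≫ (ρ_ P).hom) ⊗ₘ (ε[P] ▷ Q ≫ (λ_ Q).hom)) =
    𝟙 (P ⊗ Q) := by
  rw [Comon.tensorObj_comul, ← tensorHom_comp_tensorHom]
  have n := tensorμ_natural (𝟙 P) ε[P] ε[Q] (𝟙 Q)
  rw [id_tensorHom, tensorHom_id, id_tensorHom, tensorHom_id] at n
  rw [Category.assoc, ← reassoc_of% n, tensorHom_comp_tensorHom_assoc, ComonObj.comul_counit,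
    ComonObj.counit_comul, tensorμ]
  simp only [braiding_tensorUnit_left]
  simp only [MonoidalCategory.tensorHom_def]
  monoidal

/-- The two projections of a tensor product of comonoids, taken in the opposite order, give the
braiding. -/
theorem comul_proj_swap : Δ[P ⊗ Q] ≫ ((ε[P] ▷ Q ≫ (λ_ Q).hom) ⊗ₘ (P ◁ ε[Q] ≫ (ρ_ P).hom)) =
    (β_ P Q).hom := by
  rw [Comon.tensorObj_comul, ← tensorHom_comp_tensorHom]
  have n := tensorμ_natural ε[P] (𝟙 P) (𝟙 Q) ε[Q]
  rw [id_tensorHom, tensorHom_id, id_tensorHom, tensorHom_id] at n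
  rw [Category.assoc, ← reassoc_of% n, tensorHom_comp_tensorHom_assoc, ComonObj.comul_counit,
    ComonObj.counit_comul, tensorμ]
  simp only [MonoidalCategory.tensorHom_def]
  monoidal

omit [ComonObj Q] in
theorem conv_whiskerLeft {R : C} [ComonObj R] (τ : P ⊗ Q ⟶ 𝟙_ C) (a b : R ⟶ Q) :
    conv (P ◁ a ≫ τ) (P ◁ b ≫ τ) =
      Δ[P] ▷ R ≫ (P ⊗ P) ◁ (Δ[R] ≫ (a ⊗ₘ b)) ≫ tensorμ P P Q Q ≫ (τ ⊗ₘ τ) ≫ (λ_ _).hom := by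
  rw [conv, Comon.tensorObj_comul, MonoidalCategory.whiskerLeft_comp_assoc,
    tensorμ_natural_right_assoc, tensorHom_comp_tensorHom_assoc, MonoidalCategory.tensorHom_def]
  simp only [Category.assoc]

omit [ComonObj P] in
theorem conv_whiskerRight {R : C} [ComonObj R] (τ : P ⊗ Q ⟶ 𝟙_ C) (a b : R ⟶ P) :
    conv (a ▷ Q ≫ τ) (b ▷ Q ≫ τ) =
      R ◁ Δ[Q] ≫ (Δ[R] ≫ (a ⊗ₘ b)) ▷ (Q ⊗ Q) ≫ tensorμ P P Q Q ≫ (τ ⊗ₘ τ) ≫ (λ_ _).hom := by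
  rw [conv, Comon.tensorObj_comul, comp_whiskerRight_assoc,
    tensorμ_natural_left_assoc, tensorHom_comp_tensorHom_assoc, MonoidalCategory.tensorHom_def']
  simp only [Category.assoc]

end

/-- A convolution invertible skew pairing of bimonoids: a functional `τ` on `H ⊗ B` with inverse
`τ'` such that `τ(h h', f) = τ(h', f₁) τ(h, f₂)` and `τ(h, f f') = τ(h₁, f) τ(h₂, f')`, and that
is compatible with the units. -/
structure SkewPairing (H B : C) [BimonObj H] [BimonObj B] where
  /-- The pairing. -/
  τ : H ⊗ B ⟶ 𝟙_ C
  /-- The convolution inverse of the pairing. -/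
  τ' : H ⊗ B ⟶ 𝟙_ C
  conv_inv : conv τ τ' = ε[H ⊗ B]
  inv_conv : conv τ' τ = ε[H ⊗ B]
  mul_left : μ[H] ▷ B ≫ τ = (H ⊗ H) ◁ Δ[B] ≫ (β_ H H).hom ▷ (B ⊗ B) ≫ tensorμ H H B B ≫
    (τ ⊗ₘ τ) ≫ (λ_ _).hom
  mul_right : H ◁ μ[B] ≫ τ = Δ[H] ▷ (B ⊗ B) ≫ tensorμ H H B B ≫ (τ ⊗ₘ τ) ≫ (λ_ _).hom
  one_left : η[H] ▷ B ≫ τ = (λ_ B).hom ≫ ε[B]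
  one_right : H ◁ η[B] ≫ τ = (ρ_ H).hom ≫ ε[H]

namespace SkewPairing
variable {H B : C} [BimonObj H] [BimonObj B] (p : SkewPairing H B)

/-- The exchange morphism `h ⊗ f ↦ τ(h₁, f₁) f₂ ⊗ h₂ τ⁻¹(h₃, f₃)`. -/
def exch : H ⊗ B ⟶ B ⊗ H := twist p.τ p.τ' ≫ (β_ H B).hom

theorem isComonHom_exch (hH : IsTransparent H) : IsComonHom p.exch :=
  have := isComonHom_twist p.conv_inv p.inv_conv
  have := isComonHom_braiding (Q := B) hH
  inferInstanceAs (IsComonHom (_ ≫ _))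

/-- A left convolution inverse of the pullback of `τ` along a morphism of comonoids is the pullback
of `τ'`. This yields the multiplicativity of `τ'` from that of `τ`. -/
theorem comp_inv_eq {R : C} [ComonObj R] (g : R ⟶ H ⊗ B) [IsComonHom g] {w : R ⟶ 𝟙_ C}
    (h : conv w (g ≫ p.τ) = ε[R]) : g ≫ p.τ' = w := by
  symm
  apply conv_inv_unique h
  rw [← comp_conv, p.conv_inv, IsComonHom.hom_counit]

/-- Where `τ` is trivial, the exchange is the braiding. -/
theorem comp_exch_eq {R : C} [ComonObj R] (g : R ⟶ H ⊗ B) [IsComonHom g] (h : g ≫ p.τ = ε[R]) :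
    g ≫ p.exch = g ≫ (β_ H B).hom := by
  have h' : g ≫ p.τ' = ε[R] := p.comp_inv_eq g (by rw [h, counit_conv])
  rw [exch, reassoc_of% comp_twist g, h, h', twist_counit, Category.id_comp]

theorem one_exch : η[H] ▷ B ≫ p.exch = (λ_ B).hom ≫ (ρ_ B).inv ≫ B ◁ η[H] := by
  have := isComonHom_one_tensor H B
  rw [← Iso.inv_comp_eq, ← Category.assoc, p.comp_exch_eq _ (by simp [p.one_left])]
  simp

theorem exch_one : H ◁ η[B] ≫ p.exch = (ρ_ H).hom ≫ (λ_ H).inv ≫ η[B] ▷ H := by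
  have := isComonHom_tensor_one B H
  rw [← Iso.inv_comp_eq, ← Category.assoc, p.comp_exch_eq _ (by simp [p.one_right])]
  simp

/-- The exchange is compatible with the multiplication of `B`: both sides are twists of `H ⊗ B ⊗ B`
followed by `μ[B]` and the braiding, with functionals that agree by `mul_right`. -/
theorem whiskerLeft_mul_exch (hH : IsTransparent H) :
    H ◁ μ[B] ≫ p.exch = (α_ H B B).inv ≫ p.exch ▷ B ≫ (α_ B H B).hom ≫ B ◁ p.exch ≫
      (α_ B B H).inv ≫ μ[B] ▷ H := by
  have := isComonHom_braiding (Q := B) hH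
  -- `Q` moves `h` past the first factor `B`; the second exchange is performed after it.
  set Q : H ⊗ (B ⊗ B) ⟶ B ⊗ (H ⊗ B) := (α_ H B B).inv ≫ (β_ H B).hom ▷ B ≫ (α_ B H B).hom with hQ
  have hu : ∀ t : H ⊗ B ⟶ 𝟙_ C, (α_ H B B).inv ≫ (t ⊗ₘ ε[B]) ≫ (λ_ (𝟙_ C)).hom =
      H ◁ (B ◁ ε[B] ≫ (ρ_ B).hom) ≫ t := by
    intro t; simp [MonoidalCategory.tensorHom_def', unitors_equal]
  have hw : ∀ t : H ⊗ B ⟶ 𝟙_ C, Q ≫ (ε[B] ⊗ₘ t) ≫ (λ_ (𝟙_ C)).hom =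
      H ◁ (ε[B] ▷ B ≫ (λ_ B).hom) ≫ t := by
    intro t
    rw [hQ, MonoidalCategory.tensorHom_def]
    simp only [Category.assoc, ← associator_naturality_left_assoc, ← comp_whiskerRight_assoc,
      ← BraidedCategory.braiding_naturality_right]
    simp
  have h1 : conv (H ◁ (B ◁ ε[B] ≫ (ρ_ B).hom) ≫ p.τ) (H ◁ (ε[B] ▷ B ≫ (λ_ B).hom) ≫ p.τ) =
      H ◁ μ[B] ≫ p.τ := by
    rw [conv_whiskerLeft, comul_proj, p.mul_right]; simp
  have h2 : conv (H ◁ (ε[B] ▷ B ≫ (λ_ B).hom) ≫ p.τ') (H ◁ (B ◁ ε[B] ≫ (ρ_ B).hom) ≫ p.τ') =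
      H ◁ μ[B] ≫ p.τ' := by
    symm
    apply p.comp_inv_eq
    rw [← h1, conv_assoc, ← conv_assoc (H ◁ (B ◁ ε[B] ≫ (ρ_ B).hom) ≫ p.τ'), ← hu, ← hu,
      ← comp_conv, conv_tensor, p.inv_conv, conv_counit, ← Comon.tensorObj_counit,
      IsComonHom.hom_counit, counit_conv, ← hw, ← hw, ← comp_conv, conv_tensor, p.inv_conv,
      conv_counit, ← Comon.tensorObj_counit, IsComonHom.hom_counit]
  rw [exch, reassoc_of% comp_twist (H ◁ μ[B]), comp_whiskerRight, twist_whiskerRight]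
  simp only [Category.assoc, MonoidalCategory.whiskerLeft_comp]
  rw [reassoc_of% comp_twist (α_ H B B).inv, whiskerLeft_twist, hu, hu]
  have hQ' := reassoc_of% hQ
  rw [← hQ', reassoc_of% comp_twist Q, reassoc_of% twist_twist, hw, hw, h1, h2, hQ']
  rw [BraidedCategory.braiding_naturality_right, BraidedCategory.braiding_tensor_right_hom]
  simp

/-- The exchange is compatible with the multiplication of `H`; the counterpart of
`whiskerLeft_mul_exch`, based on `mul_left`. -/
theorem mul_whiskerRight_exch (hH : IsTransparent H) :
    μ[H] ▷ B ≫ p.exch = (α_ H H B).hom ≫ H ◁ p.exch ≫ (α_ H B H).inv ≫ p.exch ▷ H ≫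
      (α_ B H H).hom ≫ B ◁ μ[H] := by
  have := isComonHom_braiding (Q := B) hH
  -- `Q` moves `f` past the second factor `H`; the second exchange is performed after it.
  set Q : (H ⊗ H) ⊗ B ⟶ (H ⊗ B) ⊗ H := (α_ H H B).hom ≫ H ◁ (β_ H B).hom ≫ (α_ H B H).inv with hQ
  have hu : ∀ t : H ⊗ B ⟶ 𝟙_ C, (α_ H H B).hom ≫ (ε[H] ⊗ₘ t) ≫ (λ_ (𝟙_ C)).hom =
      (ε[H] ▷ H ≫ (λ_ H).hom) ▷ B ≫ t := by
    intro t; simp [MonoidalCategory.tensorHom_def]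
  have hw : ∀ t : H ⊗ B ⟶ 𝟙_ C, Q ≫ (t ⊗ₘ ε[H]) ≫ (λ_ (𝟙_ C)).hom =
      (H ◁ ε[H] ≫ (ρ_ H).hom) ▷ B ≫ t := by
    intro t
    rw [hQ, MonoidalCategory.tensorHom_def']
    simp only [Category.assoc, ← associator_inv_naturality_right_assoc,
      ← MonoidalCategory.whiskerLeft_comp_assoc, ← BraidedCategory.braiding_naturality_left]
    simp [unitors_equal]
  have h1 : conv ((ε[H] ▷ H ≫ (λ_ H).hom) ▷ B ≫ p.τ) ((H ◁ ε[H] ≫ (ρ_ H).hom) ▷ B ≫ p.τ) =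
      μ[H] ▷ B ≫ p.τ := by
    rw [conv_whiskerRight, comul_proj_swap, p.mul_left]
  have h2 : conv ((H ◁ ε[H] ≫ (ρ_ H).hom) ▷ B ≫ p.τ') ((ε[H] ▷ H ≫ (λ_ H).hom) ▷ B ≫ p.τ') =
      μ[H] ▷ B ≫ p.τ' := by
    symm
    apply p.comp_inv_eq
    rw [← h1, conv_assoc, ← conv_assoc ((ε[H] ▷ H ≫ (λ_ H).hom) ▷ B ≫ p.τ'), ← hu, ← hu,
      ← comp_conv, conv_tensor, p.inv_conv, conv_counit, ← Comon.tensorObj_counit,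
      IsComonHom.hom_counit, counit_conv, ← hw, ← hw, ← comp_conv, conv_tensor, p.inv_conv,
      conv_counit, ← Comon.tensorObj_counit, IsComonHom.hom_counit]
  rw [exch, reassoc_of% comp_twist (μ[H] ▷ B), MonoidalCategory.whiskerLeft_comp, whiskerLeft_twist]
  simp only [Category.assoc, comp_whiskerRight]
  rw [reassoc_of% comp_twist (α_ H H B).hom, twist_whiskerRight, hu, hu]
  have hQ' := reassoc_of% hQ
  rw [← hQ', reassoc_of% comp_twist Q, reassoc_of% twist_twist, hw, hw, h1, h2, hQ']
  rw [BraidedCategory.braiding_naturality_left, BraidedCategory.braiding_tensor_left_hom]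
  simp

end SkewPairing
end

/-! ### Smash products along a distributive law -/

section
variable {C : Type u} [Category.{v} C] [MonoidalCategory C]

/-- `E` is a distributive law between the monoids `H` and `B`: it moves units and products of either
monoid past the other one. -/
structure IsDistributive {H B : C} [MonObj H] [MonObj B] (E : H ⊗ B ⟶ B ⊗ H) : Prop where
  one_left : η[H] ▷ B ≫ E = (λ_ B).hom ≫ (ρ_ B).inv ≫ B ◁ η[H]
  one_right : H ◁ η[B] ≫ E = (ρ_ H).hom ≫ (λ_ H).inv ≫ η[B] ▷ H
  mul_left : μ[H] ▷ B ≫ E = (α_ H H B).hom ≫ H ◁ E ≫ (α_ H B H).inv ≫ E ▷ H ≫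
    (α_ B H H).hom ≫ B ◁ μ[H]
  mul_right : H ◁ μ[B] ≫ E = (α_ H B B).inv ≫ E ▷ B ≫ (α_ B H B).hom ≫ B ◁ E ≫
    (α_ B B H).inv ≫ μ[B] ▷ H

variable {H B : C} [MonObj H] [MonObj B]

/-- The multiplication `(f ⊗ h)(f' ⊗ h') = f E(h ⊗ f') h'` on `B ⊗ H`. -/
def smashMul (E : H ⊗ B ⟶ B ⊗ H) : (B ⊗ H) ⊗ (B ⊗ H) ⟶ B ⊗ H :=
  (α_ B H (B ⊗ H)).hom ≫ B ◁ (α_ H B H).inv ≫ B ◁ E ▷ H ⊗≫ (μ[B] ⊗ₘ μ[H])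

variable (H B) in
/-- The unit of `B ⊗ H`. -/
def smashOne : 𝟙_ C ⟶ B ⊗ H := (λ_ (𝟙_ C)).inv ≫ (η[B] ⊗ₘ η[H])

/-- The action of `B ⊗ H` obtained from actions of the two factors, `H` acting first. -/
def smashAct {M : C} (a : H ⊗ M ⟶ M) (b : B ⊗ M ⟶ M) : (B ⊗ H) ⊗ M ⟶ M :=
  (α_ B H M).hom ≫ B ◁ a ≫ b

theorem smashAct_one {M : C} {a : H ⊗ M ⟶ M} {b : B ⊗ M ⟶ M}
    (ha : η[H] ▷ M ≫ a = (λ_ M).hom) (hb : η[B] ▷ M ≫ b = (λ_ M).hom) :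
    smashOne H B ▷ M ≫ smashAct a b = (λ_ M).hom := by
  calc
    _ = 𝟙 _ ⊗≫ (η[B] ▷ (𝟙_ C ⊗ M) ≫ B ◁ (η[H] ▷ M ≫ a)) ≫ b := by
      rw [smashOne, smashAct, MonoidalCategory.tensorHom_def]; monoidal
    _ = 𝟙 _ ⊗≫ η[B] ▷ M ≫ b := by rw [ha, ← whisker_exchange]; monoidal
    _ = _ := by rw [hb]; monoidal

/-- Actions of `H` and `B` satisfying the exchange relation define an action of `B ⊗ H`. -/
theorem smashAct_mul {E : H ⊗ B ⟶ B ⊗ H} {M : C} {a : H ⊗ M ⟶ M} {b : B ⊗ M ⟶ M}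
    (ha : μ[H] ▷ M ≫ a = (α_ H H M).hom ≫ H ◁ a ≫ a)
    (hb : μ[B] ▷ M ≫ b = (α_ B B M).hom ≫ B ◁ b ≫ b)
    (hab : H ◁ b ≫ a = (α_ H B M).inv ≫ E ▷ M ≫ smashAct a b) :
    smashMul E ▷ M ≫ smashAct a b =
      (α_ (B ⊗ H) (B ⊗ H) M).hom ≫ (B ⊗ H) ◁ smashAct a b ≫ smashAct a b := by
  calc
    _ = 𝟙 _ ⊗≫ B ◁ E ▷ H ▷ M ⊗≫ (μ[B] ▷ ((H ⊗ H) ⊗ M) ≫ B ◁ (μ[H] ▷ M ≫ a)) ≫ b := by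
      rw [smashMul, smashAct, MonoidalCategory.tensorHom_def]; monoidal
    _ = 𝟙 _ ⊗≫ B ◁ E ▷ H ▷ M ⊗≫ (B ⊗ B) ◁ (H ◁ a ≫ a) ⊗≫ (μ[B] ▷ M ≫ b) := by
      rw [← whisker_exchange, ha]; monoidal
    _ = 𝟙 _ ⊗≫ B ◁ (E ▷ (H ⊗ M) ≫ (B ⊗ H) ◁ a) ⊗≫ B ◁ B ◁ a ⊗≫ B ◁ b ⊗≫ b := by
      rw [hb]; monoidal
    _ = 𝟙 _ ⊗≫ B ◁ H ◁ B ◁ a ⊗≫ B ◁ ((α_ H B M).inv ≫ E ▷ M ≫ smashAct a b) ⊗≫ b := by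
      rw [← whisker_exchange, smashAct]; monoidal
    _ = 𝟙 _ ⊗≫ B ◁ H ◁ (B ◁ a ≫ b) ⊗≫ B ◁ a ⊗≫ b := by rw [← hab]; monoidal
    _ = _ := by simp only [smashAct]; monoidal

variable (H B) in
/-- The inclusion `h ↦ 1 ⊗ h`. -/
def inclH : H ⟶ B ⊗ H := (λ_ H).inv ≫ η[B] ▷ H

variable (H B) in
/-- The inclusion `f ↦ f ⊗ 1`. -/
def inclB : B ⟶ B ⊗ H := (ρ_ B).inv ≫ B ◁ η[H]

omit [MonObj H] in
theorem inclH_smashAct {M : C} {a : H ⊗ M ⟶ M} {b : B ⊗ M ⟶ M}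
    (hb : η[B] ▷ M ≫ b = (λ_ M).hom) : inclH H B ▷ M ≫ smashAct a b = a := by
  calc
    _ = 𝟙 _ ⊗≫ (η[B] ▷ (H ⊗ M) ≫ B ◁ a) ≫ b := by
      rw [inclH, smashAct]; monoidal
    _ = 𝟙 _ ⊗≫ a ⊗≫ η[B] ▷ M ≫ b := by rw [← whisker_exchange]; monoidal
    _ = _ := by rw [hb]; monoidal

omit [MonObj B] in
theorem inclB_smashAct {M : C} {a : H ⊗ M ⟶ M} {b : B ⊗ M ⟶ M}
    (ha : η[H] ▷ M ≫ a = (λ_ M).hom) : inclB H B ▷ M ≫ smashAct a b = b := by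
  calc
    _ = 𝟙 _ ⊗≫ B ◁ (η[H] ▷ M ≫ a) ≫ b := by rw [inclB, smashAct]; monoidal
    _ = _ := by rw [ha]; monoidal

variable {E : H ⊗ B ⟶ B ⊗ H}

theorem smashMul_one (hE : IsDistributive E) :
    (B ⊗ H) ◁ smashOne H B ≫ smashMul E = (ρ_ (B ⊗ H)).hom := by
  calc
    _ = 𝟙 _ ⊗≫ (B ⊗ H) ◁ (𝟙_ C ◁ η[H] ≫ η[B] ▷ H) ⊗≫ B ◁ E ▷ H ⊗≫ (μ[B] ⊗ₘ μ[H]) := by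
      rw [smashMul, smashOne, MonoidalCategory.tensorHom_def']; monoidal
    _ = 𝟙 _ ⊗≫ (B ⊗ H) ◁ η[H] ⊗≫ B ◁ (H ◁ η[B] ≫ E) ▷ H ⊗≫ (μ[B] ⊗ₘ μ[H]) := by monoidal
    _ = 𝟙 _ ⊗≫ ((B ⊗ H) ◁ η[H] ≫ (B ⊗ H) ◁ (λ_ H).inv) ⊗≫ B ◁ η[B] ▷ (H ⊗ H) ⊗≫
          (μ[B] ▷ (H ⊗ H) ≫ B ◁ μ[H]) := by
      rw [hE.one_right, MonoidalCategory.tensorHom_def]; monoidal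
    _ = 𝟙 _ ⊗≫ (B ⊗ H) ◁ η[H] ⊗≫ (B ◁ η[B] ≫ μ[B]) ▷ (H ⊗ H) ⊗≫ B ◁ μ[H] := by monoidal
    _ = 𝟙 _ ⊗≫ B ◁ (H ◁ η[H] ≫ μ[H]) := by rw [MonObj.mul_one]; monoidal
    _ = _ := by rw [MonObj.mul_one]; monoidal

/-- Left multiplication on `B ⊗ H` is the action obtained from the left multiplications by elements
of `H` and of `B`. The monoid axioms thus become axioms of an action. -/
theorem smashMul_eq_smashAct :
    smashMul E = smashAct ((α_ H B H).inv ≫ E ▷ H ≫ (α_ B H H).hom ≫ B ◁ μ[H])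
      ((α_ B B H).inv ≫ μ[B] ▷ H) := by
  rw [smashMul, smashAct, MonoidalCategory.tensorHom_def']
  monoidal

/-- The monoid structure on `B ⊗ H` determined by a distributive law. -/
abbrev smashMonObj (hE : IsDistributive E) : MonObj (B ⊗ H) where
  one := smashOne H B
  mul := smashMul E
  one_mul := by
    rw [smashMul_eq_smashAct]
    apply smashAct_one
    · rw [associator_inv_naturality_left_assoc, ← comp_whiskerRight_assoc, hE.one_left]
      simp only [comp_whiskerRight, Category.assoc, associator_naturality_middle_assoc]
      rw [← MonoidalCategory.whiskerLeft_comp, MonObj.one_mul]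
      monoidal
    · rw [associator_inv_naturality_left_assoc, ← comp_whiskerRight, MonObj.one_mul]
      monoidal
  mul_one := smashMul_one hE
  mul_assoc := by
    have key := smashAct_mul (E := E) (M := B ⊗ H)
      (a := (α_ H B H).inv ≫ E ▷ H ≫ (α_ B H H).hom ≫ B ◁ μ[H])
      (b := (α_ B B H).inv ≫ μ[B] ▷ H) ?_ ?_ ?_
    · rwa [← smashMul_eq_smashAct] at key
    · calc
        _ = 𝟙 _ ⊗≫ (μ[H] ▷ B ≫ E) ▷ H ⊗≫ B ◁ μ[H] := by monoidal
        _ = 𝟙 _ ⊗≫ H ◁ E ▷ H ⊗≫ E ▷ H ▷ H ⊗≫ B ◁ (μ[H] ▷ H ≫ μ[H]) := by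
          rw [hE.mul_left]; monoidal
        _ = 𝟙 _ ⊗≫ H ◁ E ▷ H ⊗≫ (E ▷ (H ⊗ H) ≫ (B ⊗ H) ◁ μ[H]) ⊗≫ B ◁ μ[H] := by
          rw [MonObj.mul_assoc]; monoidal
        _ = _ := by rw [← whisker_exchange]; monoidal
    · calc
        _ = 𝟙 _ ⊗≫ (μ[B] ▷ B ≫ μ[B]) ▷ H := by monoidal
        _ = _ := by rw [MonObj.mul_assoc]; monoidal
    · calc
        _ = 𝟙 _ ⊗≫ (H ◁ μ[B] ≫ E) ▷ H ⊗≫ B ◁ μ[H] := by monoidal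
        _ = 𝟙 _ ⊗≫ E ▷ B ▷ H ⊗≫ B ◁ E ▷ H ⊗≫ (μ[B] ▷ (H ⊗ H) ≫ B ◁ μ[H]) := by
          rw [hE.mul_right]; monoidal
        _ = _ := by rw [← whisker_exchange, smashAct]; monoidal

/-- `(f ⊗ 1)(1 ⊗ h) = f ⊗ h`. -/
theorem inclB_inclH_smashMul (hE : IsDistributive E) :
    (inclB H B ⊗ₘ inclH H B) ≫ smashMul E = 𝟙 (B ⊗ H) := by
  calc
    _ = 𝟙 _ ⊗≫ B ◁ (η[H] ▷ (𝟙_ C ⊗ H) ≫ H ◁ η[B] ▷ H) ⊗≫ B ◁ E ▷ H ⊗≫ (μ[B] ⊗ₘ μ[H]) := by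
      rw [smashMul, inclB, inclH, MonoidalCategory.tensorHom_def (_ ≫ _)]; monoidal
    _ = 𝟙 _ ⊗≫ B ◁ (η[H] ▷ (𝟙_ C ⊗ H)) ⊗≫ B ◁ (H ◁ η[B] ≫ E) ▷ H ⊗≫ (μ[B] ⊗ₘ μ[H]) := by monoidal
    _ = 𝟙 _ ⊗≫ B ◁ (η[H] ▷ H) ⊗≫ B ◁ η[B] ▷ (H ⊗ H) ⊗≫
          (μ[B] ▷ (H ⊗ H) ≫ B ◁ μ[H]) := by
      rw [hE.one_right, MonoidalCategory.tensorHom_def]; monoidal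
    _ = 𝟙 _ ⊗≫ B ◁ (η[H] ▷ H) ⊗≫ (B ◁ η[B] ≫ μ[B]) ▷ (H ⊗ H) ⊗≫ B ◁ μ[H] := by monoidal
    _ = 𝟙 _ ⊗≫ B ◁ (η[H] ▷ H ≫ μ[H]) := by rw [MonObj.mul_one]; monoidal
    _ = _ := by rw [MonObj.one_mul]; monoidal

/-- `(1 ⊗ h)(f ⊗ 1) = E(h ⊗ f)`. -/
theorem inclH_inclB_smashMul :
    (inclH H B ⊗ₘ inclB H B) ≫ smashMul E = E := by
  calc
    _ = 𝟙 _ ⊗≫ (η[B] ▷ (H ⊗ B ⊗ 𝟙_ C) ≫ B ◁ (H ◁ B ◁ η[H])) ⊗≫ B ◁ E ▷ H ⊗≫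
          (μ[B] ⊗ₘ μ[H]) := by
      rw [smashMul, inclB, inclH, MonoidalCategory.tensorHom_def (_ ≫ _)]; monoidal
    _ = 𝟙 _ ⊗≫ (H ⊗ B) ◁ η[H] ⊗≫ (η[B] ▷ ((H ⊗ B) ⊗ H) ≫ B ◁ (E ▷ H)) ⊗≫
          (μ[B] ⊗ₘ μ[H]) := by
      rw [← whisker_exchange]; monoidal
    _ = 𝟙 _ ⊗≫ ((H ⊗ B) ◁ η[H] ≫ E ▷ H) ⊗≫ η[B] ▷ ((B ⊗ H) ⊗ H) ⊗≫
          (μ[B] ▷ (H ⊗ H) ≫ B ◁ μ[H]) := by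
      rw [← whisker_exchange, MonoidalCategory.tensorHom_def]; monoidal
    _ = 𝟙 _ ⊗≫ E ⊗≫ B ◁ H ◁ η[H] ⊗≫ (η[B] ▷ B ≫ μ[B]) ▷ (H ⊗ H) ⊗≫ B ◁ μ[H] := by
      rw [whisker_exchange]; monoidal
    _ = 𝟙 _ ⊗≫ E ⊗≫ B ◁ (H ◁ η[H] ≫ μ[H]) := by rw [MonObj.one_mul]; monoidal
    _ = _ := by rw [MonObj.mul_one]; monoidal

theorem mul_inclH (hE : IsDistributive E) :
    (inclH H B ⊗ₘ inclH H B) ≫ smashMul E = μ[H] ≫ inclH H B := by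
  calc
    _ = 𝟙 _ ⊗≫ η[B] ▷ (H ⊗ 𝟙_ C ⊗ H) ⊗≫ B ◁ (H ◁ η[B] ≫ E) ▷ H ⊗≫ (μ[B] ⊗ₘ μ[H]) := by
      rw [smashMul, inclH, MonoidalCategory.tensorHom_def (_ ≫ _)]; monoidal
    _ = 𝟙 _ ⊗≫ η[B] ▷ (H ⊗ H) ⊗≫ (B ◁ η[B] ≫ μ[B]) ▷ (H ⊗ H) ⊗≫ B ◁ μ[H] := by
      rw [hE.one_right, MonoidalCategory.tensorHom_def]; monoidal
    _ = 𝟙 _ ⊗≫ (η[B] ▷ (H ⊗ H) ≫ B ◁ μ[H]) := by rw [MonObj.mul_one]; monoidal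
    _ = _ := by rw [← whisker_exchange, inclH]; monoidal

theorem mul_inclB (hE : IsDistributive E) :
    (inclB H B ⊗ₘ inclB H B) ≫ smashMul E = μ[B] ≫ inclB H B := by
  calc
    _ = 𝟙 _ ⊗≫ B ◁ (η[H] ▷ (B ⊗ 𝟙_ C) ≫ H ◁ B ◁ η[H]) ⊗≫ B ◁ E ▷ H ⊗≫ (μ[B] ⊗ₘ μ[H]) := by
      rw [smashMul, inclB, MonoidalCategory.tensorHom_def (_ ≫ _)]; monoidal
    _ = 𝟙 _ ⊗≫ B ◁ B ◁ η[H] ⊗≫ B ◁ (η[H] ▷ B ≫ E) ▷ H ⊗≫ (μ[B] ⊗ₘ μ[H]) := by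
      rw [← whisker_exchange]; monoidal
    _ = 𝟙 _ ⊗≫ B ◁ B ◁ η[H] ⊗≫ ((B ⊗ B) ◁ (η[H] ▷ H ≫ μ[H])) ⊗≫ μ[B] ▷ H := by
      rw [hE.one_left, MonoidalCategory.tensorHom_def']; monoidal
    _ = 𝟙 _ ⊗≫ ((B ⊗ B) ◁ η[H] ≫ μ[B] ▷ H) := by rw [MonObj.one_mul]; monoidal
    _ = _ := by rw [whisker_exchange, inclB]; monoidal

end

/-! ### The smash product of a skew pairing -/

section
variable {C : Type u} [Category.{v} C] [MonoidalCategory C]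

section
variable {H B : C} [MonObj H] [MonObj B] {E : H ⊗ B ⟶ B ⊗ H}

/-- `x (y m) = (x y) m` for generalized elements `x` and `y` of an algebra acting on `M`. -/
theorem act_act {D M X Y : C} {m : D ⊗ D ⟶ D} {g : D ⊗ M ⟶ M}
    (hg : m ▷ M ≫ g = (α_ D D M).hom ≫ D ◁ g ≫ g) (x : X ⟶ D) (y : Y ⟶ D) :
    X ◁ (y ▷ M ≫ g) ≫ x ▷ M ≫ g = (α_ X Y M).inv ≫ ((x ⊗ₘ y) ≫ m) ▷ M ≫ g := by
  rw [comp_whiskerRight_assoc, hg, MonoidalCategory.tensorHom_def', comp_whiskerRight_assoc]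
  calc
    _ = X ◁ y ▷ M ≫ (X ◁ g ≫ x ▷ M) ≫ g := by monoidal
    _ = _ := by rw [whisker_exchange]; monoidal

/-- Every action of `B ⊗ H` comes from actions of the two factors. -/
theorem smashAct_incl (hE : IsDistributive E) {M : C} {g : (B ⊗ H) ⊗ M ⟶ M}
    (hg : smashMul E ▷ M ≫ g = (α_ (B ⊗ H) (B ⊗ H) M).hom ≫ (B ⊗ H) ◁ g ≫ g) :
    smashAct (inclH H B ▷ M ≫ g) (inclB H B ▷ M ≫ g) = g := by
  rw [smashAct, act_act hg, inclB_inclH_smashMul hE]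
  simp

/-- The restrictions to `H` and `B` of an action of `B ⊗ H` satisfy the exchange relation. -/
theorem exchange_incl (hE : IsDistributive E) {M : C} {g : (B ⊗ H) ⊗ M ⟶ M}
    (hg : smashMul E ▷ M ≫ g = (α_ (B ⊗ H) (B ⊗ H) M).hom ≫ (B ⊗ H) ◁ g ≫ g) :
    H ◁ (inclB H B ▷ M ≫ g) ≫ inclH H B ▷ M ≫ g = (α_ H B M).inv ≫ E ▷ M ≫
      smashAct (inclH H B ▷ M ≫ g) (inclB H B ▷ M ≫ g) := by
  rw [act_act hg, inclH_inclB_smashMul, smashAct_incl hE hg]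

theorem inclH_mul_act (hE : IsDistributive E) {M : C} {g : (B ⊗ H) ⊗ M ⟶ M}
    (hg : smashMul E ▷ M ≫ g = (α_ (B ⊗ H) (B ⊗ H) M).hom ≫ (B ⊗ H) ◁ g ≫ g) :
    μ[H] ▷ M ≫ inclH H B ▷ M ≫ g =
      (α_ H H M).hom ≫ H ◁ (inclH H B ▷ M ≫ g) ≫ inclH H B ▷ M ≫ g := by
  rw [act_act hg, mul_inclH hE]
  simp

theorem inclB_mul_act (hE : IsDistributive E) {M : C} {g : (B ⊗ H) ⊗ M ⟶ M}
    (hg : smashMul E ▷ M ≫ g = (α_ (B ⊗ H) (B ⊗ H) M).hom ≫ (B ⊗ H) ◁ g ≫ g) :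
    μ[B] ▷ M ≫ inclB H B ▷ M ≫ g =
      (α_ B B M).hom ≫ B ◁ (inclB H B ▷ M ≫ g) ≫ inclB H B ▷ M ≫ g := by
  rw [act_act hg, mul_inclB hE]
  simp

variable (H B) in
theorem one_inclH : η[H] ≫ inclH H B = smashOne H B := by
  rw [inclH, smashOne, leftUnitor_inv_naturality_assoc, MonoidalCategory.tensorHom_def']

variable (H B) in
theorem one_inclB : η[B] ≫ inclB H B = smashOne H B := by
  rw [inclB, smashOne, rightUnitor_inv_naturality_assoc, MonoidalCategory.tensorHom_def,
    unitors_inv_equal]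

end

variable [BraidedCategory C]

section
variable {H B : C} [BimonObj H] [BimonObj B] {E : H ⊗ B ⟶ B ⊗ H}

/-- The multiplication of `B ⊗ H` is a composite of morphisms of comonoids. -/
theorem isComonHom_smashMul (hE : IsComonHom E) : IsComonHom (smashMul E) := by
  have : smashMul E = (α_ B H (B ⊗ H)).hom ≫ B ◁ (α_ H B H).inv ≫ B ◁ (E ▷ H) ≫
      B ◁ (α_ B H H).hom ≫ (α_ B B (H ⊗ H)).inv ≫ (μ[B] ⊗ₘ μ[H]) := by
    rw [smashMul]; monoidal
  rw [this]
  infer_instance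

/-- The bimonoid structure on `B ⊗ H` determined by a distributive law that is a morphism of
comonoids; the comonoid structure is that of a tensor product. -/
abbrev smashBimonObj (hE : IsDistributive E) (hE' : IsComonHom E) : BimonObj (B ⊗ H) where
  toMonObj := smashMonObj hE
  toComonObj := inferInstance
  mul_comul := by
    have := isComonHom_smashMul hE'
    have h := IsComonHom.hom_comul (smashMul E)
    rw [Comon.tensorObj_comul (B ⊗ H) (B ⊗ H), Category.assoc] at h
    exact h
  one_comul := by
    have := isComonHom_one_tensor B H
    change smashOne H B ≫ _ = (λ_ _).inv ≫ (smashOne H B ⊗ₘ smashOne H B)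
    rw [← one_inclH, Category.assoc]
    conv_lhs => rw [inclH, IsComonHom.hom_comul, reassoc_of% BimonObj.one_comul H]
    rw [MonObj.tensorObj.one_def, Category.assoc, tensorHom_comp_tensorHom]
    rfl
  mul_counit := by
    have := isComonHom_smashMul hE'
    exact IsComonHom.hom_counit (smashMul E)
  one_counit := by
    have := isComonHom_one_tensor B H
    change smashOne H B ≫ _ = _
    rw [← one_inclH, Category.assoc]
    conv_lhs => rw [inclH, IsComonHom.hom_counit, BimonObj.one_counit]

theorem SkewPairing.isDistributive (p : SkewPairing H B) (hH : IsTransparent H) :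
    IsDistributive p.exch where
  one_left := p.one_exch
  one_right := p.exch_one
  mul_left := p.mul_whiskerRight_exch hH
  mul_right := p.whiskerLeft_mul_exch hH

end

section Hopf

variable (H : C) [HopfObj H] [IsIso 𝒮[H]]

/-- `S⁻¹(h₂) h₁ = ε(h) 1`: apply the antipode, which reverses products. -/
theorem comul_antipode_inv_right (hH : IsTransparent H) :
    Δ[H] ≫ H ◁ inv 𝒮[H] ≫ (β_ H H).hom ≫ μ[H] = ε[H] ≫ η[H] := by
  rw [← cancel_mono 𝒮[H]]
  simp only [Category.assoc, HopfObj.mul_antipode, HopfObj.one_antipode]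
  rw [← BraidedCategory.braiding_naturality_assoc, reassoc_of% hH.hom_hom H,
    MonoidalCategory.tensorHom_def, Category.assoc, whisker_exchange_assoc]
  simp [← HopfObj.antipode_left]

/-- `h₂ S⁻¹(h₁) = ε(h) 1`. -/
theorem comul_antipode_inv_left (hH : IsTransparent H) :
    Δ[H] ≫ inv 𝒮[H] ▷ H ≫ (β_ H H).hom ≫ μ[H] = ε[H] ≫ η[H] := by
  rw [← cancel_mono 𝒮[H]]
  simp only [Category.assoc, HopfObj.mul_antipode, HopfObj.one_antipode]
  rw [← BraidedCategory.braiding_naturality_assoc, reassoc_of% hH.hom_hom H,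
    MonoidalCategory.tensorHom_def, Category.assoc]
  simp [← comp_whiskerRight_assoc]

variable [HasRightDual H]

omit [HopfObj H] [IsIso 𝒮[H]] in
theorem tensorμ_evBar (hH : IsTransparent H) :
    tensorμ H H Hᘁ Hᘁ ≫ (evBar H ⊗ₘ evBar H) ≫ (λ_ _).hom =
      (β_ (H ⊗ H) (Hᘁ ⊗ Hᘁ)).hom ≫ tensorPairing (ε_ H Hᘁ) (ε_ H Hᘁ) := by
  rw [tensorPairing, reassoc_of% braiding_tensorμ (hH.hom_hom _), tensorHom_comp_tensorHom_assoc]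
  rfl

omit [IsIso 𝒮[H]] in
theorem one_evBar : η[H] ▷ Hᘁ ≫ evBar H = (λ_ Hᘁ).hom ≫ dualCounit η[H] := by
  rw [evBar, BraidedCategory.braiding_naturality_left_assoc, dualCounit]
  simp

omit [IsIso 𝒮[H]] in
theorem evBar_dualOne : H ◁ dualOne ε[H] ≫ evBar H = (ρ_ H).hom ≫ ε[H] := by
  rw [evBar, BraidedCategory.braiding_naturality_right_assoc, dualOne, curry_ev]
  simp

omit [IsIso 𝒮[H]] in
/-- `⟨h h', f⟩ = ⟨h', f₁⟩⟨h, f₂⟩`. -/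
theorem mul_evBar (hH : IsTransparent H) :
    μ[H] ▷ Hᘁ ≫ evBar H = (H ⊗ H) ◁ comulB H ≫ (β_ H H).hom ▷ (Hᘁ ⊗ Hᘁ) ≫ tensorμ H H Hᘁ Hᘁ ≫
      (evBar H ⊗ₘ evBar H) ≫ (λ_ _).hom := by
  have h := isMate_dualComul H (opMul H)
  unfold IsMate at h
  rw [tensorμ_evBar H hH, BraidedCategory.braiding_naturality_left_assoc,
    BraidedCategory.braiding_naturality_right_assoc, evBar,
    BraidedCategory.braiding_naturality_left_assoc, ← whisker_exchange_assoc, comulB, h,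
    ← MonoidalCategory.whiskerLeft_comp_assoc, opMul, reassoc_of% hH.hom_hom H]

omit [IsIso 𝒮[H]] in
/-- `⟨h, f f'⟩ = ⟨h₁, f⟩⟨h₂, f'⟩`. -/
theorem evBar_dualMul (hH : IsTransparent H) :
    H ◁ dualMul Δ[H] ≫ evBar H = Δ[H] ▷ (Hᘁ ⊗ Hᘁ) ≫ tensorμ H H Hᘁ Hᘁ ≫
      (evBar H ⊗ₘ evBar H) ≫ (λ_ _).hom := by
  have h := isMate_dualMul H Δ[H]
  unfold IsMate at h
  rw [tensorμ_evBar H hH, BraidedCategory.braiding_naturality_left_assoc, evBar,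
    BraidedCategory.braiding_naturality_right_assoc, h]

omit [IsIso 𝒮[H]] in
/-- `⟨g₁(h₁), f₁⟩⟨g₂(h₂), f₂⟩` for a morphism `φ : h ↦ g₁(h₁) ⊗ g₂(h₂)`. -/
theorem comul_evBar (hH : IsTransparent H) (φ : H ⟶ H ⊗ H) :
    H ◁ comulB H ≫ φ ▷ (Hᘁ ⊗ Hᘁ) ≫ tensorμ H H Hᘁ Hᘁ ≫ (evBar H ⊗ₘ evBar H) ≫ (λ_ _).hom =
      (φ ≫ (β_ H H).hom ≫ μ[H]) ▷ Hᘁ ≫ evBar H := by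
  rw [comp_whiskerRight_assoc, comp_whiskerRight_assoc, mul_evBar H hH,
    ← whisker_exchange_assoc, ← comp_whiskerRight_assoc, hH.hom_hom, id_whiskerRight,
    Category.id_comp, whisker_exchange_assoc]

/-- The evaluation of a transparent Hopf algebra `H` with invertible antipode on `(H^op)*` is a
skew pairing; its convolution inverse is the evaluation at `S⁻¹`. -/
def dualPairing (hH : IsTransparent H) :
    letI := dualBimonObj H hH
    SkewPairing H Hᘁ :=
  letI := dualBimonObj H hH
  { τ := evBar H
    τ' := inv 𝒮[H] ▷ Hᘁ ≫ evBar H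
    conv_inv := by
      have h := conv_whiskerRight (evBar H) (𝟙 H) (inv 𝒮[H])
      rw [id_whiskerRight, Category.id_comp] at h
      rw [h, id_tensorHom]
      refine (comul_evBar H hH _).trans ?_
      rw [Category.assoc, comul_antipode_inv_right H hH, comp_whiskerRight_assoc, one_evBar]
      change _ = (ε[H] ⊗ₘ dualCounit η[H]) ≫ (λ_ (𝟙_ C)).hom
      rw [MonoidalCategory.tensorHom_def, Category.assoc, leftUnitor_naturality]
    inv_conv := by
      have h := conv_whiskerRight (evBar H) (inv 𝒮[H]) (𝟙 H)
      rw [id_whiskerRight, Category.id_comp] at h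
      rw [h, tensorHom_id]
      refine (comul_evBar H hH _).trans ?_
      rw [Category.assoc, comul_antipode_inv_left H hH, comp_whiskerRight_assoc, one_evBar]
      change _ = (ε[H] ⊗ₘ dualCounit η[H]) ≫ (λ_ (𝟙_ C)).hom
      rw [MonoidalCategory.tensorHom_def, Category.assoc, leftUnitor_naturality]
    mul_left := mul_evBar H hH
    mul_right := evBar_dualMul H hH
    one_left := one_evBar H
    one_right := evBar_dualOne H }

end Hopf
end

/-! ### The exchange morphism of the double -/

section
variable {C : Type u} [Category.{v} C] [MonoidalCategory C] [BraidedCategory C]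

/-- The first component of `p ⊗ q ↦ p₁ ⊗ q₁ u(p₂, q₂)`. -/
theorem convR_fst {P Q : C} [ComonObj P] [ComonObj Q] (u : P ⊗ Q ⟶ 𝟙_ C) :
    convR u ≫ P ◁ ε[Q] ≫ (ρ_ P).hom = Δ[P] ▷ Q ≫ (α_ P P Q).hom ≫ P ◁ u ≫ (ρ_ P).hom := by
  calc
    _ = 𝟙 _ ⊗≫ P ◁ Δ[Q] ⊗≫ Δ[P] ▷ (Q ⊗ Q) ⊗≫ P ◁ (β_ P Q).hom ▷ Q ⊗≫
          ((P ⊗ Q) ◁ u ≫ (P ◁ ε[Q]) ▷ 𝟙_ C) ⊗≫ 𝟙 _ := by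
      rw [convR, Comon.tensorObj_comul, tensorμ, MonoidalCategory.tensorHom_def']; monoidal
    _ = 𝟙 _ ⊗≫ P ◁ Δ[Q] ⊗≫ Δ[P] ▷ (Q ⊗ Q) ⊗≫ P ◁ ((β_ P Q).hom ≫ ε[Q] ▷ P) ▷ Q ⊗≫
          P ◁ u ⊗≫ 𝟙 _ := by
      rw [whisker_exchange]; monoidal
    _ = 𝟙 _ ⊗≫ P ◁ Δ[Q] ⊗≫ (Δ[P] ▷ (Q ⊗ Q) ≫ (P ⊗ P) ◁ ε[Q] ▷ Q) ⊗≫ P ◁ u ⊗≫ 𝟙 _ := by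
      rw [← BraidedCategory.braiding_naturality_right, braiding_tensorUnit_right]; monoidal
    _ = 𝟙 _ ⊗≫ P ◁ (Δ[Q] ≫ ε[Q] ▷ Q) ⊗≫ Δ[P] ▷ Q ⊗≫ P ◁ u ⊗≫ 𝟙 _ := by
      rw [← whisker_exchange]; monoidal
    _ = _ := by rw [ComonObj.counit_comul]; monoidal

/-- The second component of `p ⊗ q ↦ p₁ ⊗ q₁ u(p₂, q₂)`. -/
theorem convR_snd {P Q : C} [ComonObj P] [ComonObj Q] (u : P ⊗ Q ⟶ 𝟙_ C) :
    convR u ≫ ε[P] ▷ Q ≫ (λ_ Q).hom = P ◁ Δ[Q] ≫ (α_ P Q Q).inv ≫ (β_ P Q).hom ▷ Q ≫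
      (α_ Q P Q).hom ≫ Q ◁ u ≫ (ρ_ Q).hom := by
  calc
    _ = 𝟙 _ ⊗≫ P ◁ Δ[Q] ⊗≫ Δ[P] ▷ (Q ⊗ Q) ⊗≫ P ◁ (β_ P Q).hom ▷ Q ⊗≫
          ((P ⊗ Q) ◁ u ≫ (ε[P] ▷ Q) ▷ 𝟙_ C) ⊗≫ 𝟙 _ := by
      rw [convR, Comon.tensorObj_comul, tensorμ, MonoidalCategory.tensorHom_def']; monoidal
    _ = 𝟙 _ ⊗≫ P ◁ Δ[Q] ⊗≫ Δ[P] ▷ (Q ⊗ Q) ⊗≫ (P ◁ (β_ P Q).hom ≫ ε[P] ▷ (Q ⊗ P)) ▷ Q ⊗≫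
          Q ◁ u ⊗≫ 𝟙 _ := by
      rw [whisker_exchange]; monoidal
    _ = 𝟙 _ ⊗≫ P ◁ Δ[Q] ⊗≫ (Δ[P] ≫ ε[P] ▷ P) ▷ (Q ⊗ Q) ⊗≫ (β_ P Q).hom ▷ Q ⊗≫
          Q ◁ u ⊗≫ 𝟙 _ := by
      rw [whisker_exchange]; monoidal
    _ = _ := by rw [ComonObj.counit_comul]; monoidal

variable (H : C) [HopfObj H] [IsIso 𝒮[H]] [HasRightDual H] (hH : IsTransparent H)

include hH in
/-- The action of `B` on `H` is the `H`-component `τ(h₁, f₁) h₂ τ⁻¹(h₃, f₂)` of the exchange: the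
multiplicativity of `τ` combines the two values into `f(S⁻¹(h₃) h₁)`. -/
theorem rightAction_eq : letI := dualBimonObj H hH
    rightAction H = (dualPairing H hH).exch ≫ ε[Hᘁ] ▷ H ≫ (λ_ H).hom := by
  let _ := dualBimonObj H hH
  have e1 : (dualPairing H hH).exch ≫ ε[Hᘁ] ▷ H ≫ (λ_ H).hom =
      convL (evBar H) ≫ Δ[H] ▷ Hᘁ ≫ (α_ H H Hᘁ).hom ≫ H ◁ inv 𝒮[H] ▷ Hᘁ ≫ H ◁ evBar H ≫
        (ρ_ H).hom := by
    rw [SkewPairing.exch, Category.assoc, ← BraidedCategory.braiding_naturality_right_assoc, twist,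
      Category.assoc, braiding_tensorUnit_right]
    have := convR_fst (P := H) (Q := Hᘁ) (inv 𝒮[H] ▷ Hᘁ ≫ evBar H)
    rw [MonoidalCategory.whiskerLeft_comp_assoc] at this
    rw [← this]
    simp; rfl
  have e2 : (β_ H H).hom ▷ Hᘁ ≫ μ[H] ▷ Hᘁ ≫ evBar H = (H ⊗ H) ◁ Δ[Hᘁ] ≫
      tensorμ H H Hᘁ Hᘁ ≫ (evBar H ⊗ₘ evBar H) ≫ (λ_ _).hom := by
    rw [mul_evBar H hH, ← whisker_exchange_assoc, ← comp_whiskerRight_assoc, hH.hom_hom,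
      id_whiskerRight, Category.id_comp]
    rfl
  have e3 : H ◁ evBar H ≫ (ρ_ H).hom = (β_ H (H ⊗ Hᘁ)).hom ≫ evBar H ▷ H ≫ (λ_ H).hom := by
    rw [← BraidedCategory.braiding_naturality_right_assoc, braiding_tensorUnit_right]; simp
  rw [e1, rightAction]
  symm
  calc
    _ = 𝟙 _ ⊗≫ H ◁ Δ[Hᘁ] ⊗≫ Δ[H] ▷ (Hᘁ ⊗ Hᘁ) ⊗≫ H ◁ (β_ H Hᘁ).hom ▷ Hᘁ ⊗≫
          (evBar H ▷ (H ⊗ Hᘁ) ≫ 𝟙_ C ◁ Δ[H] ▷ Hᘁ) ⊗≫ H ◁ inv 𝒮[H] ▷ Hᘁ ⊗≫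
          H ◁ evBar H ⊗≫ 𝟙 _ := by
      rw [convL, Comon.tensorObj_comul, tensorμ, MonoidalCategory.tensorHom_def']; monoidal
    _ = 𝟙 _ ⊗≫ H ◁ Δ[Hᘁ] ⊗≫ Δ[H] ▷ (Hᘁ ⊗ Hᘁ) ⊗≫
          H ◁ ((β_ H Hᘁ).hom ≫ Hᘁ ◁ Δ[H]) ▷ Hᘁ ⊗≫
          (evBar H ▷ ((H ⊗ H) ⊗ Hᘁ) ≫ 𝟙_ C ◁ (H ◁ inv 𝒮[H]) ▷ Hᘁ) ⊗≫ H ◁ evBar H ⊗≫ 𝟙 _ := by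
      rw [← whisker_exchange]; monoidal
    _ = 𝟙 _ ⊗≫ H ◁ Δ[Hᘁ] ⊗≫ (Δ[H] ≫ H ◁ Δ[H]) ▷ (Hᘁ ⊗ Hᘁ) ⊗≫
          H ◁ ((β_ (H ⊗ H) Hᘁ).hom ≫ Hᘁ ◁ (H ◁ inv 𝒮[H])) ▷ Hᘁ ⊗≫
          evBar H ▷ (H ⊗ H ⊗ Hᘁ) ⊗≫ H ◁ evBar H ⊗≫ 𝟙 _ := by
      rw [← whisker_exchange, ← BraidedCategory.braiding_naturality_left]; monoidal
    _ = 𝟙 _ ⊗≫ H ◁ Δ[Hᘁ] ⊗≫ (Δ[H] ≫ Δ[H] ▷ H) ▷ (Hᘁ ⊗ Hᘁ) ⊗≫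
          (H ⊗ H) ◁ inv 𝒮[H] ▷ (Hᘁ ⊗ Hᘁ) ⊗≫ H ◁ H ◁ (β_ H Hᘁ).hom ▷ Hᘁ ⊗≫
          H ◁ (β_ H Hᘁ).hom ▷ (H ⊗ Hᘁ) ⊗≫
          (evBar H ▷ (H ⊗ H ⊗ Hᘁ) ≫ 𝟙_ C ◁ (H ◁ evBar H)) ⊗≫ 𝟙 _ := by
      rw [← BraidedCategory.braiding_naturality_left, BraidedCategory.braiding_tensor_left_hom,
        ComonObj.comul_assoc]; monoidal
    _ = 𝟙 _ ⊗≫ H ◁ Δ[Hᘁ] ⊗≫ (Δ[H] ≫ Δ[H] ▷ H) ▷ (Hᘁ ⊗ Hᘁ) ⊗≫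
          (H ⊗ H) ◁ inv 𝒮[H] ▷ (Hᘁ ⊗ Hᘁ) ⊗≫ H ◁ H ◁ (β_ H Hᘁ).hom ▷ Hᘁ ⊗≫
          (H ◁ (β_ H Hᘁ).hom ▷ (H ⊗ Hᘁ) ⊗≫ (H ⊗ Hᘁ ⊗ H) ◁ evBar H) ⊗≫
            evBar H ▷ H ⊗≫ 𝟙 _ := by
      rw [← whisker_exchange]; monoidal
    _ = 𝟙 _ ⊗≫ H ◁ Δ[Hᘁ] ⊗≫ (Δ[H] ≫ Δ[H] ▷ H) ▷ (Hᘁ ⊗ Hᘁ) ⊗≫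
          (((β_ H H).inv ≫ (β_ H H).hom) ⊗ₘ inv 𝒮[H]) ▷ (Hᘁ ⊗ Hᘁ) ⊗≫
          H ◁ H ◁ (β_ H Hᘁ).hom ▷ Hᘁ ⊗≫
          H ◁ (β_ H Hᘁ).hom ▷ (H ⊗ Hᘁ) ⊗≫ (H ⊗ Hᘁ ⊗ H) ◁ evBar H ⊗≫
            evBar H ▷ H ⊗≫ 𝟙 _ := by
      rw [Iso.inv_hom_id, id_tensorHom]; monoidal
    _ = 𝟙 _ ⊗≫ (Δ[H] ≫ Δ[H] ▷ H) ▷ Hᘁ ⊗≫ ((β_ H H).inv ⊗ₘ inv 𝒮[H]) ▷ Hᘁ ⊗≫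
          H ◁ ((H ⊗ H) ◁ Δ[Hᘁ] ≫ tensorμ H H Hᘁ Hᘁ ≫ (evBar H ⊗ₘ evBar H) ≫ (λ_ _).hom) ⊗≫
          𝟙 _ := by
      symm
      calc
        _ = 𝟙 _ ⊗≫ (((Δ[H] ≫ Δ[H] ▷ H) ≫ ((β_ H H).inv ⊗ₘ inv 𝒮[H])) ▷ Hᘁ ≫
              ((H ⊗ H) ⊗ H) ◁ Δ[Hᘁ]) ⊗≫
              H ◁ H ◁ (β_ H Hᘁ).hom ▷ Hᘁ ⊗≫ (H ⊗ H ⊗ Hᘁ) ◁ evBar H ⊗≫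
              (H ◁ evBar H ≫ (ρ_ H).hom) ⊗≫ 𝟙 _ := by
          rw [tensorμ, MonoidalCategory.tensorHom_def' (evBar H)]; monoidal
        _ = 𝟙 _ ⊗≫ H ◁ Δ[Hᘁ] ⊗≫ (Δ[H] ≫ Δ[H] ▷ H) ▷ (Hᘁ ⊗ Hᘁ) ⊗≫
              ((β_ H H).inv ⊗ₘ inv 𝒮[H]) ▷ (Hᘁ ⊗ Hᘁ) ⊗≫
              ((H ⊗ H) ◁ ((β_ H Hᘁ).hom ▷ Hᘁ ⊗≫ Hᘁ ◁ evBar H) ≫ (β_ H H).hom ▷ (Hᘁ ⊗ 𝟙_ C)) ⊗≫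
              H ◁ (β_ H Hᘁ).hom ⊗≫ evBar H ▷ H ⊗≫ 𝟙 _ := by
          rw [e3, BraidedCategory.braiding_tensor_right_hom, ← whisker_exchange]; monoidal
        _ = 𝟙 _ ⊗≫ H ◁ Δ[Hᘁ] ⊗≫ (Δ[H] ≫ Δ[H] ▷ H) ▷ (Hᘁ ⊗ Hᘁ) ⊗≫
              ((β_ H H).inv ⊗ₘ inv 𝒮[H]) ▷ (Hᘁ ⊗ Hᘁ) ⊗≫ (β_ H H).hom ▷ (H ⊗ Hᘁ ⊗ Hᘁ) ⊗≫
              H ◁ H ◁ (β_ H Hᘁ).hom ▷ Hᘁ ⊗≫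
              ((H ⊗ H ⊗ Hᘁ) ◁ evBar H ≫ (H ◁ (β_ H Hᘁ).hom) ▷ 𝟙_ C) ⊗≫
              evBar H ▷ H ⊗≫ 𝟙 _ := by
          rw [whisker_exchange]; monoidal
        _ = _ := by
          rw [whisker_exchange, MonoidalCategory.tensorHom_def ((β_ H H).inv),
            MonoidalCategory.tensorHom_def' ((β_ H H).inv ≫ (β_ H H).hom),
            ← MonoidalCategory.tensorHom_def, MonoidalCategory.tensorHom_def']; monoidal
    _ = _ := by rw [← e2]; monoidal

omit [IsIso 𝒮[H]] in
include hH in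
/-- A nested form of `mul_evBar`. -/
theorem mul_evBar_nested : μ[H] ▷ Hᘁ ≫ evBar H =
    𝟙 _ ⊗≫ (H ⊗ H) ◁ comulB H ⊗≫ H ◁ evBar H ▷ Hᘁ ⊗≫ evBar H := by
  have e3 : H ◁ evBar H ≫ (ρ_ H).hom = (β_ H (H ⊗ Hᘁ)).hom ≫ evBar H ▷ H ≫ (λ_ H).hom := by
    rw [← BraidedCategory.braiding_naturality_right_assoc, braiding_tensorUnit_right]; simp
  rw [mul_evBar H hH]
  calc
    _ = 𝟙 _ ⊗≫ (H ⊗ H) ◁ comulB H ⊗≫ (β_ H H).hom ▷ (Hᘁ ⊗ Hᘁ) ⊗≫ H ◁ (β_ H Hᘁ).hom ▷ Hᘁ ⊗≫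
          evBar H ▷ (H ⊗ Hᘁ) ⊗≫ evBar H := by
      rw [tensorμ, MonoidalCategory.tensorHom_def]; monoidal
    _ = 𝟙 _ ⊗≫ (H ⊗ H) ◁ comulB H ⊗≫
          ((β_ H (H ⊗ Hᘁ)).hom ≫ evBar H ▷ H ≫ (λ_ H).hom) ▷ Hᘁ ⊗≫ evBar H := by
      rw [BraidedCategory.braiding_tensor_right_hom]; monoidal
    _ = _ := by rw [← e3]; monoidal

omit [HopfObj H] [IsIso 𝒮[H]] in
/-- Morphisms into the dual are determined by their values. -/
theorem evBar_ext {T : C} {f g : T ⟶ Hᘁ} (h : H ◁ f ≫ evBar H = H ◁ g ≫ evBar H) : f = g := by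
  simp only [evBar, BraidedCategory.braiding_naturality_right_assoc] at h
  exact (rightDual_nondegenerate H).eq ((cancel_epi _).1 h)

include hH in
/-- The action of `H` on `B` is the `B`-component `τ(h₁, f₁) f₂ τ⁻¹(h₂, f₃)` of the exchange, as one
sees by evaluating both sides. -/
theorem leftAction_eq : letI := dualBimonObj H hH
    leftAction H = (dualPairing H hH).exch ≫ Hᘁ ◁ ε[H] ≫ (ρ_ Hᘁ).hom := by
  let _ := dualBimonObj H hH
  have e1 : (dualPairing H hH).exch ≫ Hᘁ ◁ ε[H] ≫ (ρ_ Hᘁ).hom =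
      convL (evBar H) ≫ H ◁ Δ[Hᘁ] ≫ (α_ H Hᘁ Hᘁ).inv ≫ (β_ H Hᘁ).hom ▷ Hᘁ ≫
      (α_ Hᘁ H Hᘁ).hom ≫ Hᘁ ◁ (inv 𝒮[H] ▷ Hᘁ ≫ evBar H) ≫ (ρ_ Hᘁ).hom := by
    rw [SkewPairing.exch, Category.assoc, ← BraidedCategory.braiding_naturality_left_assoc, twist,
      Category.assoc, braiding_tensorUnit_left, ← convR_snd]
    simp; rfl
  have e2 : (β_ H H).hom ▷ Hᘁ ≫ μ[H] ▷ Hᘁ ≫ evBar H = (H ⊗ H) ◁ Δ[Hᘁ] ≫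
      tensorμ H H Hᘁ Hᘁ ≫ (evBar H ⊗ₘ evBar H) ≫ (λ_ _).hom := by
    rw [mul_evBar H hH, ← whisker_exchange_assoc, ← comp_whiskerRight_assoc, hH.hom_hom,
      id_whiskerRight, Category.id_comp]
    rfl
  have e4 : μ[H] ▷ Hᘁ ≫ evBar H =
      𝟙 _ ⊗≫ (H ⊗ H) ◁ Δ[Hᘁ] ⊗≫ H ◁ evBar H ▷ Hᘁ ⊗≫ evBar H := mul_evBar_nested H hH
  apply evBar_ext
  rw [leftAction, curryBar_evBar, e1, e2]
  calc
    _ = 𝟙 _ ⊗≫ H ◁ Δ[H] ▷ Hᘁ ⊗≫ ((μ[H] ⊗ₘ inv 𝒮[H]) ▷ Hᘁ ≫ (H ⊗ H) ◁ Δ[Hᘁ]) ⊗≫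
          H ◁ (β_ H Hᘁ).hom ▷ Hᘁ ⊗≫ ((H ⊗ Hᘁ) ◁ evBar H ≫ evBar H ▷ 𝟙_ C) ⊗≫ 𝟙 _ := by
      rw [tensorμ, MonoidalCategory.tensorHom_def' (evBar H)]; monoidal
    _ = 𝟙 _ ⊗≫ H ◁ Δ[H] ▷ Hᘁ ⊗≫ (H ⊗ H ⊗ H) ◁ Δ[Hᘁ] ⊗≫ (μ[H] ⊗ₘ inv 𝒮[H]) ▷ (Hᘁ ⊗ Hᘁ) ⊗≫
          H ◁ (β_ H Hᘁ).hom ▷ Hᘁ ⊗≫ ((H ⊗ Hᘁ) ◁ evBar H ≫ evBar H ▷ 𝟙_ C) ⊗≫ 𝟙 _ := by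
      rw [← whisker_exchange]; monoidal
    _ = 𝟙 _ ⊗≫ H ◁ Δ[H] ▷ Hᘁ ⊗≫ (H ⊗ H ⊗ H) ◁ Δ[Hᘁ] ⊗≫ μ[H] ▷ (H ⊗ Hᘁ ⊗ Hᘁ) ⊗≫
          H ◁ (inv 𝒮[H] ▷ Hᘁ ≫ (β_ H Hᘁ).hom) ▷ Hᘁ ⊗≫
          ((H ⊗ Hᘁ) ◁ evBar H ≫ evBar H ▷ 𝟙_ C) ⊗≫ 𝟙 _ := by
      rw [MonoidalCategory.tensorHom_def]; monoidal
    _ = 𝟙 _ ⊗≫ H ◁ Δ[H] ▷ Hᘁ ⊗≫ (H ⊗ H ⊗ H) ◁ Δ[Hᘁ] ⊗≫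
          (μ[H] ▷ ((H ⊗ Hᘁ) ⊗ Hᘁ) ≫ H ◁ ((β_ H Hᘁ).hom ▷ Hᘁ ≫ (α_ Hᘁ H Hᘁ).hom ≫
            Hᘁ ◁ (inv 𝒮[H] ▷ Hᘁ ≫ evBar H))) ⊗≫ evBar H ⊗≫ 𝟙 _ := by
      rw [BraidedCategory.braiding_naturality_left]; monoidal
    _ = 𝟙 _ ⊗≫ H ◁ Δ[H] ▷ Hᘁ ⊗≫ (H ⊗ H ⊗ H) ◁ Δ[Hᘁ] ⊗≫
          H ◁ H ◁ (β_ H Hᘁ).hom ▷ Hᘁ ⊗≫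
            (H ⊗ H ⊗ Hᘁ) ◁ (inv 𝒮[H] ▷ Hᘁ ≫ evBar H) ⊗≫ (μ[H] ▷ Hᘁ ≫ evBar H) ⊗≫ 𝟙 _ := by
      rw [← whisker_exchange]; monoidal
    _ = 𝟙 _ ⊗≫ H ◁ Δ[H] ▷ Hᘁ ⊗≫ (H ⊗ H ⊗ H) ◁ Δ[Hᘁ] ⊗≫
          H ◁ H ◁ (β_ H Hᘁ).hom ▷ Hᘁ ⊗≫
            ((H ⊗ H ⊗ Hᘁ) ◁ (inv 𝒮[H] ▷ Hᘁ ≫ evBar H) ≫ (H ◁ H ◁ Δ[Hᘁ]) ▷ 𝟙_ C) ⊗≫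
            H ◁ evBar H ▷ Hᘁ ⊗≫ evBar H ⊗≫ 𝟙 _ := by
      rw [e4]; monoidal
    _ = 𝟙 _ ⊗≫ H ◁ Δ[H] ▷ Hᘁ ⊗≫ (H ⊗ H ⊗ H) ◁ Δ[Hᘁ] ⊗≫
          H ◁ H ◁ ((β_ H Hᘁ).hom ≫ Δ[Hᘁ] ▷ H) ▷ Hᘁ ⊗≫
            (H ⊗ H ⊗ Hᘁ ⊗ Hᘁ) ◁ (inv 𝒮[H] ▷ Hᘁ ≫ evBar H) ⊗≫
            H ◁ evBar H ▷ Hᘁ ⊗≫ evBar H ⊗≫ 𝟙 _ := by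
      rw [whisker_exchange]; monoidal
    _ = 𝟙 _ ⊗≫ H ◁ (Δ[H] ▷ Hᘁ ≫ (H ⊗ H) ◁ (Δ[Hᘁ] ≫ Δ[Hᘁ] ▷ Hᘁ ≫ (α_ Hᘁ Hᘁ Hᘁ).hom)) ⊗≫
          H ◁ H ◁ (β_ H (Hᘁ ⊗ Hᘁ)).hom ▷ Hᘁ ⊗≫
            (H ⊗ H ⊗ Hᘁ ⊗ Hᘁ) ◁ (inv 𝒮[H] ▷ Hᘁ ≫ evBar H) ⊗≫
            H ◁ evBar H ▷ Hᘁ ⊗≫ evBar H ⊗≫ 𝟙 _ := by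
      rw [← BraidedCategory.braiding_naturality_right]; monoidal
    _ = 𝟙 _ ⊗≫ H ◁ H ◁ Δ[Hᘁ] ⊗≫ H ◁ (Δ[H] ▷ (Hᘁ ⊗ Hᘁ) ≫ (H ⊗ H) ◁ Hᘁ ◁ Δ[Hᘁ]) ⊗≫
          H ◁ H ◁ (β_ H Hᘁ).hom ▷ (Hᘁ ⊗ Hᘁ) ⊗≫ (H ⊗ H ⊗ Hᘁ) ◁ (β_ H Hᘁ).hom ▷ Hᘁ ⊗≫
            H ◁ ((H ⊗ Hᘁ) ◁ Hᘁ ◁ (inv 𝒮[H] ▷ Hᘁ ≫ evBar H) ≫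
            evBar H ▷ (Hᘁ ⊗ 𝟙_ C)) ⊗≫ evBar H ⊗≫ 𝟙 _ := by
      rw [← ComonObj.comul_assoc, BraidedCategory.braiding_tensor_right_hom,
        ← whisker_exchange, ← whisker_exchange]; monoidal
    _ = 𝟙 _ ⊗≫ H ◁ H ◁ Δ[Hᘁ] ⊗≫ H ◁ Δ[H] ▷ (Hᘁ ⊗ Hᘁ) ⊗≫ (H ⊗ H ⊗ H ⊗ Hᘁ) ◁ Δ[Hᘁ] ⊗≫
          H ◁ H ◁ (β_ H Hᘁ).hom ▷ (Hᘁ ⊗ Hᘁ) ⊗≫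
            H ◁ ((H ⊗ Hᘁ) ◁ (β_ H Hᘁ).hom ▷ Hᘁ ≫ evBar H ▷ ((Hᘁ ⊗ H) ⊗ Hᘁ)) ⊗≫
            H ◁ Hᘁ ◁ (inv 𝒮[H] ▷ Hᘁ ≫ evBar H) ⊗≫ evBar H ⊗≫ 𝟙 _ := by
      rw [whisker_exchange]; monoidal
    _ = 𝟙 _ ⊗≫ H ◁ H ◁ Δ[Hᘁ] ⊗≫ H ◁ Δ[H] ▷ (Hᘁ ⊗ Hᘁ) ⊗≫
          H ◁ H ◁ ((H ⊗ Hᘁ) ◁ Δ[Hᘁ] ≫ (β_ H Hᘁ).hom ▷ (Hᘁ ⊗ Hᘁ)) ⊗≫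
            H ◁ evBar H ▷ (H ⊗ Hᘁ ⊗ Hᘁ) ⊗≫ H ◁ (β_ H Hᘁ).hom ▷ Hᘁ ⊗≫
            H ◁ Hᘁ ◁ (inv 𝒮[H] ▷ Hᘁ ≫ evBar H) ⊗≫ evBar H ⊗≫ 𝟙 _ := by
      rw [whisker_exchange]; monoidal
    _ = 𝟙 _ ⊗≫ H ◁ H ◁ Δ[Hᘁ] ⊗≫ H ◁ Δ[H] ▷ (Hᘁ ⊗ Hᘁ) ⊗≫
          H ◁ H ◁ (β_ H Hᘁ).hom ▷ Hᘁ ⊗≫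
            H ◁ ((H ⊗ Hᘁ) ◁ (H ◁ Δ[Hᘁ]) ≫ evBar H ▷ (H ⊗ Hᘁ ⊗ Hᘁ)) ⊗≫
            H ◁ (β_ H Hᘁ).hom ▷ Hᘁ ⊗≫
            H ◁ Hᘁ ◁ (inv 𝒮[H] ▷ Hᘁ ≫ evBar H) ⊗≫ evBar H ⊗≫ 𝟙 _ := by
      rw [whisker_exchange]; monoidal
    _ = _ := by
      rw [whisker_exchange, convL, Comon.tensorObj_comul, tensorμ, MonoidalCategory.tensorHom_def']
      monoidal

include hH in
/-- The exchange of the double is the one defined by the skew pairing of `H` and `(H^op)*`: a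
morphism of comonoids into a tensor product is determined by its two components. -/
theorem exchange_eq : letI := dualBimonObj H hH
    exchange H = (dualPairing H hH).exch := by
  let _ := dualBimonObj H hH
  have := (dualPairing H hH).isComonHom_exch hH
  have h := comul_proj (P := Hᘁ) (Q := H)
  rw [exchange, leftAction_eq H hH, rightAction_eq H hH, ← tensorHom_comp_tensorHom]
  have h2 := IsComonHom.hom_comul (dualPairing H hH).exch
  rw [Comon.tensorObj_comul H Hᘁ, Category.assoc] at h2
  calc
    _ = (dualPairing H hH).exch ≫ Δ[Hᘁ ⊗ H] ≫
          ((Hᘁ ◁ ε[H] ≫ (ρ_ Hᘁ).hom) ⊗ₘ (ε[Hᘁ] ▷ H ≫ (λ_ H).hom)) := by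
      rw [reassoc_of% h2]; rfl
    _ = _ := by rw [h, Category.comp_id]

end

/-! ### Contraction with the dual basis -/

section
variable {C : Type u} [Category.{v} C] [MonoidalCategory C]

section
variable {H B : C} [ExactPairing H B]

variable (B) in
/-- The morphism `f ⊗ t ↦ f(x) m` for `p : t ↦ x ⊗ m`. -/
def contract {T M : C} (p : T ⟶ H ⊗ M) : B ⊗ T ⟶ M :=
  B ◁ p ≫ (α_ B H M).inv ≫ ε_ H B ▷ M ≫ (λ_ M).hom

variable (H) in
/-- The morphism inserting the dual basis, inverse to `contract`. -/
def uncontract {T M : C} (b : B ⊗ T ⟶ M) : T ⟶ H ⊗ M :=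
  (λ_ T).inv ≫ η_ H B ▷ T ≫ (α_ H B T).hom ≫ H ◁ b

theorem contract_uncontract {T M : C} (b : B ⊗ T ⟶ M) : contract B (uncontract H b) = b :=
  (tensorLeftHomEquiv T H B M).symm_apply_apply b

theorem uncontract_contract {T M : C} (p : T ⟶ H ⊗ M) : uncontract H (contract B p) = p :=
  (tensorLeftHomEquiv T H B M).apply_symm_apply p

theorem uncontract_eq {T M : C} {p : T ⟶ H ⊗ M} {b : B ⊗ T ⟶ M} (h : contract B p = b) :
    uncontract H b = p := by
  rw [← h, uncontract_contract]

theorem contract_injective {T M : C} {p q : T ⟶ H ⊗ M} (h : contract B p = contract B q) :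
    p = q := by
  rw [← uncontract_contract (B := B) p, h, uncontract_contract]

theorem contract_comp {T M N : C} (p : T ⟶ H ⊗ M) (g : M ⟶ N) :
    contract B (p ≫ H ◁ g) = contract B p ≫ g := by
  simp only [contract, MonoidalCategory.whiskerLeft_comp, Category.assoc,
    associator_inv_naturality_right_assoc, whisker_exchange_assoc, leftUnitor_naturality]

theorem comp_contract {T T' M : C} (t : T ⟶ T') (p : T' ⟶ H ⊗ M) :
    contract B (t ≫ p) = B ◁ t ≫ contract B p := by
  simp [contract]

end

variable [BraidedCategory C] {H B : C} [ExactPairing H B]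

section
variable [ComonObj H] [MonObj B]

omit [BraidedCategory C] in
theorem one_contract (h : η[B] ▷ H ≫ ε_ H B = (λ_ H).hom ≫ ε[H]) {T M : C} (p : T ⟶ H ⊗ M) :
    η[B] ▷ T ≫ contract B p = (λ_ T).hom ≫ p ≫ ε[H] ▷ M ≫ (λ_ M).hom := by
  calc
    _ = 𝟙 _ ⊗≫ (η[B] ▷ T ≫ B ◁ p) ⊗≫ ε_ H B ▷ M ⊗≫ 𝟙 _ := by rw [contract]; monoidal
    _ = 𝟙 _ ⊗≫ p ⊗≫ (η[B] ▷ H ≫ ε_ H B) ▷ M ⊗≫ 𝟙 _ := by rw [← whisker_exchange]; monoidal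
    _ = _ := by rw [h]; monoidal

/-- Acting with a product is acting twice, on the coaction followed by the comultiplication. The
braiding appears because the inner contraction, that with the second factor of the product, is with
the first tensor factor. -/
theorem mul_contract (hH : IsTransparent H)
    (h : IsMate (tensorPairing (ε_ H B) (ε_ H B)) (ε_ H B) μ[B] Δ[H]) {T M : C} (p : T ⟶ H ⊗ M) :
    μ[B] ▷ T ≫ contract B p = (α_ B B T).hom ≫
      contract B (contract B (p ≫ (Δ[H] ≫ (β_ H H).hom) ▷ M ≫ (α_ H H M).hom)) := by
  unfold IsMate at h
  rw [tensorPairing_eq_nested, ← hH H] at h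
  calc
    _ = 𝟙 _ ⊗≫ (μ[B] ▷ T ≫ B ◁ p) ⊗≫ ε_ H B ▷ M ⊗≫ 𝟙 _ := by rw [contract]; monoidal
    _ = 𝟙 _ ⊗≫ (B ⊗ B) ◁ p ⊗≫ (μ[B] ▷ H ≫ ε_ H B) ▷ M ⊗≫ 𝟙 _ := by
      rw [← whisker_exchange]; monoidal
    _ = _ := by rw [h, contract, contract]; monoidal

end

/-- A coaction is counital if and only if the corresponding action is unital. -/
theorem coact_counit_iff [ComonObj H] [MonObj B]
    (h : η[B] ▷ H ≫ ε_ H B = (λ_ H).hom ≫ ε[H]) {M : C} (r : M ⟶ H ⊗ M) :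
    (r ≫ (β_ H M).hom) ≫ M ◁ ε[H] = (ρ_ M).inv ↔
      η[B] ▷ M ≫ contract B r = (λ_ M).hom := by
  rw [one_contract h, Category.assoc, ← BraidedCategory.braiding_naturality_left,
    braiding_tensorUnit_left]
  constructor
  · intro h
    have := h =≫ (ρ_ M).hom
    simp only [Category.assoc, Iso.inv_hom_id, Category.comp_id] at this
    rw [this, Category.comp_id]
  · intro h
    have : r ≫ ε[H] ▷ M ≫ (λ_ M).hom = 𝟙 M := by
      rw [← cancel_epi (λ_ M).hom, h, Category.comp_id]
    rw [reassoc_of% this]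

/-- A coaction is coassociative if and only if the corresponding action is associative. -/
theorem coact_comul_iff [ComonObj H] [MonObj B] (hH : IsTransparent H)
    (h : IsMate (tensorPairing (ε_ H B) (ε_ H B)) (ε_ H B) μ[B] Δ[H]) {M : C} (r : M ⟶ H ⊗ M) :
    (r ≫ (β_ H M).hom) ≫ M ◁ Δ[H] =
        (r ≫ (β_ H M).hom) ≫ (r ≫ (β_ H M).hom) ▷ H ≫ (α_ M H H).hom ↔
      μ[B] ▷ M ≫ contract B r = (α_ B B M).hom ≫ B ◁ contract B r ≫ contract B r := by
  have h1 : (r ≫ (β_ H M).hom) ≫ M ◁ Δ[H] = r ≫ Δ[H] ▷ M ≫ (β_ (H ⊗ H) M).hom := by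
    rw [BraidedCategory.braiding_naturality_left, Category.assoc]
  have h2 : (r ≫ (β_ H M).hom) ≫ (r ≫ (β_ H M).hom) ▷ H ≫ (α_ M H H).hom =
      r ≫ H ◁ r ≫ (α_ H H M).inv ≫ (β_ H H).hom ▷ M ≫ (β_ (H ⊗ H) M).hom := by
    rw [Category.assoc, ← BraidedCategory.braiding_naturality_right_assoc,
      BraidedCategory.braiding_naturality_left, BraidedCategory.braiding_tensor_right_hom,
      BraidedCategory.braiding_tensor_left_hom]
    simp
  have h3 : B ◁ contract B r ≫ contract B r = contract B (contract B (r ≫ H ◁ r)) := by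
    rw [contract_comp, comp_contract]
  rw [h1, h2, mul_contract hH h, h3, cancel_epi (α_ B B M).hom]
  constructor
  · intro h
    rw [comp_whiskerRight_assoc]
    simp only [← Category.assoc] at h
    rw [cancel_mono] at h
    simp only [Category.assoc] at h
    rw [reassoc_of% h, ← comp_whiskerRight_assoc, hH.hom_hom]
    simp
  · intro h
    have h := contract_injective (contract_injective h)
    have h' : r ≫ Δ[H] ▷ M = r ≫ H ◁ r ≫ (α_ H H M).inv ≫ (β_ H H).hom ▷ M := by
      rw [← reassoc_of% h, comp_whiskerRight, Category.assoc, Iso.hom_inv_id_assoc,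
        ← comp_whiskerRight, hH.hom_hom, id_whiskerRight, Category.comp_id]
    rw [reassoc_of% h']

section Compat
variable [BimonObj H]

/-- `h ⊗ m ↦ y h₁ ⊗ m''` where `y ⊗ m'' = r(h₂ m)`: one side of the Yetter-Drinfel'd condition, with
the factor `H` of the coaction on the left. -/
def compatL {M : C} (a : H ⊗ M ⟶ M) (r : M ⟶ H ⊗ M) : H ⊗ M ⟶ H ⊗ M :=
  Δ[H] ▷ M ≫ (α_ H H M).hom ≫ H ◁ (a ≫ r) ≫ (α_ H H M).inv ≫ opMul H ▷ M

/-- `h ⊗ m ↦ h₂ x ⊗ h₁ m'` where `x ⊗ m' = r(m)`: the other side of the Yetter-Drinfel'd condition,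
with the factor `H` of the coaction on the left. -/
def compatR {M : C} (a : H ⊗ M ⟶ M) (r : M ⟶ H ⊗ M) : H ⊗ M ⟶ H ⊗ M :=
  Δ[H] ▷ M ≫ (H ⊗ H) ◁ r ≫ (α_ H H (H ⊗ M)).hom ≫ H ◁ ((α_ H H M).inv ≫ μ[H] ▷ M) ≫
    (α_ H H M).inv ≫ (β_ H H).hom ▷ M ≫ (α_ H H M).hom ≫ H ◁ a

theorem compatL_braiding (hH : IsTransparent H) {M : C} (a : H ⊗ M ⟶ M) (r : M ⟶ H ⊗ M) :
    Δ[H] ▷ M ≫ (α_ H H M).hom ≫ H ◁ a ≫ (β_ M H).inv ≫ (r ≫ (β_ H M).hom) ▷ H ≫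
        (α_ M H H).hom ≫ M ◁ μ[H] = compatL a r ≫ (β_ H M).hom := by
  rw [← hH M, ← BraidedCategory.braiding_naturality_right_assoc,
    BraidedCategory.braiding_tensor_right_hom]
  symm
  calc
    _ = 𝟙 _ ⊗≫ Δ[H] ▷ M ⊗≫ H ◁ (a ≫ r) ⊗≫ (β_ H H).hom ▷ M ⊗≫
          (μ[H] ▷ M ≫ (β_ H M).hom) := by
      rw [compatL, opMul]; monoidal
    _ = 𝟙 _ ⊗≫ Δ[H] ▷ M ⊗≫ H ◁ (a ≫ r) ⊗≫
          ((β_ H H).hom ▷ M ≫ (β_ (H ⊗ H) M).hom) ⊗≫ M ◁ μ[H] := by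
      rw [BraidedCategory.braiding_naturality_left]; monoidal
    _ = _ := by
      rw [BraidedCategory.braiding_naturality_left, BraidedCategory.braiding_tensor_left_hom]
      monoidal

theorem compatR_braiding (hH : IsTransparent H) {M : C} (a : H ⊗ M ⟶ M) (r : M ⟶ H ⊗ M) :
    (Δ[H] ⊗ₘ (r ≫ (β_ H M).hom)) ≫ tensorμ H H M H ≫ (a ⊗ₘ μ[H]) =
      compatR a r ≫ (β_ H M).hom := by
  symm
  calc
    _ = 𝟙 _ ⊗≫ Δ[H] ▷ M ⊗≫ (H ⊗ H) ◁ r ⊗≫ H ◁ μ[H] ▷ M ⊗≫ (β_ H H).hom ▷ M ⊗≫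
          (H ◁ a ≫ (β_ H M).hom) := by rw [compatR]; monoidal
    _ = 𝟙 _ ⊗≫ Δ[H] ▷ M ⊗≫ (H ⊗ H) ◁ r ⊗≫ H ◁ μ[H] ▷ M ⊗≫
          ((β_ H H).hom ≫ (β_ H H).hom) ▷ M ⊗≫ H ◁ (β_ H M).hom ⊗≫ a ▷ H := by
      rw [BraidedCategory.braiding_naturality_right, BraidedCategory.braiding_tensor_right_hom]
      monoidal
    _ = 𝟙 _ ⊗≫ Δ[H] ▷ M ⊗≫ (H ⊗ H) ◁ r ⊗≫ H ◁ (μ[H] ▷ M ≫ (β_ H M).hom) ⊗≫ a ▷ H := by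
      rw [hH.hom_hom]; monoidal
    _ = 𝟙 _ ⊗≫ Δ[H] ▷ M ⊗≫ (H ⊗ H) ◁ r ⊗≫ H ◁ (β_ (H ⊗ H) M).hom ⊗≫
          ((H ⊗ M) ◁ μ[H] ≫ a ▷ H) := by
      rw [BraidedCategory.braiding_naturality_left]; monoidal
    _ = _ := by
      rw [whisker_exchange, tensorμ, BraidedCategory.braiding_tensor_left_hom,
        MonoidalCategory.tensorHom_def, MonoidalCategory.tensorHom_def]
      monoidal

variable [ComonObj B] (hH : IsTransparent H)
  (hB : IsMate (ε_ H B) (tensorPairing (ε_ H B) (ε_ H B)) Δ[B] (opMul H))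

include hB in
/-- The contraction of `compatL` with `f` is `f₁(h₁) f₂ (h₂ m)`. -/
theorem contract_compatL {M : C} (a : H ⊗ M ⟶ M) (r : M ⟶ H ⊗ M) :
    contract B (compatL a r) = (α_ B H M).inv ≫ convL (ε_ H B) ▷ M ≫ smashAct a (contract B r) := by
  have h : Δ[B] ▷ (H ⊗ H) ≫ tensorμ B B H H ≫ (ε_ H B ⊗ₘ ε_ H B) ≫ (λ_ (𝟙_ C)).hom =
      B ◁ opMul H ≫ ε_ H B := hB
  calc
    _ = 𝟙 _ ⊗≫ B ◁ Δ[H] ▷ M ⊗≫ B ◁ H ◁ (a ≫ r) ⊗≫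
          (B ◁ opMul H ≫ ε_ H B) ▷ M ⊗≫ 𝟙 _ := by
      rw [contract, compatL]; monoidal
    _ = 𝟙 _ ⊗≫ B ◁ Δ[H] ▷ M ⊗≫ (B ◁ H ◁ (a ≫ r) ≫
          Δ[B] ▷ (H ⊗ H ⊗ M)) ⊗≫ B ◁ (β_ B H).hom ▷ (H ⊗ M) ⊗≫
          ε_ H B ▷ (B ⊗ H ⊗ M) ⊗≫ ε_ H B ▷ M ⊗≫ 𝟙 _ := by
      rw [← h, tensorμ, MonoidalCategory.tensorHom_def]; monoidal
    _ = 𝟙 _ ⊗≫ (B ◁ Δ[H] ≫ Δ[B] ▷ (H ⊗ H)) ▷ M ⊗≫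
          B ◁ ((B ⊗ H) ◁ (a ≫ r) ≫ (β_ B H).hom ▷ (H ⊗ M)) ⊗≫
          ε_ H B ▷ (B ⊗ H ⊗ M) ⊗≫ ε_ H B ▷ M ⊗≫ 𝟙 _ := by
      rw [whisker_exchange]; monoidal
    _ = 𝟙 _ ⊗≫ (Δ[B] ▷ H ≫ (B ⊗ B) ◁ Δ[H]) ▷ M ⊗≫
          B ◁ (β_ B H).hom ▷ (H ⊗ M) ⊗≫
          ((B ⊗ H) ◁ B ◁ (a ≫ r) ≫ ε_ H B ▷ (B ⊗ H ⊗ M)) ⊗≫ ε_ H B ▷ M ⊗≫ 𝟙 _ := by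
      rw [whisker_exchange Δ[B] Δ[H], whisker_exchange (β_ B H).hom]; monoidal
    _ = _ := by
      rw [whisker_exchange, convL, smashAct, contract, Comon.tensorObj_comul, tensorμ,
        MonoidalCategory.tensorHom_def]
      monoidal

include hH hB in
/-- The contraction of `compatR` with `f` is `h₁ (f₁ m) f₂(h₂)`. -/
theorem contract_compatR {M : C} (a : H ⊗ M ⟶ M) (r : M ⟶ H ⊗ M) :
    contract B (compatR a r) = (α_ B H M).inv ≫ convR (ε_ H B) ▷ M ≫ (β_ B H).hom ▷ M ≫
      (α_ H B M).hom ≫ H ◁ contract B r ≫ a := by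
  have h : B ◁ μ[H] ≫ ε_ H B = 𝟙 _ ⊗≫ Δ[B] ▷ (H ⊗ H) ⊗≫ B ◁ (ε_ H B) ▷ H ⊗≫ ε_ H B := by
    have h1 : Δ[B] ▷ (H ⊗ H) ≫ tensorPairing (ε_ H B) (ε_ H B) =
      B ◁ opMul H ≫ ε_ H B := hB
    have h2 : μ[H] = (β_ H H).hom ≫ opMul H := by rw [opMul, reassoc_of% hH.hom_hom H]
    rw [h2, MonoidalCategory.whiskerLeft_comp_assoc, ← h1, tensorPairing_eq_nested,
      whisker_exchange_assoc, ← MonoidalCategory.whiskerLeft_comp_assoc, Iso.hom_inv_id]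
    monoidal
  have e : B ◁ (β_ H H).hom ≫ (α_ B H H).inv ≫ ε_ H B ▷ H ≫ (λ_ H).hom =
      (α_ B H H).inv ≫ (β_ B H).hom ▷ H ≫ (α_ H B H).hom ≫ H ◁ ε_ H B ≫ (ρ_ H).hom := by
    have e3 : H ◁ ε_ H B ≫ (ρ_ H).hom = (β_ H (B ⊗ H)).hom ≫ ε_ H B ▷ H ≫ (λ_ H).hom := by
      rw [← BraidedCategory.braiding_naturality_right_assoc, braiding_tensorUnit_right]; simp
    rw [e3, BraidedCategory.braiding_tensor_right_hom]
    symm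
    calc
      _ = 𝟙 _ ⊗≫ ((β_ B H).hom ≫ (β_ H B).hom) ▷ H ⊗≫ B ◁ (β_ H H).hom ⊗≫
            ε_ H B ▷ H ⊗≫ 𝟙 _ := by monoidal
      _ = _ := by rw [hH.hom_hom']; monoidal
  calc
    _ = 𝟙 _ ⊗≫ B ◁ Δ[H] ▷ M ⊗≫ B ◁ (H ⊗ H) ◁ r ⊗≫
          B ◁ (H ◁ μ[H] ≫ (β_ H H).hom) ▷ M ⊗≫ (B ⊗ H) ◁ a ⊗≫ ε_ H B ▷ M ⊗≫ 𝟙 _ := by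
      rw [contract, compatR]; monoidal
    _ = 𝟙 _ ⊗≫ B ◁ Δ[H] ▷ M ⊗≫ B ◁ (H ⊗ H) ◁ r ⊗≫
          B ◁ (β_ H (H ⊗ H)).hom ▷ M ⊗≫ (B ◁ μ[H]) ▷ (H ⊗ M) ⊗≫ ((B ⊗ H) ◁ a ≫
            ε_ H B ▷ M) ⊗≫ 𝟙 _ := by
      rw [BraidedCategory.braiding_naturality_right]; monoidal
    _ = 𝟙 _ ⊗≫ B ◁ Δ[H] ▷ M ⊗≫ B ◁ (H ⊗ H) ◁ r ⊗≫
          B ◁ (β_ H (H ⊗ H)).hom ▷ M ⊗≫ (B ◁ μ[H] ≫ ε_ H B) ▷ (H ⊗ M) ⊗≫ a := by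
      rw [whisker_exchange]; monoidal
    _ = 𝟙 _ ⊗≫ B ◁ Δ[H] ▷ M ⊗≫ B ◁ (H ⊗ H) ◁ r ⊗≫
          (B ◁ ((α_ H H H).inv ≫ (β_ H H).hom ▷ H ≫ (α_ H H H).hom ≫ H ◁ (β_ H H).hom) ≫
          Δ[B] ▷ (H ⊗ H ⊗ H)) ▷ M ⊗≫ B ◁ (ε_ H B) ▷ (H ⊗ H ⊗ M) ⊗≫
          ε_ H B ▷ (H ⊗ M) ⊗≫ a := by
      rw [h, BraidedCategory.braiding_tensor_right_hom]; monoidal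
    _ = 𝟙 _ ⊗≫ (B ◁ Δ[H] ▷ M ≫ B ◁ (H ⊗ H) ◁ r ≫ Δ[B] ▷ ((H ⊗ H) ⊗ H ⊗ M)) ⊗≫
          B ◁ B ◁ (β_ H H).hom ▷ (H ⊗ M) ⊗≫ B ◁ ((B ⊗ H) ◁ (β_ H H).hom ≫
          ε_ H B ▷ (H ⊗ H)) ▷ M ⊗≫
          ε_ H B ▷ (H ⊗ M) ⊗≫ a := by
      rw [whisker_exchange Δ[B]]; monoidal
    _ = 𝟙 _ ⊗≫ (B ◁ Δ[H] ▷ M ≫ B ◁ (H ⊗ H) ◁ r ≫ Δ[B] ▷ ((H ⊗ H) ⊗ H ⊗ M)) ⊗≫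
          B ◁ (B ◁ (β_ H H).hom ≫ (α_ B H H).inv ≫ ε_ H B ▷ H ≫ (λ_ H).hom) ▷ (H ⊗ M) ⊗≫
          (B ◁ (β_ H H).hom ≫ (α_ B H H).inv ≫ ε_ H B ▷ H ≫ (λ_ H).hom) ▷ M ⊗≫ a := by
      rw [whisker_exchange (ε_ H B)]; monoidal
    _ = 𝟙 _ ⊗≫ (B ◁ Δ[H] ▷ M ≫ Δ[B] ▷ ((H ⊗ H) ⊗ M)) ⊗≫
          B ◁ ((B ⊗ H) ◁ H ◁ r ≫ (β_ B H).hom ▷ (H ⊗ H ⊗ M)) ⊗≫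
          B ◁ H ◁ ε_ H B ▷ (H ⊗ M) ⊗≫ (β_ B H).hom ▷ (H ⊗ M) ⊗≫ H ◁ ε_ H B ▷ M ⊗≫ a := by
      rw [e, whisker_exchange]; monoidal
    _ = 𝟙 _ ⊗≫ (B ◁ Δ[H] ≫ Δ[B] ▷ (H ⊗ H)) ▷ M ⊗≫
          B ◁ (β_ B H).hom ▷ (H ⊗ M) ⊗≫
          B ◁ H ◁ ((B ⊗ H) ◁ r ≫ ε_ H B ▷ (H ⊗ M)) ⊗≫
          (β_ B H).hom ▷ (H ⊗ M) ⊗≫ H ◁ ε_ H B ▷ M ⊗≫ a := by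
      rw [whisker_exchange (β_ B H).hom]; monoidal
    _ = 𝟙 _ ⊗≫ (Δ[B] ▷ H ≫ (B ⊗ B) ◁ Δ[H]) ▷ M ⊗≫
          B ◁ (β_ B H).hom ▷ (H ⊗ M) ⊗≫
          (B ⊗ H) ◁ ε_ H B ▷ M ⊗≫ ((B ⊗ H) ◁ r ≫
          (β_ B H).hom ▷ (H ⊗ M)) ⊗≫ H ◁ ε_ H B ▷ M ⊗≫ a := by
      rw [whisker_exchange Δ[B] Δ[H], whisker_exchange (ε_ H B)]; monoidal
    _ = _ := by
      rw [whisker_exchange, convR, contract, Comon.tensorObj_comul, tensorμ,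
        MonoidalCategory.tensorHom_def]
      monoidal

include hH hB in
/-- The Yetter-Drinfel'd condition is the exchange relation
`⟨h₁, f₁⟩ f₂ (h₂ m) = h₁ (f₁ m) ⟨h₂, f₂⟩` of the actions of `H` and of its dual. -/
theorem compat_iff {M : C} (a : H ⊗ M ⟶ M) (r : M ⟶ H ⊗ M) :
    (Δ[H] ▷ M ≫ (α_ H H M).hom ≫ H ◁ a ≫ (β_ M H).inv ≫ (r ≫ (β_ H M).hom) ▷ H ≫
        (α_ M H H).hom ≫ M ◁ μ[H] =
      (Δ[H] ⊗ₘ (r ≫ (β_ H M).hom)) ≫ tensorμ H H M H ≫ (a ⊗ₘ μ[H])) ↔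
    convL ((β_ H B).hom ≫ ε_ H B) ▷ M ≫ (β_ H B).hom ▷ M ≫ smashAct a (contract B r) =
      convR ((β_ H B).hom ≫ ε_ H B) ▷ M ≫ (α_ H B M).hom ≫ H ◁ contract B r ≫ a := by
  have := isComonHom_braiding (Q := B) hH
  have hL : convL ((β_ H B).hom ≫ ε_ H B) ▷ M ≫ (β_ H B).hom ▷ M ≫ smashAct a (contract B r) =
      (β_ H B).hom ▷ M ≫ (α_ B H M).hom ≫ contract B (compatL a r) := by
    rw [contract_compatL hB, Iso.hom_inv_id_assoc, ← comp_whiskerRight_assoc,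
      ← comp_whiskerRight_assoc, comp_convL]
  have hR : convR ((β_ H B).hom ≫ ε_ H B) ▷ M ≫ (α_ H B M).hom ≫ H ◁ contract B r ≫ a =
      (β_ H B).hom ▷ M ≫ (α_ B H M).hom ≫ contract B (compatR a r) := by
    rw [contract_compatR hH hB, Iso.hom_inv_id_assoc, ← comp_whiskerRight_assoc, comp_convR,
      comp_whiskerRight_assoc, ← comp_whiskerRight_assoc (β_ H B).hom, hH.hom_hom]
    simp
  rw [compatL_braiding hH, compatR_braiding hH, hL, hR, cancel_mono, cancel_epi, cancel_epi]
  exact ⟨fun h => by rw [h], contract_injective⟩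

end Compat
end

/-! ### Modules over the double as Yetter-Drinfel'd modules -/

section
variable {C : Type u} [Category.{v} C] [MonoidalCategory C] [BraidedCategory C]

omit [BraidedCategory C] in
theorem smashAct_natural {H B M N : C} {a : H ⊗ M ⟶ M} {b : B ⊗ M ⟶ M} {a' : H ⊗ N ⟶ N}
    {b' : B ⊗ N ⟶ N} {f : M ⟶ N} (ha : a ≫ f = H ◁ f ≫ a') (hb : b ≫ f = B ◁ f ≫ b') :
    smashAct a b ≫ f = (B ⊗ H) ◁ f ≫ smashAct a' b' := by
  rw [smashAct, smashAct, Category.assoc, Category.assoc, hb,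
    ← MonoidalCategory.whiskerLeft_comp_assoc, ha]
  monoidal

theorem diagAct_restrict {A T : C} [ComonObj A] [ComonObj T] (g : T ⟶ A) [IsComonHom g] {M N : C}
    (a : A ⊗ M ⟶ M) (b : A ⊗ N ⟶ N) :
    g ▷ (M ⊗ N) ≫ diagAct a b = diagAct (g ▷ M ≫ a) (g ▷ N ≫ b) := by
  rw [diagAct, ← comp_whiskerRight_assoc, IsComonHom.hom_comul, comp_whiskerRight_assoc,
    tensorμ_natural_left_assoc, tensorHom_comp_tensorHom, diagAct]

omit [BraidedCategory C] in
theorem unitAct_restrict {A T : C} [ComonObj A] [ComonObj T] (g : T ⟶ A) [IsComonHom g] :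
    g ▷ 𝟙_ C ≫ unitAct A = unitAct T := by
  rw [unitAct, rightUnitor_naturality_assoc, IsComonHom.hom_counit, unitAct]

section Tensor
variable {H B : C} [ExactPairing H B] [MonObj H]

/-- The codiagonal coaction with the factor `H` on the left: `m ⊗ n ↦ y x ⊗ (m' ⊗ n')` where
`r(m) = x ⊗ m'` and `r'(n) = y ⊗ n'`. -/
def diagInsert {M N : C} (r : M ⟶ H ⊗ M) (r' : N ⟶ H ⊗ N) : M ⊗ N ⟶ H ⊗ (M ⊗ N) :=
  (r ⊗ₘ r') ≫ tensorμ H M H N ≫ opMul H ▷ (M ⊗ N)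

theorem diagInsert_braiding (hH : IsTransparent H) {M N : C} (r : M ⟶ H ⊗ M) (r' : N ⟶ H ⊗ N) :
    diagInsert r r' ≫ (β_ H (M ⊗ N)).hom =
      diagCoact (r ≫ (β_ H M).hom) (r' ≫ (β_ H N).hom) := by
  rw [diagInsert, Category.assoc, Category.assoc, BraidedCategory.braiding_naturality_left,
    reassoc_of% tensorμ_braiding (A := H) (B := M) (D := H) (E := N) (hH.hom_hom' M), diagCoact,
    tensorHom_comp_tensorHom_assoc]

omit [MonObj H] in
theorem tensorμ_transparent (hH : IsTransparent H) (M N : C) :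
    tensorμ H M H N ≫ tensorμ H H M N = 𝟙 _ := by
  calc
    _ = 𝟙 _ ⊗≫ H ◁ ((β_ M H).hom ≫ (β_ H M).hom) ▷ N ⊗≫ 𝟙 _ := by simp only [tensorμ]; monoidal
    _ = _ := by rw [hH.hom_hom']; monoidal

/-- The diagonal action of the dual corresponds to the codiagonal coaction. -/
theorem contract_diagInsert [ComonObj B] (hH : IsTransparent H)
    (hB : IsMate (ε_ H B) (tensorPairing (ε_ H B) (ε_ H B)) Δ[B] (opMul H)) {M N : C}
    (r : M ⟶ H ⊗ M) (r' : N ⟶ H ⊗ N) :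
    contract B (diagInsert r r') = diagAct (contract B r) (contract B r') := by
  have hB : Δ[B] ▷ (H ⊗ H) ≫ tensorμ B B H H ≫ (ε_ H B ⊗ₘ ε_ H B) ≫ (λ_ _).hom =
    B ◁ opMul H ≫ ε_ H B := hB
  have e := tensor_associativity B B H H M N
  have n1 := tensorμ_natural_right B B r r'
  have n2 := tensorμ_natural_left (ε_ H B) (ε_ H B) M N
  have u := tensor_left_unitality M N
  have e2 : (B ⊗ B) ◁ tensorμ H H M N ≫ tensorμ B B (H ⊗ M) (H ⊗ N) ≫
      ((α_ B H M).inv ⊗ₘ (α_ B H N).inv) = (α_ _ _ _).inv ≫ tensorμ B B H H ▷ (M ⊗ N) ≫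
      tensorμ (B ⊗ H) (B ⊗ H) M N := by
    rw [Iso.eq_inv_comp, ← reassoc_of% e, tensorHom_comp_tensorHom]
    simp
  have e3 : (B ⊗ B) ◁ tensorμ H M H N ≫ (B ⊗ B) ◁ tensorμ H H M N = 𝟙 _ := by
    rw [← MonoidalCategory.whiskerLeft_comp, tensorμ_transparent hH,
      MonoidalCategory.whiskerLeft_id]
  symm
  calc
    _ = Δ[B] ▷ (M ⊗ N) ≫ (tensorμ B B M N ≫ ((B ◁ r) ⊗ₘ (B ◁ r'))) ≫
          ((α_ B H M).inv ⊗ₘ (α_ B H N).inv) ≫ (ε_ H B ▷ M ⊗ₘ ε_ H B ▷ N) ≫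
          ((λ_ M).hom ⊗ₘ (λ_ N).hom) := by
      simp [diagAct, contract]
    _ = Δ[B] ▷ (M ⊗ N) ≫ (B ⊗ B) ◁ (r ⊗ₘ r') ≫ (B ⊗ B) ◁ tensorμ H M H N ≫
          (B ⊗ B) ◁ tensorμ H H M N ≫ tensorμ B B (H ⊗ M) (H ⊗ N) ≫
          ((α_ B H M).inv ⊗ₘ (α_ B H N).inv) ≫ (ε_ H B ▷ M ⊗ₘ ε_ H B ▷ N) ≫
          ((λ_ M).hom ⊗ₘ (λ_ N).hom) := by
      rw [reassoc_of% e3, ← n1]; simp only [Category.assoc]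
    _ = Δ[B] ▷ (M ⊗ N) ≫ (B ⊗ B) ◁ (r ⊗ₘ r') ≫ (B ⊗ B) ◁ tensorμ H M H N ≫
          (α_ _ _ _).inv ≫ tensorμ B B H H ▷ (M ⊗ N) ≫ (ε_ H B ⊗ₘ ε_ H B) ▷ (M ⊗ N) ≫
          (λ_ (𝟙_ C)).hom ▷ (M ⊗ N) ≫ (λ_ (M ⊗ N)).hom := by
      rw [u, hom_inv_whiskerRight_assoc, reassoc_of% e2, reassoc_of% n2]
    _ = 𝟙 _ ⊗≫ (Δ[B] ▷ (M ⊗ N) ≫ (B ⊗ B) ◁ ((r ⊗ₘ r') ≫ tensorμ H M H N)) ⊗≫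
          (tensorμ B B H H ≫ (ε_ H B ⊗ₘ ε_ H B) ≫ (λ_ _).hom) ▷ (M ⊗ N) ⊗≫ 𝟙 _ := by monoidal
    _ = 𝟙 _ ⊗≫ B ◁ ((r ⊗ₘ r') ≫ tensorμ H M H N) ⊗≫ (Δ[B] ▷ (H ⊗ H) ≫
          tensorμ B B H H ≫ (ε_ H B ⊗ₘ ε_ H B) ≫ (λ_ _).hom) ▷ (M ⊗ N) ⊗≫ 𝟙 _ := by
      rw [← whisker_exchange]; monoidal
    _ = _ := by rw [hB, contract, diagInsert]; monoidal

omit [BraidedCategory C] in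
theorem contract_unit [ComonObj B] (h : B ◁ η[H] ≫ ε_ H B = (ρ_ B).hom ≫ ε[B]) :
    contract B (η[H] ≫ (ρ_ H).inv) = unitAct B := by
  calc
    _ = 𝟙 _ ⊗≫ (B ◁ η[H] ≫ ε_ H B) ▷ 𝟙_ C ⊗≫ 𝟙 _ := by rw [contract]; monoidal
    _ = _ := by rw [h, unitAct]; monoidal

theorem unit_braiding : (η[H] ≫ (ρ_ H).inv) ≫ (β_ H (𝟙_ C)).hom = unitCoact H := by
  rw [unitCoact, braiding_tensorUnit_right]; simp

end Tensor

section Double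
variable (H : C) [HopfObj H] [IsIso 𝒮[H]] [HasRightDual H] (hH : IsTransparent H)

/-- The bialgebra structure of the Drinfel'd double. -/
abbrev doubleBimonObj : BimonObj (double H) :=
  letI := dualBimonObj H hH
  smashBimonObj ((dualPairing H hH).isDistributive hH) ((dualPairing H hH).isComonHom_exch hH)

theorem doubleBimonObj_mul : (doubleBimonObj H hH).mul = doubleMul H := by
  unfold doubleMul
  rw [exchange_eq H hH]
  rfl

theorem doubleBimonObj_comul : (doubleBimonObj H hH).comul = doubleComul H :=
  letI := dualBimonObj H hH
  Comon.tensorObj_comul Hᘁ H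

variable {H}

/-- Yetter-Drinfel'd modules in terms of the action of the dual obtained from the coaction: the two
actions satisfy the exchange relation. It differs from the relation in `compat_iff` by the action
`convR` of `τ`, which is invertible. -/
theorem isYetterDrinfeld_iff (M : ActCoact H) (b : Hᘁ ⊗ M.X ⟶ M.X)
    (hb : M.coact = uncontract H b ≫ (β_ H M.X).hom) : letI := dualBimonObj H hH
    IsYetterDrinfeld M ↔ η[H] ▷ M.X ≫ M.act = (λ_ M.X).hom ∧
      μ[H] ▷ M.X ≫ M.act = (α_ H H M.X).hom ≫ H ◁ M.act ≫ M.act ∧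
      η[Hᘁ] ▷ M.X ≫ b = (λ_ M.X).hom ∧
      μ[Hᘁ] ▷ M.X ≫ b = (α_ Hᘁ Hᘁ M.X).hom ≫ Hᘁ ◁ b ≫ b ∧
      H ◁ b ≫ M.act = (α_ H Hᘁ M.X).inv ≫ (dualPairing H hH).exch ▷ M.X ≫ smashAct M.act b := by
  let _ := dualBimonObj H hH
  have h1 := coact_counit_iff (H := H) (B := Hᘁ) (curry_ev _) (uncontract H b)
  have h2 := coact_comul_iff (H := H) (B := Hᘁ) hH (isMate_dualMul H Δ[H]) (uncontract H b)
  have h3 := compat_iff (H := H) (B := Hᘁ) hH (isMate_dualComul H (opMul H)) M.act (uncontract H b)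
  rw [contract_uncontract, ← hb] at h1 h2 h3
  have h4 : (convL ((β_ H Hᘁ).hom ≫ ε_ H Hᘁ) ▷ M.X ≫ (β_ H Hᘁ).hom ▷ M.X ≫ smashAct M.act b =
      convR ((β_ H Hᘁ).hom ≫ ε_ H Hᘁ) ▷ M.X ≫ (α_ H Hᘁ M.X).hom ≫ H ◁ b ≫ M.act) ↔
      H ◁ b ≫ M.act = (α_ H Hᘁ M.X).inv ≫ (dualPairing H hH).exch ▷ M.X ≫ smashAct M.act b := by
    set p := dualPairing H hH
    change (convL p.τ ▷ M.X ≫ _ = convR p.τ ▷ M.X ≫ _) ↔ _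
    have i1 : convR p.τ ≫ convR p.τ' = 𝟙 _ := by rw [convR_convR, p.inv_conv, convR_counit]
    have i2 : convR p.τ' ≫ convR p.τ = 𝟙 _ := by rw [convR_convR, p.conv_inv, convR_counit]
    rw [Iso.eq_inv_comp, SkewPairing.exch, twist, convL_convR]
    constructor
    · intro h
      simp only [comp_whiskerRight, Category.assoc]
      rw [h, ← comp_whiskerRight_assoc, i2]
      simp
    · intro h
      rw [h]
      simp only [comp_whiskerRight, Category.assoc]
      rw [← comp_whiskerRight_assoc (convR p.τ), i1]
      simp
  constructor
  · rintro ⟨a1, a2, a3, a4, a5⟩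
    exact ⟨a1, a2, h1.1 a3, h2.1 a4, h4.1 (h3.1 a5)⟩
  · rintro ⟨a1, a2, a3, a4, a5⟩
    exact ⟨a1, a2, h1.2 a3, h2.2 a4, h3.2 (h4.2 a5)⟩

section
variable [Fact (IsTransparent H)]

/-- The bialgebra `(H^op)*`. Transparency of `H` is assumed through `Fact` so that this and the
bialgebra `D(H)` can be instances. -/
local instance dualBimon : BimonObj Hᘁ := dualBimonObj H Fact.out

/-- The bialgebra `D(H)`. -/
local instance doubleBimon : BimonObj (double H) := doubleBimonObj H Fact.out

variable (H) in
/-- The exchange morphism of the double. -/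
abbrev doubleExch : H ⊗ Hᘁ ⟶ Hᘁ ⊗ H := (dualPairing H Fact.out).exch

variable (H) in
theorem isDistributive_doubleExch : IsDistributive (doubleExch H) :=
  (dualPairing H Fact.out).isDistributive Fact.out

omit [IsIso 𝒮[H]] [HasRightDual H] [Fact (IsTransparent H)] in
theorem one_inclH_act {B M : C} [MonObj B] {g : (B ⊗ H) ⊗ M ⟶ M}
    (h : smashOne H B ▷ M ≫ g = (λ_ M).hom) :
    η[H] ▷ M ≫ inclH H B ▷ M ≫ g = (λ_ M).hom := by
  rw [← comp_whiskerRight_assoc, one_inclH, h]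

omit [IsIso 𝒮[H]] [HasRightDual H] [Fact (IsTransparent H)] in
theorem one_inclB_act {B M : C} [MonObj B] {g : (B ⊗ H) ⊗ M ⟶ M}
    (h : smashOne H B ▷ M ≫ g = (λ_ M).hom) :
    η[B] ▷ M ≫ inclB H B ▷ M ≫ g = (λ_ M).hom := by
  rw [← comp_whiskerRight_assoc, one_inclB, h]

theorem coactOfDouble_eq (M : Mod C (double H)) :
    coactOfDouble H M = uncontract H (dualActOfDouble H M) ≫ (β_ H M.X).hom := by
  simp [coactOfDouble, uncontract]

theorem double_mul_smul (M : Mod C (double H)) :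
    smashMul (doubleExch H) ▷ M.X ≫ γ[double H, M.X] =
      (α_ (Hᘁ ⊗ H) (Hᘁ ⊗ H) M.X).hom ≫ (Hᘁ ⊗ H) ◁ γ[double H, M.X] ≫ γ[double H, M.X] :=
  ModObj.mul_smul_self (double H) M.X

theorem double_one_smul (M : Mod C (double H)) :
    smashOne H Hᘁ ▷ M.X ≫ γ[double H, M.X] = (λ_ M.X).hom :=
  ModObj.one_smul_self (double H) M.X

/-- A module over the double is a Yetter-Drinfel'd module. -/
theorem isYD_doubleToActCoact (M : Mod C (double H)) : isYD H ((doubleToActCoact H).obj M) :=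
  (isYetterDrinfeld_iff Fact.out _ (dualActOfDouble H M) (coactOfDouble_eq M)).2
    ⟨one_inclH_act (double_one_smul M),
      inclH_mul_act (isDistributive_doubleExch H) (double_mul_smul M),
      one_inclB_act (double_one_smul M),
      inclB_mul_act (isDistributive_doubleExch H) (double_mul_smul M),
      exchange_incl (isDistributive_doubleExch H) (double_mul_smul M)⟩

/-- The action of the dual on a Yetter-Drinfel'd module: `f m = f(m₁) m₀`. -/
def dualActOfCoact (M : ActCoact H) : Hᘁ ⊗ M.X ⟶ M.X :=
  contract Hᘁ (M.coact ≫ (β_ M.X H).hom)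

omit [HopfObj H] [IsIso 𝒮[H]] in
theorem uncontract_dualActOfCoact (M : ActCoact H) :
    M.coact = uncontract H (dualActOfCoact M) ≫ (β_ H M.X).hom := by
  rw [dualActOfCoact, uncontract_contract, Category.assoc, IsTransparent.hom_hom' Fact.out,
    Category.comp_id]

/-- The module over the double defined by a Yetter-Drinfel'd module. -/
def doubleMod (M : ActCoact H) (hM : isYD H M) : Mod C (double H) where
  X := M.X
  mod :=
    { smul := smashAct M.act (dualActOfCoact M)
      one_smul := by
        have h := (isYetterDrinfeld_iff Fact.out M _ (uncontract_dualActOfCoact M)).1 hM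
        exact smashAct_one h.1 h.2.2.1
      mul_smul := by
        have h := (isYetterDrinfeld_iff Fact.out M _ (uncontract_dualActOfCoact M)).1 hM
        exact smashAct_mul h.2.1 h.2.2.2.1 h.2.2.2.2 }

theorem doubleToActCoact_doubleMod (M : ActCoact H) (hM : isYD H M) :
    (doubleToActCoact H).obj (doubleMod M hM) = M := by
  have h := (isYetterDrinfeld_iff Fact.out M _ (uncontract_dualActOfCoact M)).1 hM
  have h1 : actOfDouble H (doubleMod M hM) = M.act :=
    inclH_smashAct (b := dualActOfCoact M) h.2.2.1
  have h2 : dualActOfDouble H (doubleMod M hM) = dualActOfCoact M :=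
    inclB_smashAct (a := M.act) h.1
  have h3 : coactOfDouble H (doubleMod M hM) = M.coact := by
    rw [coactOfDouble_eq, h2, uncontract_dualActOfCoact M]; rfl
  change ActCoact.mk M.X (actOfDouble H (doubleMod M hM)) (coactOfDouble H (doubleMod M hM)) = M
  rw [h1, h3]

theorem dualActOfCoact_doubleToActCoact (M : Mod C (double H)) :
    dualActOfCoact ((doubleToActCoact H).obj M) = dualActOfDouble H M := by
  change contract Hᘁ (coactOfDouble H M ≫ (β_ M.X H).hom) = _
  rw [coactOfDouble_eq, Category.assoc, IsTransparent.hom_hom Fact.out, Category.comp_id,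
    contract_uncontract]

theorem doubleMod_doubleToActCoact (M : Mod C (double H)) :
    doubleMod ((doubleToActCoact H).obj M) (isYD_doubleToActCoact M) = M := by
  have h : smashAct (actOfDouble H M) (dualActOfCoact ((doubleToActCoact H).obj M)) =
      γ[double H, M.X] := by
    rw [dualActOfCoact_doubleToActCoact]
    exact smashAct_incl (isDistributive_doubleExch H) (double_mul_smul M)
  obtain ⟨X, ⟨⟩⟩ := M
  unfold doubleMod
  congr 1
  congr 1

/-- The functor from Yetter-Drinfel'd modules to modules over the double. -/
def ydToDouble : YD H ⥤ Mod C (double H) where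
  obj M := doubleMod M.obj M.property
  map {M N} f := Mod.Hom.mk' (M := doubleMod M.obj M.property) (N := doubleMod N.obj N.property)
    f.hom.hom (by
      have h1 := f.hom.linear
      have h2 := f.hom.colinear
      have h3 : dualActOfCoact M.obj ≫ f.hom.hom = Hᘁ ◁ f.hom.hom ≫ dualActOfCoact N.obj := by
        rw [dualActOfCoact, dualActOfCoact, ← contract_comp, ← comp_contract, Category.assoc,
          ← BraidedCategory.braiding_naturality_left, reassoc_of% h2]
      exact smashAct_natural h1 h3)

end
end Double
end

/-! ### The braiding of Yetter-Drinfel'd modules -/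

section
variable {C : Type u} [Category.{v} C] [MonoidalCategory C]

section
variable {H : C}

/-- The morphism `n ⊗ m ↦ n₀ ⊗ g(n₁) m`. -/
def coactAct (N M : ActCoact H) (g : H ⟶ H) : N.X ⊗ M.X ⟶ N.X ⊗ M.X :=
  N.coact ▷ M.X ≫ (α_ N.X H M.X).hom ≫ N.X ◁ (g ▷ M.X ≫ M.act)

theorem coactAct_natural {N M N' M' : ActCoact H} (f : N ⟶ N') (k : M ⟶ M') :
    coactAct N M (𝟙 H) ≫ (f.hom ⊗ₘ k.hom) = (f.hom ⊗ₘ k.hom) ≫ coactAct N' M' (𝟙 H) := by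
  have hf := f.colinear
  have hk := k.linear
  symm
  calc
    _ = 𝟙 _ ⊗≫ N.X ◁ k.hom ⊗≫ (f.hom ≫ N'.coact) ▷ M'.X ⊗≫ N'.X ◁ M'.act := by
      rw [MonoidalCategory.tensorHom_def', coactAct]; monoidal
    _ = 𝟙 _ ⊗≫ (N.X ◁ k.hom ≫ N.coact ▷ M'.X) ⊗≫ (f.hom ▷ (H ⊗ M'.X) ≫ N'.X ◁ M'.act) := by
      rw [← hf]; monoidal
    _ = 𝟙 _ ⊗≫ N.coact ▷ M.X ⊗≫ N.X ◁ (H ◁ k.hom ≫ M'.act) ≫ f.hom ▷ M'.X := by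
      rw [← whisker_exchange, whisker_exchange]; monoidal
    _ = _ := by rw [← hk, MonoidalCategory.tensorHom_def', coactAct]; monoidal

end

variable [BraidedCategory C]

section
variable {H : C} [BimonObj H]

/-- `coactAct` is multiplicative for the opposite convolution of endomorphisms of `H`. -/
theorem coactAct_comp {N M : ActCoact H} (hN : IsYetterDrinfeld N) (hM : IsYetterDrinfeld M)
    (g g' : H ⟶ H) :
    coactAct N M g ≫ coactAct N M g' = coactAct N M (Δ[H] ≫ (g' ⊗ₘ g) ≫ μ[H]) := by
  symm
  calc
    _ = 𝟙 _ ⊗≫ (N.coact ≫ N.X ◁ Δ[H]) ▷ M.X ⊗≫ N.X ◁ (g' ⊗ₘ g) ▷ M.X ⊗≫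
          N.X ◁ (μ[H] ▷ M.X ≫ M.act) := by rw [coactAct]; monoidal
    _ = 𝟙 _ ⊗≫ (N.coact ≫ N.coact ▷ H) ▷ M.X ⊗≫ N.X ◁ (g' ▷ (H ⊗ M.X) ≫
          H ◁ (g ▷ M.X ≫ M.act)) ⊗≫ N.X ◁ M.act := by
      rw [hM.mul_act, hN.coact_comul, MonoidalCategory.tensorHom_def]; monoidal
    _ = 𝟙 _ ⊗≫ N.coact ▷ M.X ⊗≫ (N.coact ▷ (H ⊗ M.X) ≫ (N.X ⊗ H) ◁ (g ▷ M.X ≫ M.act)) ⊗≫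
          N.X ◁ g' ▷ M.X ⊗≫ N.X ◁ M.act := by rw [← whisker_exchange]; monoidal
    _ = _ := by rw [← whisker_exchange, coactAct, coactAct]; monoidal

theorem coactAct_counit_unit {N M : ActCoact H} (hN : IsYetterDrinfeld N)
    (hM : IsYetterDrinfeld M) : coactAct N M (ε[H] ≫ η[H]) = 𝟙 _ := by
  calc
    _ = 𝟙 _ ⊗≫ (N.coact ≫ N.X ◁ ε[H]) ▷ M.X ⊗≫ N.X ◁ (η[H] ▷ M.X ≫ M.act) := by
      rw [coactAct]; monoidal
    _ = _ := by rw [hM.one_act, hN.coact_counit]; monoidal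

omit [BimonObj H] in
theorem ydBraiding_eq (M N : ActCoact H) :
    ydBraiding M N = (β_ M.X N.X).hom ≫ coactAct N M (𝟙 H) := by
  rw [ydBraiding, coactAct, id_whiskerRight, Category.id_comp]

omit [BimonObj H] in
theorem ydBraiding_natural {M N M' N' : ActCoact H} (f : M ⟶ M') (g : N ⟶ N') :
    (f.hom ⊗ₘ g.hom) ≫ ydBraiding M' N' = ydBraiding M N ≫ (g.hom ⊗ₘ f.hom) := by
  rw [ydBraiding_eq, ydBraiding_eq, BraidedCategory.braiding_naturality_assoc, Category.assoc,
    coactAct_natural]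

variable (hH : IsTransparent H)
include hH

/-- Linearity of the braiding uses the Yetter-Drinfel'd condition of the second factor. -/
theorem ydBraiding_linear {M N : ActCoact H} (hM : IsYetterDrinfeld M) (hN : IsYetterDrinfeld N) :
    diagAct M.act N.act ≫ ydBraiding M N = H ◁ ydBraiding M N ≫ diagAct N.act M.act := by
  have hc := hN.compat
  have h1 : diagAct M.act N.act ≫ (β_ M.X N.X).hom = H ◁ (β_ M.X N.X).hom ≫
      (Δ[H] ≫ (β_ H H).hom) ▷ (N.X ⊗ M.X) ≫ tensorμ H H N.X M.X ≫ (N.act ⊗ₘ M.act) := by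
    rw [diagAct, Category.assoc, Category.assoc, BraidedCategory.braiding_naturality,
      reassoc_of% tensorμ_braiding (A := H) (B := H) (D := M.X) (E := N.X) (hH.hom_hom _),
      MonoidalCategory.tensorHom_def]
    simp only [comp_whiskerRight, Category.assoc]
    rw [← whisker_exchange_assoc, ← whisker_exchange_assoc]
  rw [ydBraiding_eq, reassoc_of% h1, MonoidalCategory.whiskerLeft_comp, Category.assoc]
  congr 1
  calc
    _ = 𝟙 _ ⊗≫ Δ[H] ▷ (N.X ⊗ M.X) ⊗≫ (β_ H H).hom ▷ (N.X ⊗ M.X) ⊗≫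
          H ◁ (β_ H N.X).hom ▷ M.X ⊗≫ N.act ▷ (H ⊗ M.X) ⊗≫ (N.X ◁ M.act ≫ N.coact ▷ M.X) ⊗≫
          N.X ◁ M.act := by
      rw [coactAct, tensorμ, MonoidalCategory.tensorHom_def]; monoidal
    _ = 𝟙 _ ⊗≫ Δ[H] ▷ (N.X ⊗ M.X) ⊗≫ ((β_ H (H ⊗ N.X)).hom ≫ N.act ▷ H) ▷ M.X ⊗≫
          N.coact ▷ (H ⊗ M.X) ⊗≫
          N.X ◁ ((α_ H H M.X).hom ≫ H ◁ M.act ≫ M.act) := by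
      rw [whisker_exchange, BraidedCategory.braiding_tensor_right_hom]; monoidal
    _ = 𝟙 _ ⊗≫ (Δ[H] ▷ N.X ≫ (α_ H H N.X).hom ≫ H ◁ N.act ≫ (β_ N.X H).inv ≫ N.coact ▷ H ≫
        (α_ N.X H H).hom ≫ N.X ◁ μ[H]) ▷ M.X ⊗≫ N.X ◁ M.act := by
      rw [← BraidedCategory.braiding_naturality_right, ← hM.mul_act, hH]; monoidal
    _ = 𝟙 _ ⊗≫ (H ◁ N.coact ≫ Δ[H] ▷ (N.X ⊗ H)) ▷ M.X ⊗≫ H ◁ (β_ H N.X).hom ▷ (H ⊗ M.X) ⊗≫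
          N.act ▷ (H ⊗ H ⊗ M.X) ⊗≫ N.X ◁ (μ[H] ▷ M.X ≫ M.act) := by
      rw [hc, tensorμ, MonoidalCategory.tensorHom_def', MonoidalCategory.tensorHom_def]; monoidal
    _ = 𝟙 _ ⊗≫ H ◁ N.coact ▷ M.X ⊗≫ Δ[H] ▷ (N.X ⊗ H ⊗ M.X) ⊗≫
          H ◁ (β_ H N.X).hom ▷ (H ⊗ M.X) ⊗≫
          (N.act ▷ (H ⊗ H ⊗ M.X) ≫ N.X ◁ (H ◁ M.act)) ⊗≫ N.X ◁ M.act := by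
      rw [hM.mul_act]; monoidal
    _ = 𝟙 _ ⊗≫ H ◁ N.coact ▷ M.X ⊗≫ Δ[H] ▷ (N.X ⊗ H ⊗ M.X) ⊗≫
          H ◁ ((β_ H N.X).hom ▷ (H ⊗ M.X) ≫ (N.X ⊗ H) ◁ M.act) ⊗≫ N.act ▷ (H ⊗ M.X) ⊗≫
          N.X ◁ M.act := by
      rw [← whisker_exchange]; monoidal
    _ = 𝟙 _ ⊗≫ H ◁ N.coact ▷ M.X ⊗≫ (Δ[H] ▷ (N.X ⊗ H ⊗ M.X) ≫ (H ⊗ H) ◁ (N.X ◁ M.act)) ⊗≫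
          H ◁ (β_ H N.X).hom ▷ M.X ⊗≫ N.act ▷ (H ⊗ M.X) ⊗≫ N.X ◁ M.act := by
      rw [← whisker_exchange]; monoidal
    _ = _ := by
      rw [← whisker_exchange, coactAct, diagAct, tensorμ, MonoidalCategory.tensorHom_def]; monoidal

/-- Colinearity of the braiding uses the Yetter-Drinfel'd condition of the first factor. -/
theorem ydBraiding_colinear {M N : ActCoact H} (hM : IsYetterDrinfeld M)
    (hN : IsYetterDrinfeld N) :
    diagCoact M.coact N.coact ≫ ydBraiding M N ▷ H =
      ydBraiding M N ≫ diagCoact N.coact M.coact := by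
  have hc := hM.compat
  have h1 : diagCoact M.coact N.coact ≫ (β_ M.X N.X).hom ▷ H = (β_ M.X N.X).hom ≫
      (N.coact ⊗ₘ M.coact) ≫ tensorμ N.X H M.X H ≫ (N.X ⊗ M.X) ◁ μ[H] := by
    rw [← BraidedCategory.braiding_naturality_assoc,
      reassoc_of% braiding_tensorμ (X := M.X) (Y := H) (Z := N.X) (W := H) (hH.hom_hom' _),
      diagCoact, opMul, MonoidalCategory.tensorHom_def' (β_ M.X N.X).hom]
    simp only [MonoidalCategory.whiskerLeft_comp, Category.assoc]
    rw [whisker_exchange]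
  rw [ydBraiding_eq, comp_whiskerRight, reassoc_of% h1, Category.assoc]
  congr 1
  calc
    _ = 𝟙 _ ⊗≫ N.X ◁ M.coact ⊗≫ N.coact ▷ (M.X ⊗ H) ⊗≫ N.X ◁ (β_ H M.X).hom ▷ H ⊗≫
          ((N.X ⊗ M.X) ◁ μ[H] ≫ (N.coact ▷ M.X) ▷ H) ⊗≫ N.X ◁ M.act ▷ H ⊗≫ 𝟙 _ := by
      rw [coactAct, tensorμ, MonoidalCategory.tensorHom_def']; monoidal
    _ = 𝟙 _ ⊗≫ N.X ◁ M.coact ⊗≫ N.coact ▷ (M.X ⊗ H) ⊗≫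
          (N.X ◁ ((β_ H M.X).hom ▷ H) ≫ N.coact ▷ ((M.X ⊗ H) ⊗ H)) ⊗≫
          N.X ◁ (H ⊗ M.X) ◁ μ[H] ⊗≫ N.X ◁ M.act ▷ H ⊗≫ 𝟙 _ := by
      rw [whisker_exchange]; monoidal
    _ = 𝟙 _ ⊗≫ N.X ◁ M.coact ⊗≫ (N.coact ≫ N.coact ▷ H ≫ (α_ N.X H H).hom) ▷ (M.X ⊗ H) ⊗≫
          N.X ◁ H ◁ ((β_ H M.X).hom ▷ H) ⊗≫
          N.X ◁ ((H ⊗ M.X) ◁ μ[H] ≫ M.act ▷ H) ⊗≫ 𝟙 _ := by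
      rw [whisker_exchange]; monoidal
    _ = 𝟙 _ ⊗≫ (N.X ◁ M.coact ≫ N.coact ▷ (M.X ⊗ H)) ⊗≫ N.X ◁ Δ[H] ▷ (M.X ⊗ H) ⊗≫
          N.X ◁ H ◁ ((β_ H M.X).hom ▷ H) ⊗≫
          N.X ◁ M.act ▷ (H ⊗ H) ⊗≫ N.X ◁ M.X ◁ μ[H] ⊗≫ 𝟙 _ := by
      rw [whisker_exchange M.act, ← hN.coact_comul]; monoidal
    _ = 𝟙 _ ⊗≫ N.coact ▷ M.X ⊗≫
          N.X ◁ ((Δ[H] ⊗ₘ M.coact) ≫ tensorμ H H M.X H ≫ (M.act ⊗ₘ μ[H])) ⊗≫ 𝟙 _ := by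
      rw [whisker_exchange, tensorμ, MonoidalCategory.tensorHom_def',
        MonoidalCategory.tensorHom_def]
      monoidal
    _ = 𝟙 _ ⊗≫ (N.coact ≫ N.X ◁ Δ[H]) ▷ M.X ⊗≫ N.X ◁ H ◁ M.act ⊗≫
          N.X ◁ ((β_ H M.X).hom ≫ M.coact ▷ H) ⊗≫ N.X ◁ M.X ◁ μ[H] ⊗≫ 𝟙 _ := by
      rw [← hc, hH]; monoidal
    _ = 𝟙 _ ⊗≫ N.coact ▷ M.X ⊗≫ (N.coact ▷ (H ⊗ M.X) ≫ (N.X ⊗ H) ◁ M.act) ⊗≫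
          N.X ◁ H ◁ M.coact ⊗≫ N.X ◁ (β_ H M.X).hom ▷ H ⊗≫ N.X ◁ M.X ◁ opMul H ⊗≫ 𝟙 _ := by
      rw [← BraidedCategory.braiding_naturality_right, BraidedCategory.braiding_tensor_right_hom,
        hN.coact_comul, opMul]
      monoidal
    _ = _ := by
      rw [← whisker_exchange, coactAct, diagCoact, tensorμ, MonoidalCategory.tensorHom_def]
      monoidal

omit hH in
/-- The hexagon for a braiding with `N ⊗ L` amounts to the associativity of the action on `M`. -/
theorem ydBraiding_hexagon_forward {M : ActCoact H} (hM : IsYetterDrinfeld M) (N L : ActCoact H) :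
    (α_ M.X N.X L.X).hom ≫ (β_ M.X (N.X ⊗ L.X)).hom ≫
        diagCoact N.coact L.coact ▷ M.X ≫ (α_ (N.X ⊗ L.X) H M.X).hom ≫ (N.X ⊗ L.X) ◁ M.act ≫
        (α_ N.X L.X M.X).hom =
      ydBraiding M N ▷ L.X ≫ (α_ N.X M.X L.X).hom ≫ N.X ◁ ydBraiding M L := by
  symm
  calc
    _ = 𝟙 _ ⊗≫ (β_ M.X N.X).hom ▷ L.X ⊗≫ N.coact ▷ (M.X ⊗ L.X) ⊗≫
          N.X ◁ (M.act ▷ L.X ≫ (β_ M.X L.X).hom) ⊗≫ N.X ◁ L.coact ▷ M.X ⊗≫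
          N.X ◁ L.X ◁ M.act := by rw [ydBraiding, ydBraiding]; monoidal
    _ = 𝟙 _ ⊗≫ (β_ M.X N.X).hom ▷ L.X ⊗≫ (N.coact ▷ (M.X ⊗ L.X) ≫
          (N.X ⊗ H) ◁ (β_ M.X L.X).hom) ⊗≫ N.X ◁ (β_ H L.X).hom ▷ M.X ⊗≫
          N.X ◁ (L.X ◁ M.act ≫ L.coact ▷ M.X) ⊗≫ N.X ◁ L.X ◁ M.act := by
      rw [BraidedCategory.braiding_naturality_left, BraidedCategory.braiding_tensor_left_hom]
      monoidal
    _ = 𝟙 _ ⊗≫ (β_ M.X N.X).hom ▷ L.X ⊗≫ N.X ◁ (β_ M.X L.X).hom ⊗≫ N.coact ▷ (L.X ⊗ M.X) ⊗≫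
          N.X ◁ ((β_ H L.X).hom ≫ L.coact ▷ H) ▷ M.X ⊗≫
          N.X ◁ L.X ◁ ((α_ H H M.X).hom ≫ H ◁ M.act ≫ M.act) := by
      rw [← whisker_exchange N.coact, whisker_exchange L.coact]; monoidal
    _ = _ := by
      rw [← BraidedCategory.braiding_naturality_right, BraidedCategory.braiding_tensor_right_hom,
        ← hM.mul_act, diagCoact, tensorμ, opMul, MonoidalCategory.tensorHom_def,
        BraidedCategory.braiding_tensor_right_hom]
      monoidal

/-- The hexagon for a braiding with `M ⊗ N` amounts to the coassociativity of the coaction on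
`L`. -/
theorem ydBraiding_hexagon_reverse {L : ActCoact H} (hL : IsYetterDrinfeld L) (M N : ActCoact H) :
    (α_ M.X N.X L.X).inv ≫ (β_ (M.X ⊗ N.X) L.X).hom ≫
        L.coact ▷ (M.X ⊗ N.X) ≫ (α_ L.X H (M.X ⊗ N.X)).hom ≫ L.X ◁ diagAct M.act N.act ≫
        (α_ L.X M.X N.X).inv =
      M.X ◁ ydBraiding N L ≫ (α_ M.X L.X N.X).inv ≫ ydBraiding M L ▷ N.X := by
  have e : M.X ◁ L.coact ≫ (α_ M.X L.X H).inv ≫ (β_ M.X L.X).hom ▷ H =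
      (β_ M.X L.X).hom ≫ L.coact ▷ M.X ≫ (α_ L.X H M.X).hom ≫ L.X ◁ (β_ H M.X).hom ≫
        (α_ L.X M.X H).inv := by
    rw [← BraidedCategory.braiding_naturality_right_assoc,
      BraidedCategory.braiding_tensor_right_hom]
    symm
    calc
      _ = 𝟙 _ ⊗≫ M.X ◁ L.coact ⊗≫ (β_ M.X L.X).hom ▷ H ⊗≫
            L.X ◁ ((β_ M.X H).hom ≫ (β_ H M.X).hom) ⊗≫ 𝟙 _ := by monoidal
      _ = _ := by rw [hH.hom_hom']; monoidal
  symm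
  calc
    _ = 𝟙 _ ⊗≫ M.X ◁ (β_ N.X L.X).hom ⊗≫ M.X ◁ L.coact ▷ N.X ⊗≫
          ((M.X ⊗ L.X) ◁ N.act ≫ (β_ M.X L.X).hom ▷ N.X) ⊗≫ L.coact ▷ M.X ▷ N.X ⊗≫
          L.X ◁ M.act ▷ N.X ⊗≫ 𝟙 _ := by rw [ydBraiding, ydBraiding]; monoidal
    _ = 𝟙 _ ⊗≫ M.X ◁ (β_ N.X L.X).hom ⊗≫
          (M.X ◁ L.coact ≫ (α_ M.X L.X H).inv ≫ (β_ M.X L.X).hom ▷ H) ▷ N.X ⊗≫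
          ((L.X ⊗ M.X) ◁ N.act ≫ (L.coact ▷ M.X) ▷ N.X) ⊗≫ L.X ◁ M.act ▷ N.X ⊗≫ 𝟙 _ := by
      rw [whisker_exchange]; monoidal
    _ = 𝟙 _ ⊗≫ M.X ◁ (β_ N.X L.X).hom ⊗≫ (β_ M.X L.X).hom ▷ N.X ⊗≫
          L.coact ▷ (M.X ⊗ N.X) ⊗≫ (L.X ◁ (β_ H M.X).hom ≫ L.coact ▷ (M.X ⊗ H)) ▷ N.X ⊗≫
          L.X ◁ ((H ⊗ M.X) ◁ N.act ≫ M.act ▷ N.X) ⊗≫ 𝟙 _ := by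
      rw [e, whisker_exchange]; monoidal
    _ = 𝟙 _ ⊗≫ M.X ◁ (β_ N.X L.X).hom ⊗≫ (β_ M.X L.X).hom ▷ N.X ⊗≫
          (L.coact ≫ L.coact ▷ H ≫ (α_ L.X H H).hom) ▷ (M.X ⊗ N.X) ⊗≫
          L.X ◁ H ◁ (β_ H M.X).hom ▷ N.X ⊗≫ L.X ◁ M.act ▷ (H ⊗ N.X) ⊗≫
          L.X ◁ M.X ◁ N.act ⊗≫ 𝟙 _ := by
      rw [whisker_exchange, whisker_exchange]; monoidal
    _ = _ := by
      rw [← hL.coact_comul, diagAct, tensorμ, MonoidalCategory.tensorHom_def,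
        BraidedCategory.braiding_tensor_left_hom]
      monoidal

end

section
variable {H : C} [HopfObj H]

/-- The braiding is invertible, since `n ⊗ m ↦ n₀ ⊗ S(n₁) m` inverts `n ⊗ m ↦ n₀ ⊗ n₁ m`. -/
theorem ydBraiding_isIso {M N : ActCoact H} (hM : IsYetterDrinfeld M) (hN : IsYetterDrinfeld N) :
    IsIso (ydBraiding M N) := by
  have : IsIso (coactAct N M (𝟙 H)) := by
    refine ⟨coactAct N M 𝒮[H], ?_, ?_⟩
    · rw [coactAct_comp hN hM, tensorHom_id, HopfObj.antipode_left, coactAct_counit_unit hN hM]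
    · rw [coactAct_comp hN hM, id_tensorHom, HopfObj.antipode_right, coactAct_counit_unit hN hM]
  rw [ydBraiding_eq]
  infer_instance

end
end

/-! ### Tensor products of Yetter-Drinfel'd modules -/

section
variable {C : Type u} [Category.{v} C] [MonoidalCategory C] [BraidedCategory C]
variable {H : C} [HopfObj H] [IsIso 𝒮[H]] [HasRightDual H] [Fact (IsTransparent H)]

attribute [local instance] dualBimon doubleBimon

variable (H) in
omit [IsIso 𝒮[H]] in
theorem isComonHom_inclH : IsComonHom (inclH H Hᘁ) := isComonHom_one_tensor Hᘁ H

variable (H) in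
omit [IsIso 𝒮[H]] in
theorem isComonHom_inclB : IsComonHom (inclB H Hᘁ) := isComonHom_tensor_one H Hᘁ

theorem actOfDouble_tensor (M N : Mod C (double H)) :
    actOfDouble H (M ⊗ N) = diagAct (actOfDouble H M) (actOfDouble H N) :=
  haveI := isComonHom_inclH H
  diagAct_restrict (inclH H Hᘁ) γ[double H, M.X] γ[double H, N.X]

theorem dualActOfDouble_tensor (M N : Mod C (double H)) :
    dualActOfDouble H (M ⊗ N) = diagAct (dualActOfDouble H M) (dualActOfDouble H N) :=
  haveI := isComonHom_inclB H
  diagAct_restrict (inclB H Hᘁ) γ[double H, M.X] γ[double H, N.X]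

theorem coactOfDouble_tensor (M N : Mod C (double H)) :
    coactOfDouble H (M ⊗ N) = diagCoact (coactOfDouble H M) (coactOfDouble H N) := by
  have h := contract_diagInsert (B := Hᘁ) Fact.out (isMate_dualComul H (opMul H))
    (uncontract H (dualActOfDouble H M)) (uncontract H (dualActOfDouble H N))
  rw [contract_uncontract, contract_uncontract, ← dualActOfDouble_tensor] at h
  rw [coactOfDouble_eq M, coactOfDouble_eq N, ← diagInsert_braiding Fact.out, ← uncontract_eq h]
  exact coactOfDouble_eq (M ⊗ N)

theorem actOfDouble_unit : actOfDouble H (𝟙_ (Mod C (double H))) = unitAct H :=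
  haveI := isComonHom_inclH H
  unitAct_restrict (inclH H Hᘁ)

theorem dualActOfDouble_unit : dualActOfDouble H (𝟙_ (Mod C (double H))) = unitAct Hᘁ :=
  haveI := isComonHom_inclB H
  unitAct_restrict (inclB H Hᘁ)

theorem coactOfDouble_unit : coactOfDouble H (𝟙_ (Mod C (double H))) = unitCoact H := by
  have h : contract Hᘁ (η[H] ≫ (ρ_ H).inv) = unitAct Hᘁ := contract_unit (by
    change _ = _ ≫ dualCounit η[H]
    simp [dualCounit])
  rw [coactOfDouble_eq, dualActOfDouble_unit, ← unit_braiding, ← uncontract_eq h]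
  rfl

theorem doubleToActCoact_tensor (M N : Mod C (double H)) :
    (doubleToActCoact H).obj (M ⊗ N) = (doubleToActCoact H).obj M ⊗ (doubleToActCoact H).obj N := by
  change ActCoact.mk (M.X ⊗ N.X) (actOfDouble H (M ⊗ N)) (coactOfDouble H (M ⊗ N)) =
    ActCoact.mk (M.X ⊗ N.X) (diagAct (actOfDouble H M) (actOfDouble H N))
      (diagCoact (coactOfDouble H M) (coactOfDouble H N))
  rw [actOfDouble_tensor, coactOfDouble_tensor]

theorem doubleToActCoact_unit :
    (doubleToActCoact H).obj (𝟙_ (Mod C (double H))) = 𝟙_ (ActCoact H) := by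
  change ActCoact.mk (𝟙_ C) (actOfDouble H (𝟙_ (Mod C (double H))))
    (coactOfDouble H (𝟙_ (Mod C (double H)))) = ActCoact.mk (𝟙_ C) (unitAct H) (unitCoact H)
  rw [actOfDouble_unit, coactOfDouble_unit]

variable (H) in
/-- Yetter-Drinfel'd modules are closed under tensor products: they are the objects in the image of
`doubleToActCoact`, which respects tensor products. -/
theorem isMonoidal_isYD : (isYD H).IsMonoidal where
  prop_unit := by
    rw [← doubleToActCoact_unit]
    exact isYD_doubleToActCoact _
  prop_tensor M N hM hN := by
    rw [← doubleToActCoact_doubleMod M hM, ← doubleToActCoact_doubleMod N hN,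
      ← doubleToActCoact_tensor]
    exact isYD_doubleToActCoact _

attribute [local instance] isMonoidal_isYD

/-- The braiding isomorphism of two Yetter-Drinfel'd modules. -/
def ydBraidingIso (M N : YD H) : M ⊗ N ≅ N ⊗ M :=
  haveI := ydBraiding_isIso M.property N.property
  (isYD H).isoMk (ActCoact.mkIso (M := M.obj ⊗ N.obj) (N := N.obj ⊗ M.obj)
    (asIso (ydBraiding M.obj N.obj)) (ydBraiding_linear Fact.out M.property N.property)
    (ydBraiding_colinear Fact.out M.property N.property))

omit [IsIso 𝒮[H]] [HasRightDual H] [Fact (IsTransparent H)] in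
theorem yd_hom_ext {M N : YD H} {f g : M ⟶ N} (h : f.hom.hom = g.hom.hom) : f = g :=
  ObjectProperty.hom_ext _ (ActCoact.hom_ext h)

variable (H) in
/-- Yetter-Drinfel'd modules form a braided category. -/
abbrev ydBraidedCategory : BraidedCategory (YD H) where
  braiding := ydBraidingIso
  braiding_naturality_right X Y Z f := by
    apply yd_hom_ext
    have := ydBraiding_natural (𝟙 X.obj) f.hom
    rw [ActCoact.id_hom, id_tensorHom, tensorHom_id] at this
    exact this
  braiding_naturality_left {X Y} f Z := by
    apply yd_hom_ext
    have := ydBraiding_natural f.hom (𝟙 Z.obj)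
    rw [ActCoact.id_hom, id_tensorHom, tensorHom_id] at this
    exact this
  hexagon_forward X Y Z := by
    apply yd_hom_ext
    refine Eq.trans ?_ (ydBraiding_hexagon_forward X.property Y.obj Z.obj)
    change _ ≫ ydBraiding X.obj (Y.obj ⊗ Z.obj) ≫ _ = _
    simp only [ydBraiding, Category.assoc]
    rfl
  hexagon_reverse X Y Z := by
    apply yd_hom_ext
    refine Eq.trans ?_ (ydBraiding_hexagon_reverse Fact.out Z.property X.obj Y.obj)
    change _ ≫ ydBraiding (X.obj ⊗ Y.obj) Z.obj ≫ _ = _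
    simp only [ydBraiding, Category.assoc]
    rfl

/-- A morphism that is linear over `H` and colinear is linear over the double. -/
theorem double_linear {M N : Mod C (double H)} (f : M.X ⟶ N.X)
    (h : actOfDouble H M ≫ f = H ◁ f ≫ actOfDouble H N)
    (h' : coactOfDouble H M ≫ f ▷ H = f ≫ coactOfDouble H N) :
    γ[double H, M.X] ≫ f = double H ◁ f ≫ γ[double H, N.X] := by
  have e : ∀ L : Mod C (double H), γ[double H, L.X] =
      smashAct (actOfDouble H L) (dualActOfDouble H L) := fun L =>
    (smashAct_incl (isDistributive_doubleExch H) (double_mul_smul L)).symm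
  have h3 : dualActOfDouble H M ≫ f = Hᘁ ◁ f ≫ dualActOfDouble H N := by
    have e' : ∀ L : Mod C (double H), dualActOfDouble H L =
        contract Hᘁ (coactOfDouble H L ≫ (β_ L.X H).hom) := fun L =>
      (dualActOfCoact_doubleToActCoact L).symm
    rw [e', e', ← contract_comp, ← comp_contract, Category.assoc,
      ← BraidedCategory.braiding_naturality_left, reassoc_of% h']
  rw [e, e]
  exact smashAct_natural h h3

end

/-! ### Braided categories and the isomorphism -/

section
variable {C : Type u} [Category.{v} C] [MonoidalCategory C] [BraidedCategory C]

omit [BraidedCategory C] in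
theorem id_linear {H M : C} (a : H ⊗ M ⟶ M) : a ≫ 𝟙 M = H ◁ 𝟙 M ≫ a := by simp

omit [BraidedCategory C] in
theorem id_colinear {H M : C} (a : M ⟶ M ⊗ H) : a ≫ 𝟙 M ▷ H = 𝟙 M ≫ a := by simp

/-- Inserting the dual basis and letting its legs act on `M` and `N` is the same as coacting on `N`
and acting on `M` with the coefficient. -/
theorem braiding_tensorμ_dual {H B M N : C} [ExactPairing H B]
    (hB : (β_ B M).hom ≫ (β_ M B).hom = 𝟙 _)
    (a : H ⊗ M ⟶ M) (b : B ⊗ N ⟶ N) :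
      (λ_ (M ⊗ N)).inv ≫ η_ H B ▷ (M ⊗ N) ≫ tensorμ H B M N ≫ (a ⊗ₘ b) ≫
        (β_ M N).hom =
      (β_ M N).hom ≫ (uncontract H b ≫ (β_ H N).hom) ▷ M ≫ (α_ N H M).hom ≫
        N ◁ a := by
  have n1 : M ◁ b ≫ (β_ M N).hom = 𝟙 _ ⊗≫ (β_ M B).hom ▷ N ⊗≫ B ◁ (β_ M N).hom ⊗≫ b ▷ M := by
    rw [BraidedCategory.braiding_naturality_right, BraidedCategory.braiding_tensor_right_hom]
    monoidal
  have n2 : a ▷ B ≫ (β_ M B).hom = 𝟙 _ ⊗≫ H ◁ (β_ M B).hom ⊗≫ (β_ H B).hom ▷ M ⊗≫ B ◁ a := by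
    rw [BraidedCategory.braiding_naturality_left, BraidedCategory.braiding_tensor_left_hom]
    monoidal
  have n3 : a ▷ N ≫ (β_ M N).hom = 𝟙 _ ⊗≫ H ◁ (β_ M N).hom ⊗≫ (β_ H N).hom ▷ M ⊗≫ N ◁ a := by
    rw [BraidedCategory.braiding_naturality_left, BraidedCategory.braiding_tensor_left_hom]
    monoidal
  have n4 : H ◁ b ≫ (β_ H N).hom = 𝟙 _ ⊗≫ (β_ H B).hom ▷ N ⊗≫ B ◁ (β_ H N).hom ⊗≫ b ▷ H := by
    rw [BraidedCategory.braiding_naturality_right, BraidedCategory.braiding_tensor_right_hom]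
    monoidal
  calc
    _ = 𝟙 _ ⊗≫ η_ H B ▷ (M ⊗ N) ⊗≫ H ◁ (β_ B M).hom ▷ N ⊗≫ a ▷ (B ⊗ N) ⊗≫
        (M ◁ b ≫ (β_ M N).hom) := by
      rw [tensorμ, MonoidalCategory.tensorHom_def]; monoidal
    _ = 𝟙 _ ⊗≫ η_ H B ▷ (M ⊗ N) ⊗≫ H ◁ (β_ B M).hom ▷ N ⊗≫ (a ▷ B ≫ (β_ M B).hom) ▷ N ⊗≫
        B ◁ (β_ M N).hom ⊗≫ b ▷ M := by
      rw [n1]; monoidal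
    _ = 𝟙 _ ⊗≫ η_ H B ▷ (M ⊗ N) ⊗≫ H ◁ ((β_ B M).hom ≫ (β_ M B).hom) ▷ N ⊗≫
        (β_ H B).hom ▷ (M ⊗ N) ⊗≫ B ◁ (a ▷ N ≫ (β_ M N).hom) ⊗≫ b ▷ M := by
      rw [n2]; monoidal
    _ = 𝟙 _ ⊗≫ η_ H B ▷ (M ⊗ N) ⊗≫ ((β_ H B).hom ▷ (M ⊗ N) ≫ (B ⊗ H) ◁ (β_ M N).hom) ⊗≫
        B ◁ (β_ H N).hom ▷ M ⊗≫ ((B ⊗ N) ◁ a ≫ b ▷ M) := by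
      rw [hB, n3]; monoidal
    _ = 𝟙 _ ⊗≫ (η_ H B ▷ (M ⊗ N) ≫ (H ⊗ B) ◁ (β_ M N).hom) ⊗≫ ((β_ H B).hom ▷ (N ⊗ M)) ⊗≫
        B ◁ (β_ H N).hom ▷ M ⊗≫ b ▷ (H ⊗ M) ⊗≫ N ◁ a := by
      rw [← whisker_exchange, whisker_exchange b a]; monoidal
    _ = 𝟙 _ ⊗≫ (𝟙_ C) ◁ (β_ M N).hom ⊗≫ η_ H B ▷ (N ⊗ M) ⊗≫
        (H ◁ b ≫ (β_ H N).hom) ▷ M ⊗≫ N ◁ a := by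
      rw [n4, ← whisker_exchange]; monoidal
    _ = _ := by
      rw [uncontract]; monoidal

variable {H : C} [HopfObj H] [IsIso 𝒮[H]] [HasRightDual H] [Fact (IsTransparent H)]

attribute [local instance] dualBimon doubleBimon isMonoidal_isYD ydBraidedCategory

variable (H) in
/-- The functor from modules over the double to Yetter-Drinfel'd modules. -/
abbrev doubleToYD : Mod C (double H) ⥤ YD H :=
  (isYD H).lift (doubleToActCoact H) isYD_doubleToActCoact

instance : (doubleToYD H).Faithful where
  map_injective {M N f g} h := by
    ext
    exact congrArg (fun k : (doubleToYD H).obj M ⟶ (doubleToYD H).obj N => k.hom.hom) h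

/-- The monoidal structure of `doubleToYD`, with identities as structure morphisms. -/
instance : (doubleToYD H).Monoidal :=
  Functor.CoreMonoidal.toMonoidal
    { εIso := (isYD H).isoMk (ActCoact.mkIso (M := 𝟙_ (ActCoact H))
        (N := (doubleToActCoact H).obj (𝟙_ (Mod C (double H)))) (Iso.refl (𝟙_ C))
        (by
          change unitAct H ≫ 𝟙 _ = H ◁ 𝟙 _ ≫ actOfDouble H (𝟙_ (Mod C (double H)))
          rw [actOfDouble_unit]
          exact id_linear (unitAct H))
        (by
          change unitCoact H ≫ 𝟙 _ ▷ H = 𝟙 _ ≫ coactOfDouble H (𝟙_ (Mod C (double H)))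
          rw [coactOfDouble_unit]
          exact id_colinear (unitCoact H)))
      μIso M N := (isYD H).isoMk (ActCoact.mkIso
        (M := (doubleToActCoact H).obj M ⊗ (doubleToActCoact H).obj N)
        (N := (doubleToActCoact H).obj (M ⊗ N)) (Iso.refl (M.X ⊗ N.X))
        (by
          change diagAct (actOfDouble H M) (actOfDouble H N) ≫ 𝟙 _ = H ◁ 𝟙 _ ≫ actOfDouble H (M ⊗ N)
          rw [actOfDouble_tensor]
          exact id_linear (diagAct (actOfDouble H M) (actOfDouble H N)))
        (by
          change diagCoact (coactOfDouble H M) (coactOfDouble H N) ≫ 𝟙 _ ▷ H =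
            𝟙 _ ≫ coactOfDouble H (M ⊗ N)
          rw [coactOfDouble_tensor]
          exact id_colinear (diagCoact (coactOfDouble H M) (coactOfDouble H N))))
      μIso_hom_natural_left {M N} f L := by
        apply yd_hom_ext
        change f.hom ▷ L.X ≫ 𝟙 (N.X ⊗ L.X) = 𝟙 (M.X ⊗ L.X) ≫ f.hom ▷ L.X
        simp
      μIso_hom_natural_right {M N} L f := by
        apply yd_hom_ext
        change L.X ◁ f.hom ≫ 𝟙 (L.X ⊗ N.X) = 𝟙 (L.X ⊗ M.X) ≫ L.X ◁ f.hom
        simp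
      associativity M N L := by
        apply yd_hom_ext
        change 𝟙 (M.X ⊗ N.X) ▷ L.X ≫ 𝟙 ((M.X ⊗ N.X) ⊗ L.X) ≫ (α_ M.X N.X L.X).hom =
          (α_ M.X N.X L.X).hom ≫ M.X ◁ 𝟙 (N.X ⊗ L.X) ≫ 𝟙 (M.X ⊗ N.X ⊗ L.X)
        simp
      left_unitality M := by
        apply yd_hom_ext
        change (λ_ M.X).hom = 𝟙 (𝟙_ C) ▷ M.X ≫ 𝟙 (𝟙_ C ⊗ M.X) ≫ (λ_ M.X).hom
        simp
      right_unitality M := by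
        apply yd_hom_ext
        change (ρ_ M.X).hom = M.X ◁ 𝟙 (𝟙_ C) ≫ 𝟙 (M.X ⊗ 𝟙_ C) ≫ (ρ_ M.X).hom
        simp }

/-- The braiding isomorphism of two modules over the double. -/
def doubleBraidingIso (M N : Mod C (double H)) : M ⊗ N ≅ N ⊗ M :=
  haveI : IsIso (ydBraiding ((doubleToActCoact H).obj M) ((doubleToActCoact H).obj N)) :=
    ydBraiding_isIso (isYD_doubleToActCoact M) (isYD_doubleToActCoact N)
  modIso (M := M ⊗ N) (N := N ⊗ M)
    (@asIso C _ (M.X ⊗ N.X) (N.X ⊗ M.X)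
      (ydBraiding ((doubleToActCoact H).obj M) ((doubleToActCoact H).obj N)) this)
    (double_linear (M := M ⊗ N) (N := N ⊗ M) _
      (by
        rw [actOfDouble_tensor, actOfDouble_tensor]
        exact ydBraiding_linear Fact.out (isYD_doubleToActCoact M) (isYD_doubleToActCoact N))
      (by
        rw [coactOfDouble_tensor, coactOfDouble_tensor]
        exact ydBraiding_colinear Fact.out (isYD_doubleToActCoact M) (isYD_doubleToActCoact N)))

theorem doubleBraidingIso_comm (M N : Mod C (double H)) :
    Functor.LaxMonoidal.μ (doubleToYD H) M N ≫ (doubleToYD H).map (doubleBraidingIso M N).hom =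
      (β_ ((doubleToYD H).obj M) ((doubleToYD H).obj N)).hom ≫
        Functor.LaxMonoidal.μ (doubleToYD H) N M := by
  apply yd_hom_ext
  exact (Category.id_comp (ydBraiding ((doubleToActCoact H).obj M)
    ((doubleToActCoact H).obj N))).trans (Category.comp_id _).symm

variable (H) in
/-- Modules over the double form a braided category, since their braiding is mapped by the faithful
functor `doubleToYD` to the one of Yetter-Drinfel'd modules. -/
abbrev doubleBraidedCategory : BraidedCategory (Mod C (double H)) :=
  .ofFaithful (doubleToYD H) doubleBraidingIso doubleBraidingIso_comm

attribute [local instance] doubleBraidedCategory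

variable (H) in
instance braided_doubleToYD : (doubleToYD H).Braided where
  braided := doubleBraidingIso_comm

omit [IsIso 𝒮[H]] [HasRightDual H] [Fact (IsTransparent H)] in
theorem yd_eqToHom_hom {M N : YD H} (h : M = N) (h' : M.obj.X = N.obj.X) :
    (eqToHom h).hom.hom = eqToHom h' := by
  subst h; rfl

theorem mod_eqToHom_hom {M N : Mod C (double H)} (h : M = N) (h' : M.X = N.X) :
    (eqToHom h).hom = eqToHom h' := by
  subst h; rfl

theorem doubleToYD_comp_ydToDouble : doubleToYD H ⋙ ydToDouble = 𝟭 _ := by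
  refine CategoryTheory.Functor.ext (fun M => doubleMod_doubleToActCoact M) fun M N f => ?_
  apply Mod.hom_ext
  refine Eq.trans ?_ (congrArg₂ (fun x y => x ≫ f.hom ≫ y)
    (mod_eqToHom_hom (doubleMod_doubleToActCoact M) rfl)
    (mod_eqToHom_hom (doubleMod_doubleToActCoact N).symm rfl)).symm
  change f.hom = 𝟙 _ ≫ f.hom ≫ 𝟙 _
  simp

theorem ydToDouble_comp_doubleToYD : ydToDouble ⋙ doubleToYD H = 𝟭 _ := by
  have h : ∀ M : YD H, (doubleToYD H).obj (ydToDouble.obj M) = M := fun M => by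
    obtain ⟨M, hM⟩ := M
    exact ObjectProperty.FullSubcategory.ext (doubleToActCoact_doubleMod M hM)
  refine CategoryTheory.Functor.ext h fun M N f => ?_
  apply yd_hom_ext
  refine Eq.trans ?_ (congrArg₂ (fun x y => x ≫ f.hom.hom ≫ y)
    (yd_eqToHom_hom (h M) rfl) (yd_eqToHom_hom (h N).symm rfl)).symm
  change f.hom.hom = 𝟙 _ ≫ f.hom.hom ≫ 𝟙 _
  simp

omit [IsIso 𝒮[H]] in
theorem doubleR_eq : doubleR H = η_ H Hᘁ ≫ (inclH H Hᘁ ⊗ₘ inclB H Hᘁ) := by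
  change η_ H Hᘁ ≫ ((λ_ H).inv ⊗ₘ (ρ_ Hᘁ).inv) ≫ (dualOne ε[H] ▷ H ⊗ₘ Hᘁ ◁ η[H]) = _
  rw [tensorHom_comp_tensorHom]
  rfl

/-- The braiding defined by the canonical `R`-matrix is the one of Yetter-Drinfel'd modules. -/
theorem braidingOfR_doubleR (M N : Mod C (double H)) :
    braidingOfR (doubleR H) M N =
      ydBraiding ((doubleToActCoact H).obj M) ((doubleToActCoact H).obj N) := by
  have hB : (β_ Hᘁ M.X).hom ≫ (β_ M.X Hᘁ).hom = 𝟙 _ := by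
    rw [(Fact.out : IsTransparent H).rightDual M.X]; simp
  change _ = (β_ M.X N.X).hom ≫ coactOfDouble H N ▷ M.X ≫ (α_ N.X H M.X).hom ≫
        N.X ◁ actOfDouble H M
  rw [coactOfDouble_eq, ← braiding_tensorμ_dual hB, braidingOfR, doubleR_eq]
  refine (congrArg (fun x => (λ_ (M.X ⊗ N.X)).inv ≫ x) (comp_whiskerRight_assoc
    (η_ H Hᘁ) (inclH H Hᘁ ⊗ₘ inclB H Hᘁ) (M.X ⊗ N.X) _)).trans ?_
  refine congrArg (fun x => (λ_ (M.X ⊗ N.X)).inv ≫ η_ H Hᘁ ▷ (M.X ⊗ N.X) ≫ x) ?_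
  refine (tensorμ_natural_left_assoc (inclH H Hᘁ) (inclB H Hᘁ) M.X N.X _).trans ?_
  refine congrArg (fun x => tensorμ H Hᘁ M.X N.X ≫ x) ?_
  exact tensorHom_comp_tensorHom_assoc _ _ _ _ _

end

end

end BraidedDouble

theorem mainTheorem1 {C : Type u} [Category.{v} C] [MonoidalCategory C] [BraidedCategory C]
    (H : C) [HopfObj H] [IsIso 𝒮[H]] [HasRightDual H]
    (hH : ∀ M : C, (β_ H M).hom = (β_ M H).inv) :
    ∃ (D : BimonObj (BraidedDouble.double H)) (_ : (BraidedDouble.isYD H).IsMonoidal)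
      (_ : BraidedCategory (BraidedDouble.YD H))
      (_ : BraidedCategory (Mod C (BraidedDouble.double H)))
      (hF : ∀ M : Mod C (BraidedDouble.double H),
        BraidedDouble.isYD H ((BraidedDouble.doubleToActCoact H).obj M))
      (_ : ((BraidedDouble.isYD H).lift (BraidedDouble.doubleToActCoact H) hF).Braided),
      -- the bialgebra structure of the Drinfel'd double
      (D.mul = BraidedDouble.doubleMul H ∧ D.one = BraidedDouble.doubleOne H ∧
        D.comul = BraidedDouble.doubleComul H ∧ D.counit = BraidedDouble.doubleCounit H) ∧
      -- the two braidings
      (∀ M N : BraidedDouble.YD H,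
        (β_ M N).hom.hom.hom = BraidedDouble.ydBraiding M.obj N.obj) ∧
      (∀ M N : Mod C (BraidedDouble.double H),
        (β_ M N).hom.hom = BraidedDouble.braidingOfR (BraidedDouble.doubleR H) M N) ∧
      -- the functor from modules over the double to Yetter-Drinfel'd modules is an isomorphism of
      -- categories, and its monoidal structure is strict
      (∃ G : BraidedDouble.YD H ⥤ Mod C (BraidedDouble.double H),
        (BraidedDouble.isYD H).lift (BraidedDouble.doubleToActCoact H) hF ⋙ G = 𝟭 _ ∧
        G ⋙ (BraidedDouble.isYD H).lift (BraidedDouble.doubleToActCoact H) hF = 𝟭 _) ∧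
      (Functor.LaxMonoidal.ε
        ((BraidedDouble.isYD H).lift (BraidedDouble.doubleToActCoact H) hF)).hom.hom = 𝟙 (𝟙_ C) ∧
      (∀ M N : Mod C (BraidedDouble.double H),
        (Functor.LaxMonoidal.μ
          ((BraidedDouble.isYD H).lift (BraidedDouble.doubleToActCoact H) hF) M N).hom.hom =
          𝟙 (M.X ⊗ N.X)) := by
  have : Fact (BraidedDouble.IsTransparent H) := ⟨hH⟩
  exact ⟨BraidedDouble.doubleBimonObj H hH, BraidedDouble.isMonoidal_isYD H,
    BraidedDouble.ydBraidedCategory H, BraidedDouble.doubleBraidedCategory H,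
    BraidedDouble.isYD_doubleToActCoact, BraidedDouble.braided_doubleToYD H,
    ⟨BraidedDouble.doubleBimonObj_mul H hH, rfl, BraidedDouble.doubleBimonObj_comul H hH, rfl⟩,
    fun _ _ => rfl, fun M N => (BraidedDouble.braidingOfR_doubleR M N).symm,
    ⟨BraidedDouble.ydToDouble, BraidedDouble.doubleToYD_comp_ydToDouble,
      BraidedDouble.ydToDouble_comp_doubleToYD⟩, rfl, fun _ _ => rfl⟩
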